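/- **Setting.** Let $n\ge 3$, let $\Sigma$ be a Riemann surface, and equip $\mathbb C^{n+2}=(\mathbb R^{n+1,1})^{\mathbb C}$ with the complex bilinear extension $(\cdot,\cdot)$ of the Lorentzian metric. Let $\underline{\mathbb C}^{n+2}=\Sigma\times\mathbb C^{n+2}$ with its trivial flat connection $d$. Sections, subbundles and forms are $C^\infty$. Identify $\wedge^2\mathbb C^{n+2}$ with the orthogonal Lie algebra by $u\wedge v(w)=(u,w)v-(v,w)u$, write $\mathrm{Ad}_g\xi=g\xi g^{-1}$, and write $\alpha=\alpha^{1,0}+\alpha^{0,1}$ for the type decomposition of a $1$-form (and similarly $d=d^{1,0}+d^{0,1}$). *Definitions.* A *surface* is a pair $(\Lambda^{1,0},\Lambda^{0,1})$ of isotropic rank $2$ subbundles of $\underline{\mathbb C}^{n+2}$ that intersect in a rank $1$ bundle $\Lambda$, with $d^{1,0}\Gamma\Lambda\subset\Omega^{1,0}\Lambda^{1,0}$ and $d^{0,1}\Gamma\Lambda\subset\Omega^{0,1}\Lambda^{0,1}$. For a non-degenerate subbundle $V$ with orthogonal projections $\pi_V,\pi_{V^\perp}$, let $\mathcal D_V=\pi_V\circ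 d\circ\pi_V+\pi_{V^\perp}\circ d\circ\pi_{V^\perp}$ and $\mathcal N_V=d-\mathcal D_V$. A *central sphere congruence* of $(\Lambda^{1,0},\Lambda^{0,1})$ is a non-degenerate rank $4$ subbundle $V\supset\Lambda^{1,0}+\Lambda^{0,1}$ with $\mathcal N_V^{1,0}\Lambda^{0,1}=0=\mathcal N_V^{0,1}\Lambda^{1,0}$. A non-degenerate subbundle $V$ is *$q$-constrained harmonic*, for a $1$-form $q$ with values in $\wedge^2V\oplus\wedge^2V^\perp$, if for every $\lambda\in\mathbb C\setminus\{0\}$ the connection $$d^{\lambda,q}_V=\mathcal D_V+\lambda^{-1}\mathcal N_V^{1,0}+\lambda\,\mathcal N_V^{0,1}+(\lambda^{-2}-1)q^{1,0}+(\lambda^{2}-1)q^{0,1}$$ is flat. The surface is *$q$-constrained Willmore* if it admits a $q$-constrained harmonic central sphere congruence and $q^{1,0}\in\Omega^{1,0}(\wedge^2\Lambda^{0,1})$, $q^{0,1}\in\Omega^{0,1}(\wedge^2\Lambda^{1,0})$. **Theorem.** Let $(\Lambda^{1,0},\Lambda^{0,1})$ be a $q$-constrained Willmore surface with $q$-constrained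 harmonic central sphere congruence $V$, and let $\rho=\pi_V-\pi_{V^\perp}$. Let $\lambda\mapsto r(\lambda)\in\Gamma(O(\underline{\mathbb C}^{n+2}))$ be rational in $\lambda$ (that is, $r(\lambda)=p(\lambda)^{-1}\sum_{k=0}^N\lambda^kc_k$ with $p$ a complex polynomial and $c_k$ sections of $\mathrm{End}(\underline{\mathbb C}^{n+2})$), defined away from finitely many poles in $\mathbb C$, holomorphic and invertible at $\lambda=0$ and $\lambda=\infty$, defined at $\lambda=1$, and twisted: $\rho\,r(\lambda)\,\rho^{-1}=r(-\lambda)$ on the domain of $r$. Suppose that $\lambda\mapsto r(\lambda)\circ d^{\lambda,q}_V\circ r(\lambda)^{-1}$ extends holomorphically to $\lambda\in\mathbb C\setminus\{0\}$ through metric connections on $\underline{\mathbb C}^{n+2}$, and that $$\det r(0)|_V=\det r(\infty)|_V .$$ Set $\hat q=\mathrm{Ad}_{r(0)}q^{1,0}+\mathrm{Ad}_{r(\infty)}q^{0,1}$. Then $$\bigl(r(1)^{-1}r(\infty)\Lambda^{1,0},\; r(1)^{-1}r(0)\Lambda^{0,1}\bigr)$$ is an $\mathrm{Ad}_{r(1)^{-1}}\hat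 q$-constrained Willmore surface, with $r(1)^{-1}V$ as an $\mathrm{Ad}_{r(1)^{-1}}\hat q$-constrained harmonic central sphere congruence. -/

import Mathlib

open scoped Manifold ContDiff Topology

noncomputable section

namespace Dressing

/-! ### The complexified Lorentzian space -/

/-- `ℂⁿ⁺²`, the complexification of `ℝⁿ⁺¹·¹`. -/
abbrev E (n : ℕ) : Type := Fin (n + 2) → ℂ

/-- `End(ℂⁿ⁺²)`. -/
abbrev EndE (n : ℕ) : Type := E n →L[ℂ] E n

/-- The complex bilinear extension of the Lorentzian metric of `ℝⁿ⁺¹·¹`: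
`(u, v) = u₀v₀ + ⋯ + uₙvₙ - uₙ₊₁vₙ₊₁`. -/
def form (n : ℕ) : LinearMap.BilinForm ℂ (E n) :=
  LinearMap.mk₂ ℂ
    (fun u v => (∑ i : Fin (n + 1), u i.castSucc * v i.castSucc)
      - u (Fin.last (n + 1)) * v (Fin.last (n + 1)))
    (fun u u' v => by simp only [Pi.add_apply, add_mul, Finset.sum_add_distrib]; ring)
    (fun c u v => by
      simp only [Pi.smul_apply, smul_eq_mul, mul_assoc, ← Finset.mul_sum]; ring)
    (fun u v v' => by simp only [Pi.add_apply, mul_add, Finset.sum_add_distrib]; ring)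
    (fun c u v => by
      simp only [Pi.smul_apply, smul_eq_mul, mul_left_comm _ c, ← Finset.mul_sum]; ring)

variable {n : ℕ}

/-- The orthogonal complement of a subspace. -/
def perp (W : Submodule ℂ (E n)) : Submodule ℂ (E n) := (form n).orthogonal W

/-- The metric restricts to a non-degenerate form on `W`. -/
def Nondeg (W : Submodule ℂ (E n)) : Prop := ((form n).restrict W).Nondegenerate

def Isotropic (W : Submodule ℂ (E n)) : Prop := ∀ u ∈ W, ∀ v ∈ W, form n u v = 0

open Classical in
/-- The orthogonal projection of `ℂⁿ⁺²` onto `W`; it is meaningful when `ℂⁿ⁺² = W ⊕ W^⊥`, i.e. when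
`W` is non-degenerate. -/
def proj (W : Submodule ℂ (E n)) : EndE n :=
  if h : IsCompl W (perp W) then
    LinearMap.toContinuousLinearMap (Submodule.projection W (perp W) h)
  else 0

/-- Reflection across `W`: `π_W - π_{W^⊥}`. -/
def refl (W : Submodule ℂ (E n)) : EndE n := proj W - (1 - proj W)

/-- `T` belongs to the orthogonal group `O(ℂⁿ⁺²)`. -/
def Orthogonal (T : E n ≃L[ℂ] E n) : Prop := ∀ u v, form n (T u) (T v) = form n u v

/-- `u ∧ v`, as the skew-symmetric endomorphism `w ↦ (u, w) v - (v, w) u`. -/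
def wedge (u v : E n) : EndE n :=
  LinearMap.toContinuousLinearMap ((form n u).smulRight v - (form n v).smulRight u)

/-- `⋀² W`, as a space of skew-symmetric endomorphisms. -/
def wedgeSq (W : Submodule ℂ (E n)) : Submodule ℂ (EndE n) :=
  Submodule.span ℂ {T | ∃ u ∈ W, ∃ v ∈ W, T = wedge u v}

open Classical in
/-- The determinant of `T|_W : W → W`, for `T` preserving `W`. -/
def detOn (W : Submodule ℂ (E n)) (T : E n ≃L[ℂ] E n) : ℂ :=
  if h : ∀ w ∈ W, (T : E n →ₗ[ℂ] E n) w ∈ W then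
    LinearMap.det ((T : E n →ₗ[ℂ] E n).restrict h)
  else 0

/-! ### Subbundles of the trivial bundle and forms on a Riemann surface

A Riemann surface is a space `M` charted on `ℂ`, with holomorphic transition maps. Its real tangent
space at `x` is identified with `ℂ` through the preferred chart at `x`, a holomorphic chart, so that
the complex structure of the surface is multiplication by `i`. -/

variable {M : Type*} [TopologicalSpace M] [ChartedSpace ℂ M]

/-- Smooth maps (in the real sense) on a subset of the surface. -/
def SmoothOn {W : Type*} [NormedAddCommGroup W] [NormedSpace ℂ W] (s : M → W) (U : Set M) : Prop :=
  ContMDiffOn 𝓘(ℝ, ℂ) 𝓘(ℝ, W) ∞ s U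

/-- `L` is a smooth complex subbundle of rank `k` of `M × ℂⁿ⁺²`: it has smooth local frames. -/
def IsSubbundle (k : ℕ) (L : M → Submodule ℂ (E n)) : Prop :=
  ∀ x₀ : M, ∃ U : Set M, IsOpen U ∧ x₀ ∈ U ∧ ∃ s : Fin k → M → E n,
    (∀ i, SmoothOn (s i) U) ∧
    ∀ x ∈ U, LinearIndependent ℂ (fun i => s i x) ∧
      Submodule.span ℂ (Set.range fun i => s i x) = L x

/-- The image of a subbundle under a bundle automorphism. -/
def image (g : M → E n ≃L[ℂ] E n) (L : M → Submodule ℂ (E n)) (x : M) : Submodule ℂ (E n) :=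
  (L x).map ((g x : E n ≃L[ℂ] E n) : E n →ₗ[ℂ] E n)

/-- The inverse of a bundle automorphism. -/
def inv (g : M → E n ≃L[ℂ] E n) (x : M) : E n ≃L[ℂ] E n := (g x).symm

/-- A bundle automorphism as a section of the endomorphism bundle. -/
def toEnd (g : M → E n ≃L[ℂ] E n) (x : M) : EndE n := (g x : E n →L[ℂ] E n)

variable (M) in
/-- Complex 1-forms on the surface, with values in `W`. -/
abbrev OneForm (W : Type*) [NormedAddCommGroup W] [NormedSpace ℂ W] : Type _ :=
  ∀ x : M, TangentSpace 𝓘(ℝ, ℂ) x →L[ℝ] W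

/-- The complex structure of the surface, on the tangent space at `x`. -/
def tangentJ (x : M) : TangentSpace 𝓘(ℝ, ℂ) x →L[ℝ] TangentSpace 𝓘(ℝ, ℂ) x :=
  (Complex.I • ContinuousLinearMap.id ℝ ℂ : ℂ →L[ℝ] ℂ)

section Forms

variable {W : Type*} [NormedAddCommGroup W] [NormedSpace ℂ W]

/-- The differential of a `W`-valued function. -/
def diff (s : M → W) : OneForm M W := fun x =>
  (mfderiv 𝓘(ℝ, ℂ) 𝓘(ℝ, W) s x : TangentSpace 𝓘(ℝ, ℂ) x →L[ℝ] W)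

/-- The `(1,0)`-part of a 1-form: `X ↦ (α(X) - i α(JX)) / 2`. -/
def part10 (α : OneForm M W) : OneForm M W := fun x =>
  (1 / 2 : ℂ) • (α x - Complex.I • (α x).comp (tangentJ x))

/-- The `(0,1)`-part of a 1-form: `X ↦ (α(X) + i α(JX)) / 2`. -/
def part01 (α : OneForm M W) : OneForm M W := fun x =>
  (1 / 2 : ℂ) • (α x + Complex.I • (α x).comp (tangentJ x))

/-- The expression of a 1-form in a chart, as a 1-form on an open set of `ℂ`. -/
def inChart (α : OneForm M W) (e : OpenPartialHomeomorph M ℂ) : ℂ → ℂ →L[ℝ] W := fun y =>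
  (α (e.symm y)).comp
    (mfderiv 𝓘(ℝ, ℂ) 𝓘(ℝ, ℂ) e.symm y : ℂ →L[ℝ] TangentSpace 𝓘(ℝ, ℂ) (e.symm y))

def SmoothForm (α : OneForm M W) : Prop :=
  ∀ e ∈ atlas ℂ M, ContDiffOn ℝ ∞ (inChart α e) e.target

end Forms

/-! ### Connections on the trivial bundle

A connection on `M × ℂⁿ⁺²` is `∇ = d + A`, with `d` the trivial flat connection and
`A ∈ Ω¹(End(ℂⁿ⁺²))`, and is represented by `A`; the trivial connection is represented by `0`. -/

/-- `∇s = ds + As`, for a section `s`. -/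
def cov (A : OneForm M (EndE n)) (s : M → E n) : OneForm M (E n) := fun x =>
  diff s x + ((ContinuousLinearMap.apply ℂ (E n) (s x)).restrictScalars ℝ).comp (A x)

/-- The form `T α`, for a section `T` of the endomorphism bundle. -/
def leftMul (T : M → EndE n) (α : OneForm M (EndE n)) : OneForm M (EndE n) := fun x =>
  ((ContinuousLinearMap.compL ℂ (E n) (E n) (E n) (T x)).restrictScalars ℝ).comp (α x)

/-- The form `α T`, for a section `T` of the endomorphism bundle. -/
def rightMul (T : M → EndE n) (α : OneForm M (EndE n)) : OneForm M (EndE n) := fun x =>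
  (((ContinuousLinearMap.compL ℂ (E n) (E n) (E n)).flip (T x)).restrictScalars ℝ).comp (α x)

/-- The form `∇ ∘ T`, for a section `T` of the endomorphism bundle: `v ↦ ∇(Tv)` on constant sections
`v`, i.e. `dT + AT`. -/
def covEnd (A : OneForm M (EndE n)) (T : M → EndE n) : OneForm M (EndE n) := fun x =>
  diff T x + rightMul T A x

/-- `∇` is a metric connection: the connection form takes values in the orthogonal algebra. -/
def IsMetric (A : OneForm M (EndE n)) : Prop :=
  ∀ x X u v, form n (A x X u) v + form n u (A x X v) = 0

/-- `∇` is flat: in every chart, `dA + A ∧ A = 0`. -/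
def IsFlat (A : OneForm M (EndE n)) : Prop :=
  ∀ e ∈ atlas ℂ M, ∀ y ∈ e.target, ∀ u v : ℂ,
    fderiv ℝ (inChart A e) y u v - fderiv ℝ (inChart A e) y v u
      + (inChart A e y u * inChart A e y v - inChart A e y v * inChart A e y u) = 0

/-- The gauged connection `g ∘ ∇ ∘ g⁻¹`. -/
def gauge (g : M → E n ≃L[ℂ] E n) (A : OneForm M (EndE n)) : OneForm M (EndE n) :=
  leftMul (toEnd g) (covEnd A (toEnd (inv g)))

/-- `Ad_g α = g α g⁻¹`. -/
def Ad (g : M → E n ≃L[ℂ] E n) (α : OneForm M (EndE n)) : OneForm M (EndE n) :=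
  leftMul (toEnd g) (rightMul (toEnd (inv g)) α)

/-- `π_V`, as a section of the endomorphism bundle. -/
def projV (V : M → Submodule ℂ (E n)) (x : M) : EndE n := proj (V x)

/-- `𝒟_V`, the sum of the connections induced on `V` and on `V^⊥` by `∇`:
`s ↦ π_V ∇(π_V s) + π_{V^⊥} ∇(π_{V^⊥} s)`. -/
def connD (A : OneForm M (EndE n)) (V : M → Submodule ℂ (E n)) : OneForm M (EndE n) :=
  leftMul (projV V) (covEnd A (projV V))
    + leftMul (1 - projV V) (covEnd A (1 - projV V))

/-- `𝒩_V = ∇ - 𝒟_V`. -/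
def formN (A : OneForm M (EndE n)) (V : M → Submodule ℂ (E n)) : OneForm M (EndE n) :=
  A - connD A V

/-- `𝒟_V + λ⁻¹ 𝒩_V^{1,0} + λ 𝒩_V^{0,1} + (λ⁻² - 1) q^{1,0} + (λ² - 1) q^{0,1}`. -/
def loop (A : OneForm M (EndE n)) (V : M → Submodule ℂ (E n)) (q : OneForm M (EndE n)) (l : ℂ) :
    OneForm M (EndE n) :=
  connD A V + l⁻¹ • part10 (formN A V) + l • part01 (formN A V)
    + ((l ^ 2)⁻¹ - 1) • part10 q + (l ^ 2 - 1) • part01 q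

/-! ### Constrained Willmore surfaces -/

/-- `(L10, L01)` is a (complexified) surface with respect to the connection `∇ = d + A`. -/
structure IsSurface (A : OneForm M (EndE n)) (L10 L01 : M → Submodule ℂ (E n)) : Prop where
  subbundle10 : IsSubbundle 2 L10
  subbundle01 : IsSubbundle 2 L01
  isotropic10 : ∀ x, Isotropic (L10 x)
  isotropic01 : ∀ x, Isotropic (L01 x)
  subbundle_inf : IsSubbundle 1 fun x => L10 x ⊓ L01 x
  cov10 : ∀ (U : Set M) (s : M → E n), IsOpen U → SmoothOn s U → (∀ x ∈ U, s x ∈ L10 x ⊓ L01 x) →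
    ∀ x ∈ U, ∀ X, part10 (cov A s) x X ∈ L10 x
  cov01 : ∀ (U : Set M) (s : M → E n), IsOpen U → SmoothOn s U → (∀ x ∈ U, s x ∈ L10 x ⊓ L01 x) →
    ∀ x ∈ U, ∀ X, part01 (cov A s) x X ∈ L01 x

/-- `V` is a central sphere congruence of `(L10, L01)` with respect to `∇ = d + A`. -/
structure IsCentralSphereCongruence (A : OneForm M (EndE n)) (L10 L01 V : M → Submodule ℂ (E n)) :
    Prop where
  subbundle : IsSubbundle 4 V
  nondeg : ∀ x, Nondeg (V x)
  sup_le : ∀ x, L10 x ⊔ L01 x ≤ V x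
  formN10 : ∀ x X, ∀ u ∈ L01 x, part10 (formN A V) x X u = 0
  formN01 : ∀ x X, ∀ u ∈ L10 x, part01 (formN A V) x X u = 0

/-- `V`, a non-degenerate subbundle, is `(q, ∇)`-constrained harmonic, for `∇ = d + A`. -/
structure IsConstrainedHarmonic (A : OneForm M (EndE n)) (V : M → Submodule ℂ (E n))
    (q : OneForm M (EndE n)) : Prop where
  subbundle : ∃ k, IsSubbundle k V
  nondeg : ∀ x, Nondeg (V x)
  smooth : SmoothForm q
  values : ∀ x X, q x X ∈ wedgeSq (V x) ⊔ wedgeSq (perp (V x))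
  flat : ∀ l : ℂ, l ≠ 0 → IsFlat (loop A V q l)

/-- `(L10, L01)` is a `q`-constrained Willmore surface with respect to `∇ = d + A`, admitting `V` as
a `(q, ∇)`-constrained harmonic central sphere congruence. -/
structure IsConstrainedWillmoreWith (A : OneForm M (EndE n)) (L10 L01 : M → Submodule ℂ (E n))
    (q : OneForm M (EndE n)) (V : M → Submodule ℂ (E n)) : Prop where
  surface : IsSurface A L10 L01
  central : IsCentralSphereCongruence A L10 L01 V
  harmonic : IsConstrainedHarmonic A V q
  mult10 : ∀ x X, part10 q x X ∈ wedgeSq (L01 x)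
  mult01 : ∀ x X, part01 q x X ∈ wedgeSq (L10 x)

/-! ### Dressing -/

/-- `λ ↦ r(λ)` is a rational map into the sections of the orthogonal group of `M × ℂⁿ⁺²`, without
poles outside the finite set `poles` of complex numbers, and holomorphic at `∞` with value `rInf`
there: `r(λ) = p(λ)⁻¹ ∑ₖ λᵏ cₖ`, with `p` a polynomial and `cₖ` sections of the endomorphism bundle.
Values of `r` at `poles` are irrelevant. -/
structure IsRationalOrthogonal (r : ℂ → M → E n ≃L[ℂ] E n) (rInf : M → E n ≃L[ℂ] E n)
    (poles : Finset ℂ) : Prop where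
  rational : ∃ (p : Polynomial ℂ) (N : ℕ) (c : ℕ → M → EndE n),
    (∀ k, SmoothOn (c k) Set.univ) ∧
    ∀ l ∉ poles, p.eval l ≠ 0 ∧
      ∀ x, toEnd (r l) x = (p.eval l)⁻¹ • ∑ k ∈ Finset.range (N + 1), l ^ k • c k x
  tendsto_inf : ∀ x,
    Filter.Tendsto (fun l => toEnd (r l) x) (Bornology.cobounded ℂ) (𝓝 (toEnd rInf x))
  orthogonal : ∀ l ∉ poles, ∀ x, Orthogonal (r l x)
  orthogonal_inf : ∀ x, Orthogonal (rInf x)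

/-- `ρ r(λ) ρ⁻¹ = r(-λ)`, for `ρ = ρ⁻¹` the reflection across `V`. -/
def IsTwisted (V : M → Submodule ℂ (E n)) (r : ℂ → M → E n ≃L[ℂ] E n) (poles : Finset ℂ) : Prop :=
  ∀ l ∉ poles, -l ∉ poles →
    ∀ x, refl (V x) * toEnd (r l) x * refl (V x) = toEnd (r (-l)) x

/-- The family of connections `r(λ) ∘ (d + A λ) ∘ r(λ)⁻¹` extends holomorphically to `λ ∈ ℂ \ {0}`
through metric connections. -/
def HasHolomorphicExtension (A : ℂ → OneForm M (EndE n)) (r : ℂ → M → E n ≃L[ℂ] E n)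
    (poles : Finset ℂ) : Prop :=
  ∃ B : ℂ → OneForm M (EndE n),
    (∀ l, l ≠ 0 → SmoothForm (B l) ∧ IsMetric (B l)) ∧
    (∀ x X, DifferentiableOn ℂ (fun l => B l x X) {0}ᶜ) ∧
    ∀ l, l ≠ 0 → l ∉ poles → B l = gauge (r l) (A l)

/-- `q̂ = Ad_{r(0)} q^{1,0} + Ad_{r(∞)} q^{0,1}`. -/
def qHat (r₀ rInf : M → E n ≃L[ℂ] E n) (q : OneForm M (EndE n)) : OneForm M (EndE n) :=
  Ad r₀ (part10 q) + Ad rInf (part01 q)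

end Dressing

end

open scoped Manifold ContDiff Topology

noncomputable section

namespace Dressing

set_option linter.unusedSectionVars false

variable {n : ℕ}
variable {M : Type*} [TopologicalSpace M] [ChartedSpace ℂ M]

/-! ### Calculus on the surface -/

/-! Write g·∇ for g ∘ ∇ ∘ g⁻¹ and d̂ = r(1)·d. It is enough to show that (r(∞)Λ^{1,0}, r(0)Λ^{0,1})
is q̂-constrained Willmore with congruence V relative to d̂ (`dressed_isConstrainedWillmoreWith`).
Gauging by r(1)⁻¹ turns d̂ back into d, and all the notions involved are covariant under orthogonal
gauges (`IsConstrainedWillmoreWith.gauge`).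

Let B(λ) be the extension of r(λ)·d^{λ,q}. Its (1,0)-part is holomorphic on ℂ \ {0}, has at most a
double pole at 0 and has a limit at ∞, so by Liouville it equals λ⁻²a + λ⁻¹b + c
(`dressed_eq_laurent`), where a = Ad_{r(0)} q^{1,0} and c is the (1,0)-part of r(∞)·(𝒟_V - q).
Twisting makes r(0) and r(∞) commute with ρ, and makes r'(0) anticommute with it. Hence π_V is
parallel for a + c, while b exchanges V and V^⊥: these are the (1,0)-parts of 𝒟_V and 𝒩_V formed
from d̂ = B(1) (`dressed_splitting`). The (0,1)-part is the same statement in the parameter λ⁻¹,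
with r(0) and r(∞) interchanged. So B(λ) is the associated family of d̂ with multiplier q̂. It is
flat away from the poles of r by gauge invariance (`IsFlat.gauge`), and at the poles by continuity
in λ.

The explicit b annihilates r(0)Λ^{0,1} (`dressed_formN_apply_eq_zero`). The derivative condition on
the new line bundle reduces to (𝒟_V - q)^{1,0} preserving Λ^{1,0}, which follows from the maximality
of isotropic planes in V (`dressed_cov_mem`). The determinant condition is what makes the two new
planes meet in a line: isotropic planes of a four-dimensional quadratic space form two families,
planes meeting in a line belong to different ones, and isometries of equal determinant act alike on
the families (`minor_eq_zero_of_isometry`). -/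

theorem isManifold_real [IsManifold 𝓘(ℂ) ω M] : IsManifold 𝓘(ℝ, ℂ) ∞ M := by
  refine isManifold_of_contDiffOn _ _ _ fun e e' he he' => ?_
  have h := (contDiffGroupoid ω 𝓘(ℂ)).compatible (M := M) he he'
  have h2 := (contDiffGroupoid_le (I := 𝓘(ℂ)) (m := ∞) (n := ω) le_top) h
  have h3 := ((mem_groupoid_of_pregroupoid (PG := contDiffPregroupoid ∞ 𝓘(ℂ))).mp h2).1
  exact ContDiffOn.restrict_scalars ℝ h3

section Diff

variable {W : Type*} [NormedAddCommGroup W] [NormedSpace ℂ W]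
  {W₁ : Type*} [NormedAddCommGroup W₁] [NormedSpace ℂ W₁]
  {W₂ : Type*} [NormedAddCommGroup W₂] [NormedSpace ℂ W₂]

/-- Differentiability of a section at a point. -/
abbrev DiffAt (s : M → W) (x : M) : Prop := MDifferentiableAt 𝓘(ℝ, ℂ) 𝓘(ℝ, W) s x

theorem SmoothOn.diffAt {s : M → W} {U : Set M} (h : SmoothOn s U) (hU : IsOpen U) {x : M}
    (hx : x ∈ U) : DiffAt s x :=
  (h.contMDiffAt (hU.mem_nhds hx)).mdifferentiableAt (by simp)

theorem hasMFDerivAt_bilin (B : W₁ →L[ℝ] W₂ →L[ℝ] W) {s : M → W₁} {t : M → W₂} {x : M}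
    (hs : DiffAt s x) (ht : DiffAt t x) :
    HasMFDerivAt 𝓘(ℝ, ℂ) 𝓘(ℝ, W) (fun y => B (s y) (t y)) x
      ((B.flip (t x)).comp (diff s x) + (B (s x)).comp (diff t x)) := by
  have h1 := hs.hasMFDerivAt
  have h2 := ht.hasMFDerivAt
  refine ⟨?_, ?_⟩
  · exact (B.continuous.continuousAt.comp h1.1).clm_apply h2.1
  · have h3 := B.hasFDerivWithinAt_of_bilinear h1.2 h2.2
    have h4 : writtenInExtChartAt 𝓘(ℝ, ℂ) 𝓘(ℝ, W₁) x s (extChartAt 𝓘(ℝ, ℂ) x x) = s x := by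
      simp only [writtenInExtChartAt, mfld_simps]; rfl
    have h5 : writtenInExtChartAt 𝓘(ℝ, ℂ) 𝓘(ℝ, W₂) x t (extChartAt 𝓘(ℝ, ℂ) x x) = t x := by
      simp only [writtenInExtChartAt, mfld_simps]; rfl
    rw [h4, h5, add_comm] at h3
    exact h3

theorem diff_bilin (B : W₁ →L[ℝ] W₂ →L[ℝ] W) {s : M → W₁} {t : M → W₂} {x : M}
    (hs : DiffAt s x) (ht : DiffAt t x) (X) :
    diff (fun y => B (s y) (t y)) x X = B (diff s x X) (t x) + B (s x) (diff t x X) := by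
  rw [diff, (hasMFDerivAt_bilin B hs ht).mfderiv]; rfl

theorem diff_add {s t : M → W} {x : M} (hs : DiffAt s x) (ht : DiffAt t x) :
    diff (s + t) x = diff s x + diff t x :=
  (hs.hasMFDerivAt.add ht.hasMFDerivAt).mfderiv

theorem diff_sub {s t : M → W} {x : M} (hs : DiffAt s x) (ht : DiffAt t x) :
    diff (s - t) x = diff s x - diff t x :=
  (hs.hasMFDerivAt.sub ht.hasMFDerivAt).mfderiv

theorem diff_const (c : W) (x : M) : diff (fun _ => c) x = 0 :=
  (hasMFDerivAt_const c x).mfderiv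

theorem diff_congr {s t : M → W} {x : M} (h : s =ᶠ[𝓝 x] t) : diff s x = diff t x := by
  rw [diff, diff, h.mfderiv_eq]

theorem diff_mul {s t : M → EndE n} {x : M} (hs : DiffAt s x) (ht : DiffAt t x) (X) :
    diff (s * t) x X = diff s x X * t x + s x * diff t x X :=
  diff_bilin ((ContinuousLinearMap.compL ℂ (E n) (E n) (E n)).bilinearRestrictScalars ℝ) hs ht X

theorem diff_app {s : M → EndE n} {t : M → E n} {x : M} (hs : DiffAt s x) (ht : DiffAt t x) (X) :
    diff (fun y => s y (t y)) x X = diff s x X (t x) + s x (diff t x X) :=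
  diff_bilin ((ContinuousLinearMap.id ℂ (EndE n)).bilinearRestrictScalars ℝ) hs ht X

theorem SmoothOn.bilin (B : W₁ →L[ℝ] W₂ →L[ℝ] W) {s : M → W₁} {t : M → W₂} {U : Set M}
    (hs : SmoothOn s U) (ht : SmoothOn t U) : SmoothOn (fun y => B (s y) (t y)) U :=
  (B.isBoundedBilinearMap.contDiff.contMDiff (n := ∞)).comp_contMDiffOn (hs.prodMk_space ht)

theorem SmoothOn.sub {s t : M → W} {U : Set M} (hs : SmoothOn s U) (ht : SmoothOn t U) :
    SmoothOn (fun y => s y - t y) U := ContMDiffOn.sub hs ht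

theorem SmoothOn.sum {ι : Type*} {I : Finset ι} {s : ι → M → W} {U : Set M}
    (hs : ∀ i ∈ I, SmoothOn (s i) U) : SmoothOn (fun y => ∑ i ∈ I, s i y) U :=
  contMDiffOn_finsetSum hs

theorem SmoothOn.const (c : W) {U : Set M} : SmoothOn (fun _ => c) U := contMDiffOn_const

theorem SmoothOn.comp_contDiff {f : W₁ → W} (hf : ContDiff ℝ ∞ f) {s : M → W₁} {U : Set M}
    (hs : SmoothOn s U) : SmoothOn (fun y => f (s y)) U := hf.contMDiff.comp_contMDiffOn hs

theorem SmoothOn.const_smul (c : ℂ) {s : M → W} {U : Set M} (hs : SmoothOn s U) :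
    SmoothOn (fun y => c • s y) U :=
  hs.comp_contDiff (f := fun w => c • w) (contDiff_const_smul c)

theorem SmoothOn.smul {f : M → ℂ} {s : M → W} {U : Set M} (hf : SmoothOn f U) (hs : SmoothOn s U) :
    SmoothOn (fun y => f y • s y) U :=
  SmoothOn.bilin ((ContinuousLinearMap.lsmul ℂ ℂ).bilinearRestrictScalars ℝ) hf hs

theorem SmoothOn.mul {s t : M → EndE n} {U : Set M} (hs : SmoothOn s U) (ht : SmoothOn t U) :
    SmoothOn (fun y => s y * t y) U :=
  SmoothOn.bilin ((ContinuousLinearMap.compL ℂ (E n) (E n) (E n)).bilinearRestrictScalars ℝ) hs ht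

theorem SmoothOn.app {s : M → EndE n} {t : M → E n} {U : Set M} (hs : SmoothOn s U)
    (ht : SmoothOn t U) : SmoothOn (fun y => s y (t y)) U :=
  SmoothOn.bilin ((ContinuousLinearMap.id ℂ (EndE n)).bilinearRestrictScalars ℝ) hs ht

/-- The metric as a continuous bilinear map. -/
def formL (n : ℕ) : E n →L[ℂ] E n →L[ℂ] ℂ :=
  LinearMap.toContinuousLinearMap ((LinearMap.toContinuousLinearMap (𝕜 := ℂ)).toLinearMap ∘ₗ form n)

@[simp] theorem formL_apply (u v : E n) : formL n u v = form n u v := rfl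

theorem SmoothOn.form {s t : M → E n} {U : Set M} (hs : SmoothOn s U) (ht : SmoothOn t U) :
    SmoothOn (fun y => form n (s y) (t y)) U :=
  SmoothOn.bilin ((formL n).bilinearRestrictScalars ℝ) hs ht

theorem diff_form {s t : M → E n} {x : M} (hs : DiffAt s x) (ht : DiffAt t x) (X) :
    diff (fun y => form n (s y) (t y)) x X =
      form n (diff s x X) (t x) + form n (s x) (diff t x X) :=
  diff_bilin ((formL n).bilinearRestrictScalars ℝ) hs ht X

@[simp] theorem toEnd_mul_toEnd_inv (g : M → E n ≃L[ℂ] E n) (x : M) :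
    toEnd g x * toEnd (inv g) x = 1 := by ext1 v; simp [toEnd, inv]

@[simp] theorem toEnd_inv_mul_toEnd (g : M → E n ≃L[ℂ] E n) (x : M) :
    toEnd (inv g) x * toEnd g x = 1 := by ext1 v; simp [toEnd, inv]

theorem SmoothOn.toEnd_inv {g : M → E n ≃L[ℂ] E n} {U : Set M} (hg : SmoothOn (toEnd g) U) :
    SmoothOn (toEnd (inv g)) U := fun x hx => by
  have h1 : ContDiffAt ℝ ∞ (ContinuousLinearMap.inverse : EndE n → EndE n) (toEnd g x) :=
    (contDiffAt_map_inverse (𝕜 := ℂ) (g x)).restrict_scalars ℝ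
  have h2 := (h1.contMDiffAt (n := ∞)).comp_contMDiffWithinAt x (hg x hx)
  have h3 : toEnd (inv g) = ContinuousLinearMap.inverse ∘ toEnd g := by
    ext1 y
    simp [toEnd, inv]
  rw [h3]
  exact h2

theorem diff_toEnd_inv {g : M → E n ≃L[ℂ] E n} (hg : SmoothOn (toEnd g) Set.univ) (x : M) (X) :
    diff (toEnd (inv g)) x X = - (toEnd (inv g) x * diff (toEnd g) x X * toEnd (inv g) x) := by
  have h1 := hg.diffAt isOpen_univ (Set.mem_univ x)
  have h2 := hg.toEnd_inv.diffAt isOpen_univ (Set.mem_univ x)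
  have h3 := diff_mul h2 h1 X
  have h4 : toEnd (inv g) * toEnd g = fun _ : M => (1 : EndE n) := by
    ext1 y; simp
  rw [h4, diff_const] at h3
  have h5 : diff (toEnd (inv g)) x X * toEnd g x = - (toEnd (inv g) x * diff (toEnd g) x X) :=
    eq_neg_of_add_eq_zero_left h3.symm
  calc _ = diff (toEnd (inv g)) x X * toEnd g x * toEnd (inv g) x := by
        rw [mul_assoc, toEnd_mul_toEnd_inv, mul_one]
    _ = _ := by rw [h5]; exact neg_mul (α := EndE n) _ _

end Diff

/-! ### Forms in charts -/

section Charts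

variable {W : Type*} [NormedAddCommGroup W] [NormedSpace ℂ W]

/-- The projections of a 1-form to its `(1,0)`-part (`c = i`) and `(0,1)`-part (`c = -i`). -/
def typePart (c : ℂ) (α : OneForm M W) : OneForm M W := fun x =>
  (1 / 2 : ℂ) • (α x - c • (α x).comp (tangentJ x))

theorem part10_eq (α : OneForm M W) : part10 α = typePart Complex.I α := rfl

theorem part01_eq (α : OneForm M W) : part01 α = typePart (-Complex.I) α := by
  funext x
  simp [part01, typePart]

theorem typePart_apply (c : ℂ) (α : OneForm M W) (x : M) (X) :
    typePart c α x X = (1 / 2 : ℂ) • (α x X - c • α x (tangentJ x X)) := rfl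

theorem tangentJ_tangentJ (x : M) (X) : tangentJ x (tangentJ x X) = -X := by
  change Complex.I * (Complex.I * (show ℂ from X)) = -(show ℂ from X)
  rw [← mul_assoc, Complex.I_mul_I, neg_one_mul]

theorem typePart_typePart {c : ℂ} (hc : c * c = -1) (α : OneForm M W) :
    typePart c (typePart c α) = typePart c α := by
  funext x; ext1 X
  simp only [typePart_apply, tangentJ_tangentJ, map_neg]
  match_scalars
  · linear_combination (-1 / 4) * hc
  · ring

theorem typePart_neg_typePart {c : ℂ} (hc : c * c = -1) (α : OneForm M W) :
    typePart c (typePart (-c) α) = 0 := by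
  funext x; ext1 X
  simp only [typePart_apply, tangentJ_tangentJ, map_neg, Pi.zero_apply,
    zero_apply]
  match_scalars
  · linear_combination (1 / 4) * hc
  · ring

theorem typePart_add_neg (c : ℂ) (α : OneForm M W) : typePart c α + typePart (-c) α = α := by
  funext x; ext1 X
  simp only [typePart_apply, Pi.add_apply, add_apply]
  match_scalars <;> ring

theorem typePart_add (c : ℂ) (α β : OneForm M W) :
    typePart c (α + β) = typePart c α + typePart c β := by
  funext x; ext1 X
  simp only [typePart_apply, Pi.add_apply, add_apply]
  match_scalars <;> ring

theorem typePart_smul (c a : ℂ) (α : OneForm M W) : typePart c (a • α) = a • typePart c α := by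
  funext x; ext1 X
  simp only [typePart_apply, Pi.smul_apply, smul_apply]
  match_scalars <;> ring

/-- The charts are holomorphic, so their derivatives are complex linear. Types can therefore be read
in any chart, which is how type parts of smooth forms are seen to be smooth. -/
theorem mfderiv_symm_I [IsManifold 𝓘(ℂ) ω M] {e : OpenPartialHomeomorph M ℂ}
    (he : e ∈ atlas ℂ M) {y : ℂ} (hy : y ∈ e.target) (u : ℂ) :
    mfderiv 𝓘(ℝ, ℂ) 𝓘(ℝ, ℂ) e.symm y (Complex.I * u : ℂ) =
      tangentJ (e.symm y) (mfderiv 𝓘(ℝ, ℂ) 𝓘(ℝ, ℂ) e.symm y u) := by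
  have : IsManifold 𝓘(ℂ) 1 M := IsManifold.of_le (n := ω) le_top
  have h := (mdifferentiableAt_atlas_symm (I := 𝓘(ℂ)) he hy).hasMFDerivAt
  have h2 : HasMFDerivAt 𝓘(ℝ, ℂ) 𝓘(ℝ, ℂ) e.symm y
      ((mfderiv 𝓘(ℂ) 𝓘(ℂ) e.symm y : ℂ →L[ℂ] ℂ).restrictScalars ℝ) :=
    ⟨h.1, HasFDerivWithinAt.restrictScalars ℝ h.2⟩
  rw [h2.mfderiv]
  exact (mfderiv 𝓘(ℂ) 𝓘(ℂ) e.symm y : ℂ →L[ℂ] ℂ).map_smul Complex.I u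

theorem inChart_typePart [IsManifold 𝓘(ℂ) ω M] (c : ℂ) (α : OneForm M W)
    {e : OpenPartialHomeomorph M ℂ} (he : e ∈ atlas ℂ M) {y : ℂ} (hy : y ∈ e.target) :
    inChart (typePart c α) e y = (1 / 2 : ℂ) • (inChart α e y - c • (inChart α e y).comp
      (Complex.I • ContinuousLinearMap.id ℝ ℂ : ℂ →L[ℝ] ℂ)) := by
  ext1 u
  have := mfderiv_symm_I he hy u
  exact congrArg (fun Z => (1 / 2 : ℂ) • (α (e.symm y) (mfderiv 𝓘(ℝ, ℂ) 𝓘(ℝ, ℂ) e.symm y u) -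
    c • α (e.symm y) Z)) this.symm

theorem inChart_diff [IsManifold 𝓘(ℝ, ℂ) ∞ M] {s : M → W} {e : OpenPartialHomeomorph M ℂ}
    (he : e ∈ atlas ℂ M) {y : ℂ} (hy : y ∈ e.target) (hs : DiffAt s (e.symm y)) :
    inChart (diff s) e y = fderiv ℝ (s ∘ e.symm) y := by
  have : IsManifold 𝓘(ℝ, ℂ) 1 M := IsManifold.of_le (n := ∞) (by simp)
  have h := (mdifferentiableAt_atlas_symm (I := 𝓘(ℝ, ℂ)) he hy).hasMFDerivAt
  rw [← mfderiv_eq_fderiv]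
  exact (hs.hasMFDerivAt.comp y h).mfderiv.symm

theorem SmoothOn.comp_symm [IsManifold 𝓘(ℝ, ℂ) ∞ M] {s : M → W} (hs : SmoothOn s Set.univ)
    {e : OpenPartialHomeomorph M ℂ} (he : e ∈ atlas ℂ M) :
    ContDiffOn ℝ ∞ (s ∘ e.symm) e.target := by
  rw [← contMDiffOn_iff_contDiffOn]
  exact ContMDiffOn.comp hs (contMDiffOn_symm_of_mem_maximalAtlas
    (IsManifold.subset_maximalAtlas he)) (fun _ _ => Set.mem_univ _)

theorem SmoothForm.add {α β : OneForm M W} (hα : SmoothForm α) (hβ : SmoothForm β) :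
    SmoothForm (α + β) := fun e he => by
  refine ((hα e he).add (hβ e he)).congr fun y _ => ?_
  ext1 u; rfl

theorem SmoothForm.sub {α β : OneForm M W} (hα : SmoothForm α) (hβ : SmoothForm β) :
    SmoothForm (α - β) := fun e he => by
  refine ((hα e he).sub (hβ e he)).congr fun y _ => ?_
  ext1 u; rfl

theorem SmoothForm.const_smul (c : ℂ) {α : OneForm M W} (hα : SmoothForm α) :
    SmoothForm (c • α) := fun e he => by
  refine ((hα e he).const_smul c).congr fun y _ => ?_
  ext1 u; rfl

theorem SmoothForm.zero : SmoothForm (0 : OneForm M W) := fun e _ => by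
  refine (contDiffOn_const (c := 0)).congr fun y _ => ?_
  ext1 u; rfl

theorem SmoothForm.typePart [IsManifold 𝓘(ℂ) ω M] (c : ℂ) {α : OneForm M W} (hα : SmoothForm α) :
    SmoothForm (typePart c α) := fun e he => by
  refine (((hα e he).sub (((hα e he).clm_comp (contDiffOn_const
    (c := (Complex.I • ContinuousLinearMap.id ℝ ℂ : ℂ →L[ℝ] ℂ)))).const_smul c)).const_smul
    (1 / 2 : ℂ)).congr fun y hy => ?_
  rw [inChart_typePart c α he hy]

theorem SmoothOn.diff [IsManifold 𝓘(ℝ, ℂ) ∞ M] {s : M → W} (hs : SmoothOn s Set.univ) :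
    SmoothForm (diff s) := fun e he => by
  refine ((hs.comp_symm he).fderiv_of_isOpen (m := ∞) e.open_target (by simp)).congr
    fun y hy => ?_
  exact inChart_diff he hy (hs.diffAt isOpen_univ (Set.mem_univ _))

theorem SmoothForm.bilin [IsManifold 𝓘(ℝ, ℂ) ∞ M] {W₁ W₂ : Type*} [NormedAddCommGroup W₁]
    [NormedSpace ℂ W₁] [NormedAddCommGroup W₂] [NormedSpace ℂ W₂] (B : W₁ →L[ℝ] W₂ →L[ℝ] W)
    {T : M → W₁} {α : OneForm M W₂} (hT : SmoothOn T Set.univ) (hα : SmoothForm α) :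
    SmoothForm (fun x => (B (T x)).comp (α x)) := fun e he =>
  ((B.contDiff.comp_contDiffOn (hT.comp_symm he)).clm_comp (hα e he)).congr fun _ _ => rfl

theorem SmoothForm.leftMul [IsManifold 𝓘(ℝ, ℂ) ∞ M] {T : M → EndE n} {α : OneForm M (EndE n)}
    (hT : SmoothOn T Set.univ) (hα : SmoothForm α) : SmoothForm (leftMul T α) :=
  SmoothForm.bilin ((ContinuousLinearMap.compL ℂ (E n) (E n) (E n)).bilinearRestrictScalars ℝ) hT hα

theorem SmoothForm.rightMul [IsManifold 𝓘(ℝ, ℂ) ∞ M] {T : M → EndE n} {α : OneForm M (EndE n)}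
    (hT : SmoothOn T Set.univ) (hα : SmoothForm α) : SmoothForm (rightMul T α) :=
  SmoothForm.bilin ((ContinuousLinearMap.compL ℂ (E n) (E n) (E n)).flip.bilinearRestrictScalars ℝ)
    hT hα

theorem SmoothForm.covEnd [IsManifold 𝓘(ℝ, ℂ) ∞ M] {T : M → EndE n} {α : OneForm M (EndE n)}
    (hT : SmoothOn T Set.univ) (hα : SmoothForm α) : SmoothForm (covEnd α T) :=
  hT.diff.add (hα.rightMul hT)

theorem SmoothForm.gauge [IsManifold 𝓘(ℝ, ℂ) ∞ M] {g : M → E n ≃L[ℂ] E n}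
    {α : OneForm M (EndE n)} (hg : SmoothOn (toEnd g) Set.univ) (hα : SmoothForm α) :
    SmoothForm (gauge g α) :=
  (hα.covEnd hg.toEnd_inv).leftMul hg

theorem SmoothForm.Ad [IsManifold 𝓘(ℝ, ℂ) ∞ M] {g : M → E n ≃L[ℂ] E n}
    {α : OneForm M (EndE n)} (hg : SmoothOn (toEnd g) Set.univ) (hα : SmoothForm α) :
    SmoothForm (Ad g α) :=
  (hα.rightMul hg.toEnd_inv).leftMul hg

end Charts

/-! ### Gauge invariance of flatness -/

section Flat

theorem two_le_infty : (2 : WithTop ℕ∞) ≤ ∞ :=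
  WithTop.coe_le_coe.2 (le_top : (2 : ℕ∞) ≤ ⊤)

/-- Here `F` is a gauge and `K` its inverse; `KU`, `KV` are derivatives of `K` along two directions,
`-(F * KU * F)` is the derivative of `F`, and `S` is the mixed second derivative of `K`. The left
side is the old curvature conjugated by `F`. -/
theorem gauge_curvature_eq_zero {R : Type*} [Ring R] {F K KU KV AU AV S D1 D2 : R} (hKF : K * F = 1)
    (h : D1 - D2 + (AU * AV - AV * AU) = 0) :
    -(F * KU * F) * (KV + AV * K) + F * (S + (D1 * K + AV * KU)) -
      (-(F * KV * F) * (KU + AU * K) + F * (S + (D2 * K + AU * KV))) +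
      (F * (KU + AU * K) * (F * (KV + AV * K)) - F * (KV + AV * K) * (F * (KU + AU * K))) = 0 := by
  have e1 : F * (KU + AU * K) * (F * (KV + AV * K)) =
      F * KU * F * (KV + AV * K) + F * AU * (K * F) * (KV + AV * K) := by noncomm_ring
  have e2 : F * (KV + AV * K) * (F * (KU + AU * K)) =
      F * KV * F * (KU + AU * K) + F * AV * (K * F) * (KU + AU * K) := by noncomm_ring
  rw [e1, e2, hKF]
  have : F * (D1 - D2 + (AU * AV - AV * AU)) * K = 0 := by rw [h]; simp
  rw [← this]
  noncomm_ring

variable {W : Type*} [NormedAddCommGroup W] [NormedSpace ℂ W]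

theorem hasFDerivAt_bilin {W₁ W₂ : Type*} [NormedAddCommGroup W₁]
    [NormedSpace ℂ W₁] [NormedAddCommGroup W₂] [NormedSpace ℂ W₂] (B : W₁ →L[ℝ] W₂ →L[ℝ] W)
    {s : ℂ → W₁} {t : ℂ → W₂} {y : ℂ} {s' t'} (hs : HasFDerivAt s s' y) (ht : HasFDerivAt t t' y) :
    HasFDerivAt (fun y => B (s y) (t y)) ((B.flip (t y)).comp s' + (B (s y)).comp t') y := by
  have := B.hasFDerivAt_of_bilinear hs ht
  rw [add_comm] at this
  exact this

theorem fderiv_mul_end {s t : ℂ → EndE n} {y : ℂ} (hs : DifferentiableAt ℝ s y)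
    (ht : DifferentiableAt ℝ t y) (u : ℂ) :
    fderiv ℝ (fun z => s z * t z) y u = fderiv ℝ s y u * t y + s y * fderiv ℝ t y u := by
  have := (hasFDerivAt_bilin ((ContinuousLinearMap.compL ℂ (E n) (E n) (E n)).bilinearRestrictScalars
    ℝ) hs.hasFDerivAt ht.hasFDerivAt).fderiv
  exact congrArg (fun L : ℂ →L[ℝ] EndE n => L u) this

theorem differentiableAt_mul_end {s t : ℂ → EndE n} {y : ℂ} (hs : DifferentiableAt ℝ s y)
    (ht : DifferentiableAt ℝ t y) : DifferentiableAt ℝ (fun z => s z * t z) y :=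
  (hasFDerivAt_bilin ((ContinuousLinearMap.compL ℂ (E n) (E n) (E n)).bilinearRestrictScalars
    ℝ) hs.hasFDerivAt ht.hasFDerivAt).differentiableAt

theorem fderiv_eval {F : ℂ → ℂ →L[ℝ] W} {y : ℂ} (hF : DifferentiableAt ℝ F y) (u v : ℂ) :
    fderiv ℝ F y u v = fderiv ℝ (fun z => F z v) y u := by
  rw [fderiv_clm_apply hF (differentiableAt_const v)]
  simp

theorem IsFlat.gauge [IsManifold 𝓘(ℝ, ℂ) ∞ M] {g : M → E n ≃L[ℂ] E n} {A : OneForm M (EndE n)}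
    (hg : SmoothOn (toEnd g) Set.univ) (hA : SmoothForm A) (h : IsFlat A) :
    IsFlat (gauge g A) := by
  intro e he y hy u v
  set a : ℂ → ℂ →L[ℝ] EndE n := inChart A e with ha
  set f : ℂ → EndE n := toEnd g ∘ e.symm with hf
  set k : ℂ → EndE n := toEnd (inv g) ∘ e.symm with hk
  have hnhds : e.target ∈ 𝓝 y := e.open_target.mem_nhds hy
  have hfs : ContDiffAt ℝ ∞ f y := (hg.comp_symm he).contDiffAt hnhds
  have hks : ContDiffAt ℝ ∞ k y := (hg.toEnd_inv.comp_symm he).contDiffAt hnhds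
  have has : ContDiffAt ℝ ∞ a y := (hA e he).contDiffAt hnhds
  have hfd : DifferentiableAt ℝ f y := hfs.differentiableAt (by simp)
  have hkd : DifferentiableAt ℝ k y := hks.differentiableAt (by simp)
  have had : DifferentiableAt ℝ a y := has.differentiableAt (by simp)
  have hkdd : DifferentiableAt ℝ (fderiv ℝ k) y :=
    (hks.fderiv_right (m := 1) (by norm_num; exact two_le_infty)).differentiableAt (by simp)
  have hBs : DifferentiableAt ℝ (inChart (Dressing.gauge g A) e) y :=
    ((hA.gauge hg e he).contDiffAt hnhds).differentiableAt (by simp)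
  have hB : ∀ z ∈ e.target, ∀ w, inChart (Dressing.gauge g A) e z w
      = f z * (fderiv ℝ k z w + a z w * k z) := by
    intro z hz w
    have h1 := inChart_diff he hz (hg.toEnd_inv.diffAt isOpen_univ (Set.mem_univ (e.symm z)))
    rw [hk, ← h1]
    rfl
  have hd : ∀ u v, fderiv ℝ (inChart (Dressing.gauge g A) e) y u v =
      fderiv ℝ f y u * (fderiv ℝ k y v + a y v * k y) +
      f y * (fderiv ℝ (fderiv ℝ k) y u v + (fderiv ℝ a y u v * k y + a y v * fderiv ℝ k y u)) := by
    intro u v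
    have hkv : DifferentiableAt ℝ (fun z => fderiv ℝ k z v) y :=
      hkdd.clm_apply (differentiableAt_const v)
    have hav : DifferentiableAt ℝ (fun z => a z v) y := had.clm_apply (differentiableAt_const v)
    have h1 : (fun z => inChart (Dressing.gauge g A) e z v) =ᶠ[𝓝 y]
        fun z => f z * (fderiv ℝ k z v + a z v * k z) := by
      filter_upwards [hnhds] with z hz using hB z hz v
    rw [fderiv_eval hBs, h1.fderiv_eq,
      fderiv_mul_end hfd (hkv.fun_add (differentiableAt_mul_end hav hkd)),
      fderiv_fun_add hkv (differentiableAt_mul_end hav hkd), add_apply,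
      fderiv_mul_end hav hkd, ← fderiv_eval hkdd, ← fderiv_eval had]
  -- The second derivative of g⁻¹ enters the curvature antisymmetrised, so symmetry removes it.
  have hsymm : fderiv ℝ (fderiv ℝ k) y u v = fderiv ℝ (fderiv ℝ k) y v u :=
    (hks.isSymmSndFDerivAt (by simpa using two_le_infty)).eq u v
  have hkf : ∀ z, k z * f z = 1 := fun z => toEnd_inv_mul_toEnd g _
  have hfk : ∀ z, f z * k z = 1 := fun z => toEnd_mul_toEnd_inv g _
  have hf' : ∀ u, fderiv ℝ f y u = - (f y * fderiv ℝ k y u * f y) := by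
    intro u
    have h1 : fderiv ℝ (fun z => f z * k z) y u = 0 := by
      rw [funext hfk]; simp
    rw [fderiv_mul_end hfd hkd] at h1
    have h2 : fderiv ℝ f y u * k y = - (f y * fderiv ℝ k y u) := eq_neg_of_add_eq_zero_left h1
    calc _ = fderiv ℝ f y u * k y * f y := by rw [mul_assoc, hkf, mul_one]
      _ = _ := by rw [h2]; exact neg_mul (α := EndE n) _ _
  have hflat := h e he y hy u v
  rw [← ha] at hflat
  rw [hd u v, hd v u, hB y hy, hB y hy, hf', hf', hsymm]
  exact gauge_curvature_eq_zero (hkf y) hflat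

end Flat

/-! ### Linear algebra of the metric -/

section LinearAlgebra

instance : IsScalarTower ℂ (EndE n) (EndE n) := ⟨fun _ _ _ => rfl⟩

instance : SMulCommClass ℂ (EndE n) (EndE n) := ⟨fun c S T => by
  ext1 v
  exact ((S : E n →L[ℂ] E n).map_smul c (T v)).symm⟩

theorem reflection_mul_self {R : Type*} [Ring R] {p : R} (hp : p * p = p) :
    (p - (1 - p)) * (p - (1 - p)) = 1 := by
  have e : (p - (1 - p)) * (p - (1 - p)) = 4 • (p * p) - 4 • p + 1 := by noncomm_ring
  rw [e, hp]; abel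

theorem form_apply (u v : E n) : form n u v = (∑ i : Fin (n + 1), u i.castSucc * v i.castSucc)
    - u (Fin.last (n + 1)) * v (Fin.last (n + 1)) := rfl

theorem form_comm (u v : E n) : form n u v = form n v u := by
  simp only [form_apply, mul_comm]

theorem form_isSymm : (form n).IsSymm := ⟨fun u v => form_comm u v⟩

theorem form_isRefl : (form n).IsRefl := form_isSymm.isRefl

theorem form_nondegenerate : (form n).Nondegenerate := by
  have h : ∀ u : E n, (∀ v, form n u v = 0) → u = 0 := by
    intro u hu
    funext i
    refine Fin.lastCases ?_ (fun j => ?_) i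
    · have := hu (Pi.single (Fin.last (n + 1)) 1)
      simpa [form_apply, Pi.single_apply, Fin.castSucc_ne_last] using this
    · have := hu (Pi.single j.castSucc 1)
      simpa [form_apply, Pi.single_apply, (Fin.castSucc_ne_last j).symm] using this
  exact ⟨h, fun v hv => h v fun u => by rw [form_comm]; exact hv u⟩

theorem mem_perp {W : Submodule ℂ (E n)} {v : E n} : v ∈ perp W ↔ ∀ w ∈ W, form n w v = 0 := Iff.rfl

variable {W : Submodule ℂ (E n)}

theorem Nondeg.isCompl (h : Nondeg W) : IsCompl W (perp W) :=
  LinearMap.BilinForm.isCompl_orthogonal_of_restrict_nondegenerate form_isRefl h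

theorem nondeg_iff : Nondeg W ↔ ∀ u ∈ W, (∀ v ∈ W, form n u v = 0) → u = 0 := by
  constructor
  · intro h u hu huv
    have := h.1 ⟨u, hu⟩ fun v => huv v v.2
    simpa using this
  · intro h
    have h1 : ∀ u : W, (∀ v : W, form n u v = 0) → u = 0 := fun u hu =>
      Subtype.ext (h u u.2 fun v hv => hu ⟨v, hv⟩)
    exact ⟨h1, fun v hv => h1 v fun u => by rw [form_comm]; exact hv u⟩

theorem Nondeg.proj_eq (h : Nondeg W) (v : E n) :
    proj W v = Submodule.projection W (perp W) h.isCompl v := by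
  simp [proj, h.isCompl]

theorem Nondeg.proj_mem (h : Nondeg W) (v : E n) : proj W v ∈ W := by
  rw [h.proj_eq]; exact Submodule.projection_apply_mem _ _

theorem Nondeg.sub_proj_mem (h : Nondeg W) (v : E n) : v - proj W v ∈ perp W := by
  rw [h.proj_eq]; exact Submodule.sub_projection_mem _ _

theorem Nondeg.proj_of_mem (h : Nondeg W) {v : E n} (hv : v ∈ W) : proj W v = v := by
  rw [h.proj_eq]; exact Submodule.projection_apply_of_mem_left _ hv

theorem Nondeg.proj_of_mem_perp (h : Nondeg W) {v : E n} (hv : v ∈ perp W) : proj W v = 0 := by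
  rw [h.proj_eq]; exact (Submodule.projection_apply_eq_zero_iff _).2 hv

theorem Nondeg.proj_eq_iff (h : Nondeg W) {v : E n} : proj W v = v ↔ v ∈ W :=
  ⟨fun hv => hv ▸ h.proj_mem v, h.proj_of_mem⟩

theorem Nondeg.proj_mul_proj (h : Nondeg W) : proj W * proj W = proj W := by
  ext1 v
  exact h.proj_of_mem (h.proj_mem v)

theorem Nondeg.proj_unique (h : Nondeg W) {P : EndE n} (h1 : ∀ v, P v ∈ W)
    (h2 : ∀ v, v - P v ∈ perp W) : P = proj W := by
  ext1 v
  have := congrArg (proj W) (sub_add_cancel v (P v)).symm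
  rw [map_add, h.proj_of_mem_perp (h2 v), h.proj_of_mem (h1 v), zero_add] at this
  exact this.symm

theorem Nondeg.form_proj_left (h : Nondeg W) (u : E n) {v : E n} (hv : v ∈ W) :
    form n (proj W u) v = form n u v := by
  have := mem_perp.1 (h.sub_proj_mem u) v hv
  rw [map_sub, sub_eq_zero] at this
  rw [form_comm, ← this, form_comm]

variable {g : E n ≃L[ℂ] E n}

theorem Orthogonal.symm (hg : Orthogonal g) : Orthogonal g.symm := fun u v => by
  rw [← hg, g.apply_symm_apply, g.apply_symm_apply]

theorem Orthogonal.form_apply_left (hg : Orthogonal g) (u v : E n) :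
    form n (g u) v = form n u (g.symm v) := by
  rw [← hg u, g.apply_symm_apply]

theorem mem_map_iff {v : E n} :
    v ∈ W.map ((g : E n ≃L[ℂ] E n) : E n →ₗ[ℂ] E n) ↔ g.symm v ∈ W := by
  constructor
  · rintro ⟨w, hw, rfl⟩
    simpa using hw
  · intro h
    exact ⟨_, h, by simp⟩

theorem Orthogonal.perp_map (hg : Orthogonal g) :
    perp (W.map (g : E n →ₗ[ℂ] E n)) = (perp W).map (g : E n →ₗ[ℂ] E n) := by
  ext v
  rw [mem_map_iff, mem_perp, mem_perp]
  constructor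
  · intro h w hw
    rw [← hg.form_apply_left]
    exact h _ ⟨w, hw, rfl⟩
  · rintro h _ ⟨w, hw, rfl⟩
    exact (hg.form_apply_left w v).trans (h w hw)

theorem Orthogonal.nondeg_map (hg : Orthogonal g) (h : Nondeg W) :
    Nondeg (W.map (g : E n →ₗ[ℂ] E n)) := by
  rw [nondeg_iff] at h ⊢
  rintro _ ⟨u, hu, rfl⟩ huv
  rw [h u hu fun v hv => (hg u v).symm.trans (huv _ ⟨v, hv, rfl⟩), map_zero]

theorem Orthogonal.isotropic_map (hg : Orthogonal g) (h : Isotropic W) :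
    Isotropic (W.map (g : E n →ₗ[ℂ] E n)) := by
  rintro _ ⟨u, hu, rfl⟩ _ ⟨v, hv, rfl⟩
  exact (hg u v).trans (h u hu v hv)

theorem Orthogonal.proj_map (hg : Orthogonal g) (h : Nondeg W) :
    proj (W.map (g : E n →ₗ[ℂ] E n)) = (g : EndE n) * proj W * (g.symm : EndE n) := by
  symm
  refine (hg.nondeg_map h).proj_unique (fun v => ⟨_, h.proj_mem (g.symm v), rfl⟩) fun v => ?_
  rw [hg.perp_map, mem_map_iff]
  simpa using h.sub_proj_mem (g.symm v)

theorem Nondeg.refl_mul_refl (h : Nondeg W) : refl W * refl W = 1 :=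
  reflection_mul_self h.proj_mul_proj

theorem Nondeg.map_eq_of_commute (h : Nondeg W)
    (hg : proj W * (g : EndE n) = (g : EndE n) * proj W) : W.map (g : E n →ₗ[ℂ] E n) = W := by
  have key : ∀ v ∈ W, g v ∈ W := fun v hv => by
    rw [← h.proj_eq_iff]
    have := congrArg (fun T : EndE n => T v) hg
    simpa [h.proj_of_mem hv] using this
  refine Submodule.eq_of_le_of_finrank_eq ?_ ?_
  · rintro _ ⟨v, hv, rfl⟩
    exact key v hv
  · exact LinearEquiv.finrank_map_eq (g : E n ≃ₗ[ℂ] E n) W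

theorem wedge_apply (u v w : E n) : wedge u v w = form n u w • v - form n v w • u := rfl

theorem wedgeSq_induction {p : EndE n → Prop} (hw : ∀ u ∈ W, ∀ v ∈ W, p (wedge u v)) (h0 : p 0)
    (hadd : ∀ S T, p S → p T → p (S + T)) (hsmul : ∀ (c : ℂ) T, p T → p (c • T)) {T : EndE n}
    (hT : T ∈ wedgeSq W) : p T := by
  refine Submodule.span_induction ?_ h0 (fun _ _ _ _ => hadd _ _) (fun c _ _ => hsmul c _) hT
  rintro _ ⟨u, hu, v, hv, rfl⟩
  exact hw u hu v hv

theorem wedgeSq_apply_mem {T : EndE n} (hT : T ∈ wedgeSq W) (v : E n) : T v ∈ W := by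
  refine wedgeSq_induction (p := fun T => T v ∈ W) ?_ ?_ ?_ ?_ hT
  · intro a ha b hb
    exact W.sub_mem (W.smul_mem _ hb) (W.smul_mem _ ha)
  · exact W.zero_mem
  · exact fun S T hS hT => W.add_mem hS hT
  · exact fun c T hT => W.smul_mem c hT

/-- For isotropic `W` this covers `W` itself, since `W` lies in its orthogonal complement: a
multiplier kills the plane it is built from. -/
theorem wedgeSq_apply_eq_zero {T : EndE n} (hT : T ∈ wedgeSq W) {v : E n} (hv : v ∈ perp W) :
    T v = 0 := by
  refine wedgeSq_induction (p := fun T => T v = 0) ?_ ?_ ?_ ?_ hT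
  · intro a ha b hb
    rw [wedge_apply, mem_perp.1 hv a ha, mem_perp.1 hv b hb, zero_smul, zero_smul, sub_zero]
  · rfl
  · intro S T hS hT
    rw [add_apply, hS, hT, add_zero]
  · intro c T hT
    rw [smul_apply, hT, smul_zero]

theorem perp_anti {W W' : Submodule ℂ (E n)} (h : W ≤ W') : perp W' ≤ perp W :=
  LinearMap.BilinForm.orthogonal_le h

theorem Isotropic.le_perp (h : Isotropic W) : W ≤ perp W := fun v hv w hw => h w hw v hv

theorem le_perp_perp (W : Submodule ℂ (E n)) : W ≤ perp (perp W) :=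
  LinearMap.BilinForm.le_orthogonal_orthogonal form_isRefl

theorem wedgeSq_mono {W W' : Submodule ℂ (E n)} (h : W ≤ W') : wedgeSq W ≤ wedgeSq W' := by
  refine Submodule.span_mono ?_
  rintro _ ⟨u, hu, v, hv, rfl⟩
  exact ⟨u, h hu, v, h hv, rfl⟩

theorem Nondeg.commute_of_mem_wedgeSq (h : Nondeg W) {T : EndE n}
    (hT : T ∈ wedgeSq W ⊔ wedgeSq (perp W)) : proj W * T = T * proj W := by
  obtain ⟨A, hA, B, hB, rfl⟩ := Submodule.mem_sup.1 hT
  have hA1 : proj W * A = A := by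
    ext1 v; exact h.proj_of_mem (wedgeSq_apply_mem hA v)
  have hA2 : A * proj W = A := by
    ext1 v
    have := wedgeSq_apply_eq_zero hA (h.sub_proj_mem v)
    rw [map_sub, sub_eq_zero] at this
    exact this.symm
  have hB1 : proj W * B = 0 := by
    ext1 v; exact h.proj_of_mem_perp (wedgeSq_apply_mem hB v)
  have hB2 : B * proj W = 0 := by
    ext1 v
    exact wedgeSq_apply_eq_zero hB (le_perp_perp W (h.proj_mem v))
  rw [mul_add, add_mul, hA1, hA2, hB1, hB2]

theorem Orthogonal.conj_wedge (hg : Orthogonal g) (u v : E n) :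
    (g : EndE n) * (wedge u v * (g.symm : EndE n)) = wedge (g u) (g v) := by
  ext1 w
  change g (wedge u v (g.symm w)) = _
  rw [wedge_apply, wedge_apply, map_sub, map_smul, map_smul, hg.form_apply_left,
    hg.form_apply_left]

theorem Orthogonal.conj_mem_wedgeSq (hg : Orthogonal g) {T : EndE n} (hT : T ∈ wedgeSq W) :
    (g : EndE n) * (T * (g.symm : EndE n)) ∈ wedgeSq (W.map (g : E n →ₗ[ℂ] E n)) := by
  refine wedgeSq_induction (p := fun T => (g : EndE n) * (T * (g.symm : EndE n)) ∈
    wedgeSq (W.map (g : E n →ₗ[ℂ] E n))) ?_ ?_ ?_ ?_ hT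
  · intro u hu v hv
    rw [hg.conj_wedge]
    exact Submodule.subset_span ⟨_, ⟨u, hu, rfl⟩, _, ⟨v, hv, rfl⟩, rfl⟩
  · simp
  · intro S T hS hT
    rw [add_mul, mul_add]
    exact add_mem hS hT
  · intro c T hT
    rw [smul_mul_assoc, mul_smul_comm]
    exact Submodule.smul_mem _ c hT

/-- A maximal isotropic subspace is its own orthogonal complement. -/
theorem Nondeg.mem_of_isotropic {V L : Submodule ℂ (E n)} (hV : Nondeg V) (hL : Isotropic L)
    (hLV : L ≤ V) (h4 : Module.finrank ℂ V = 4) (h2 : Module.finrank ℂ L = 2) {v : E n}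
    (hv : v ∈ V) (hvL : ∀ w ∈ L, form n w v = 0) : v ∈ L := by
  -- A dimension count: V ∩ L^⊥ = (V^⊥ ⊕ L)^⊥ has dimension (n + 2) - n = 2 and contains `L`.
  have e1 : perp (perp V ⊔ L) ≤ V ⊓ perp L := by
    refine le_inf ?_ (perp_anti le_sup_right)
    refine (perp_anti le_sup_left).trans ?_
    exact (LinearMap.BilinForm.orthogonal_orthogonal form_nondegenerate form_isRefl V).le
  have e2 : V ⊓ perp L ≤ perp (perp V ⊔ L) := by
    rintro w ⟨hw1, hw2⟩ u hu
    obtain ⟨a, ha, b, hb, rfl⟩ := Submodule.mem_sup.1 hu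
    have h1 : form n a w = 0 := by rw [form_comm]; exact ha w hw1
    change form n (a + b) w = 0
    rw [map_add, LinearMap.add_apply, h1, hw2 b hb, add_zero]
  have e3 : Module.finrank ℂ (perp V) = n + 2 - 4 := by
    have := LinearMap.BilinForm.finrank_orthogonal (form_nondegenerate (n := n)) V
    rw [h4, Module.finrank_fin_fun] at this
    exact this
  have hle : 4 ≤ n + 2 := by
    have := V.finrank_le
    rw [h4] at this
    simpa using this
  have e4 : Module.finrank ℂ (perp V ⊔ L : Submodule ℂ (E n)) = n := by
    have := Submodule.finrank_sup_add_finrank_inf_eq (perp V) L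
    have h0 : perp V ⊓ L = ⊥ := by
      rw [eq_bot_iff, ← hV.isCompl.inf_eq_bot]
      exact le_inf (inf_le_right.trans hLV) inf_le_left
    rw [h0, finrank_bot, e3, h2] at this
    omega
  have e5 : Module.finrank ℂ (perp (perp V ⊔ L)) = 2 := by
    have := LinearMap.BilinForm.finrank_orthogonal (form_nondegenerate (n := n)) (perp V ⊔ L)
    rw [e4] at this
    rw [show perp (perp V ⊔ L) = (form n).orthogonal (perp V ⊔ L) from rfl, this]
    simp
  have e6 : V ⊓ perp L = perp (perp V ⊔ L) := le_antisymm e2 e1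
  have e7 : L = V ⊓ perp L := Submodule.eq_of_le_of_finrank_eq (le_inf hLV hL.le_perp)
    (by rw [e6, e5, h2])
  rw [e7]
  exact ⟨hv, hvL⟩

end LinearAlgebra

/-! ### Isotropic planes in a four-dimensional quadratic space

The two families of isotropic planes are told apart by the sign in `exists_sign`. -/

section Planes

open Module

variable {U : Type*} [AddCommGroup U] [Module ℂ U] {B : LinearMap.BilinForm ℂ U}

/-- The second minors of the coordinates `(a₁, ·), (a₂, ·)`. -/
def minor (B : LinearMap.BilinForm ℂ U) (a₁ a₂ x y : U) : ℂ := B a₁ x * B a₂ y - B a₁ y * B a₂ x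

theorem det_gram (b : Basis (Fin 4) ℂ U) (v w : Fin 4 → U) :
    Matrix.det (Matrix.of fun i j => B (v i) (w j)) =
      b.det v * b.det w * (LinearMap.BilinForm.toMatrix b B).det := by
  have : (Matrix.of fun i j => B (v i) (w j)) =
      (b.toMatrix v).transpose * LinearMap.BilinForm.toMatrix b B * b.toMatrix w := by
    ext i j
    rw [Matrix.mul_apply, Matrix.of_apply, ← LinearMap.sum_repr_mul_repr_mul b b (v i) (w j)]
    simp only [Matrix.mul_apply, Matrix.transpose_apply, Basis.toMatrix_apply,
      LinearMap.BilinForm.toMatrix_apply, Finset.sum_mul]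
    rw [Finsupp.sum_fintype _ _ (by simp), Finset.sum_comm]
    refine Finset.sum_congr rfl fun k _ => ?_
    rw [Finsupp.sum_fintype _ _ (by simp)]
    refine Finset.sum_congr rfl fun l _ => ?_
    simp only [smul_eq_mul]; ring
  rw [this, Matrix.det_mul, Matrix.det_mul, Matrix.det_transpose, Basis.det_apply, Basis.det_apply]
  ring

/-- The Gram matrix of (a₁, a₂, x, y) against (b₁, b₂, x', y') has a vanishing upper left 2 × 2
block, so its determinant is the product of the determinants of the two neighbouring blocks. -/
theorem det_gram_of_orthogonal (b : Basis (Fin 4) ℂ U) (hB : B.IsSymm) {a₁ a₂ b₁ b₂ : U} (h11 : B a₁ b₁ = 0)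
    (h12 : B a₁ b₂ = 0) (h21 : B a₂ b₁ = 0) (h22 : B a₂ b₂ = 0) (x y x' y' : U) :
    b.det ![a₁, a₂, x, y] * b.det ![b₁, b₂, x', y'] * (LinearMap.BilinForm.toMatrix b B).det =
      minor B a₁ a₂ x' y' * minor B b₁ b₂ x y := by
  rw [← det_gram]
  simp [Matrix.det_succ_row_zero, Fin.sum_univ_succ, Fin.succAbove, h11, h12, h21, h22, minor]
  rw [hB.eq x b₁, hB.eq x b₂, hB.eq y b₁, hB.eq y b₂]
  ring

/-- If every minor vanished, B(a₁, x) a₂ - B(a₂, x) a₁ would be orthogonal to everything,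
contradicting independence. -/
theorem exists_minor_ne_zero (hB : B.Nondegenerate) {a₁ a₂ : U}
    (ha : LinearIndependent ℂ ![a₁, a₂]) : ∃ x y, minor B a₁ a₂ x y ≠ 0 := by
  by_contra! h
  have h1 : a₁ ≠ 0 := ha.ne_zero 0
  obtain ⟨x, hx⟩ : ∃ x, B a₁ x ≠ 0 := by
    by_contra! h2
    exact h1 (hB.1 a₁ h2)
  have h3 : B a₁ x • a₂ - B a₂ x • a₁ = 0 := hB.1 _ fun y => by
    have := h x y
    simp only [minor] at this
    simp only [map_sub, map_smul, LinearMap.sub_apply, LinearMap.smul_apply, smul_eq_mul]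
    linear_combination this
  have h4 := LinearIndependent.pair_iff.1 ha (- B a₂ x) (B a₁ x) (by rw [← h3]; module)
  exact hx h4.2

/-- Pairing an isotropic plane with itself in `det_gram_of_orthogonal` shows that the ratio of
determinant to minor does not depend on `x` and `y`. The equation for `ε` leaves two values,
opposite to each other, one for each family of planes. -/
theorem exists_sign (b : Basis (Fin 4) ℂ U) (hB : B.IsSymm) (hB' : B.Nondegenerate) {a₁ a₂ : U} (h11 : B a₁ a₁ = 0)
    (h12 : B a₁ a₂ = 0) (h22 : B a₂ a₂ = 0) (ha : LinearIndependent ℂ ![a₁, a₂]) :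
    ∃ ε : ℂ, (LinearMap.BilinForm.toMatrix b B).det * ε ^ 2 = 1 ∧
      ∀ x y, b.det ![a₁, a₂, x, y] = ε * minor B a₁ a₂ x y := by
  obtain ⟨x, y, hxy⟩ := exists_minor_ne_zero hB' ha
  have key := det_gram_of_orthogonal b hB h11 h12 ((hB.eq a₂ a₁).trans h12) h22
  set d := (LinearMap.BilinForm.toMatrix b B).det
  have h := key x y x y
  have hω : b.det ![a₁, a₂, x, y] ≠ 0 := fun h0 => by
    rw [h0] at h
    exact hxy (by simpa using h.symm)
  have hd : d ≠ 0 := fun h0 => by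
    rw [h0] at h
    exact hxy (by simpa using h.symm)
  -- This is the ratio of determinant to minor at the chosen pair, rewritten with d · det² = minor².
  refine ⟨minor B a₁ a₂ x y / (d * b.det ![a₁, a₂, x, y]), ?_, fun x' y' => ?_⟩
  · field_simp
    linear_combination -h
  · have := key x y x' y'
    field_simp
    linear_combination this

theorem det_swap_middle (b : Basis (Fin 4) ℂ U) (a₁ a₂ a₃ a₄ : U) :
    b.det ![a₁, a₃, a₂, a₄] = - b.det ![a₁, a₂, a₃, a₄] := by
  rw [← b.det.map_swap ![a₁, a₂, a₃, a₄] (show (1 : Fin 4) ≠ 2 by decide)]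
  congr 1
  ext i; fin_cases i <;> rfl

theorem det_swap_pairs (b : Basis (Fin 4) ℂ U) (a₁ a₂ a₃ a₄ : U) :
    b.det ![a₃, a₄, a₁, a₂] = b.det ![a₁, a₂, a₃, a₄] := by
  have h1 := b.det.map_swap ![a₁, a₂, a₃, a₄] (show (0 : Fin 4) ≠ 2 by decide)
  have h2 := b.det.map_swap (![a₁, a₂, a₃, a₄] ∘ Equiv.swap (0 : Fin 4) 2)
    (show (1 : Fin 4) ≠ 3 by decide)
  rw [h1, neg_neg] at h2
  rw [← h2]
  congr 1
  ext i; fin_cases i <;> rfl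

/-- If two isotropic planes meet in a line and are moved by isometries of the same determinant, then
they still meet in a line. -/
theorem minor_eq_zero_of_isometry (b : Basis (Fin 4) ℂ U) (hB : B.IsSymm) (hB' : B.Nondegenerate) {e a c : U}
    (hee : B e e = 0) (hea : B e a = 0) (haa : B a a = 0) (hec : B e c = 0) (hcc : B c c = 0)
    (hac : B a c ≠ 0) (ha : LinearIndependent ℂ ![e, a]) (hc : LinearIndependent ℂ ![e, c])
    {f g : U ≃ₗ[ℂ] U} (hf : ∀ x y, B (f x) (f y) = B x y) (hg : ∀ x y, B (g x) (g y) = B x y)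
    (hfg : LinearMap.det (f : U →ₗ[ℂ] U) = LinearMap.det (g : U →ₗ[ℂ] U)) :
    minor B (f e) (f a) (g e) (g c) = 0 ∧
      ¬ (B (f e) (g e) = 0 ∧ B (f e) (g c) = 0 ∧ B (f a) (g e) = 0 ∧ B (f a) (g c) = 0) := by
  obtain ⟨ε, hε, hεa⟩ := exists_sign b hB hB' hee hea haa ha
  obtain ⟨ε', hε', hεc⟩ := exists_sign b hB hB' hee hec hcc hc
  have hε0 : ε ≠ 0 := by rintro rfl; simp at hε
  -- Planes sharing the line of `e` have opposite signs: exchanging `a` and `c` changes the sign of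
  -- the determinant of (e, a, c, y), while the two minors both reduce to -B(e, y) B(a, c).
  have hneg : ε' = -ε := by
    obtain ⟨y, hy⟩ : ∃ y, B e y ≠ 0 := by
      by_contra! h2
      exact ha.ne_zero 0 (hB'.1 e h2)
    have h1 := hεa c y
    have h2 := hεc a y
    rw [det_swap_middle, h1] at h2
    simp only [minor, hec, hea, hB.eq c a] at h2
    have : B e y * B a c * (ε' + ε) = 0 := by linear_combination h2
    rcases mul_eq_zero.1 this with h | h
    · exact absurd h (mul_ne_zero hy hac)
    · linear_combination h
  -- An isometry multiplies the sign of a plane by its determinant.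
  have tr : ∀ (k : U ≃ₗ[ℂ] U) (_ : ∀ x y, B (k x) (k y) = B x y) (a₁ a₂ : U) (η : ℂ)
      (_ : ∀ x y, b.det ![a₁, a₂, x, y] = η * minor B a₁ a₂ x y) (x y : U),
      b.det ![k a₁, k a₂, x, y] =
        LinearMap.det (k : U →ₗ[ℂ] U) * η * minor B (k a₁) (k a₂) x y := by
    intro k hk a₁ a₂ η h x y
    have h1 := b.det_comp (k : U →ₗ[ℂ] U) ![a₁, a₂, k.symm x, k.symm y]
    have h2 : (k : U →ₗ[ℂ] U) ∘ ![a₁, a₂, k.symm x, k.symm y] = ![k a₁, k a₂, x, y] := by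
      ext i; fin_cases i <;> simp
    rw [h2, h] at h1
    rw [h1, mul_assoc]
    congr 2
    simp only [minor]
    rw [← hk a₁, ← hk a₁, ← hk a₂, ← hk a₂, k.apply_symm_apply, k.apply_symm_apply]
  have hfa := tr f hf e a ε hεa
  have hgc := tr g hg e c ε' hεc
  rw [hneg, ← hfg] at hgc
  set δ := LinearMap.det (f : U →ₗ[ℂ] U) with hδ
  have hδ0 : δ ≠ 0 := (LinearEquiv.isUnit_det' f).ne_zero
  constructor
  -- The image planes still have opposite signs. Computing the determinant of the four image vectors
  -- from either plane gives the same minor with opposite factors, while interchanging the two pairs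
  -- is an even permutation; so the minor vanishes.
  · have h1 := hfa (g e) (g c)
    have h2 := hgc (f e) (f a)
    rw [det_swap_pairs, h1] at h2
    have h3 : minor B (g e) (g c) (f e) (f a) = minor B (f e) (f a) (g e) (g c) := by
      simp only [minor, hB.eq (g e), hB.eq (g c)]
      ring
    rw [h3] at h2
    have : 2 * δ * ε * minor B (f e) (f a) (g e) (g c) = 0 := by linear_combination h2
    simpa [hδ0, hε0] using this
  -- If the image planes were orthogonal, `det_gram_of_orthogonal` would apply to the two of them
  -- together. With opposite signs it gives m_f(x', y') m_g(x, y) = -m_f(x, y) m_g(x', y'), so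
  -- m_f(x', y') ≠ 0; taking both pairs equal to (x', y') then gives a contradiction.
  · rintro ⟨h1, h2, h3, h4⟩
    have key := det_gram_of_orthogonal b hB h1 h2 h3 h4
    have hfli : LinearIndependent ℂ ![f e, f a] := by
      have h5 : ![f e, f a] = (f : U →ₗ[ℂ] U) ∘ ![e, a] := by
        ext i; fin_cases i <;> rfl
      rw [h5]
      exact ha.map' (f : U →ₗ[ℂ] U) f.ker
    have hgli : LinearIndependent ℂ ![g e, g c] := by
      have h5 : ![g e, g c] = (g : U →ₗ[ℂ] U) ∘ ![e, c] := by
        ext i; fin_cases i <;> rfl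
      rw [h5]
      exact hc.map' (g : U →ₗ[ℂ] U) g.ker
    obtain ⟨ζ, hζ, hζa⟩ := exists_sign b hB hB' ((hf e e).trans hee) ((hf e a).trans hea)
      ((hf a a).trans haa) hfli
    obtain ⟨x, y, hxy⟩ := exists_minor_ne_zero hB' hfli
    obtain ⟨x', y', hxy'⟩ := exists_minor_ne_zero hB' hgli
    have hζε : ζ = δ * ε := mul_right_cancel₀ hxy ((hζa x y).symm.trans (hfa x y))
    have k1 := key x y x' y'
    rw [hfa, hgc] at k1
    rw [hζε] at hζ
    have k2 : minor B (f e) (f a) x' y' * minor B (g e) (g c) x y =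
        - (minor B (f e) (f a) x y * minor B (g e) (g c) x' y') := by
      linear_combination -k1 - (minor B (f e) (f a) x y * minor B (g e) (g c) x' y') * hζ
    have k3 : minor B (f e) (f a) x' y' ≠ 0 := by
      intro h0
      rw [h0, zero_mul, eq_comm, neg_eq_zero] at k2
      exact mul_ne_zero hxy hxy' k2
    have k4 := key x' y' x' y'
    rw [hfa, hgc] at k4
    have k5 : 2 * (minor B (f e) (f a) x' y' * minor B (g e) (g c) x' y') = 0 := by
      linear_combination -k4 - (minor B (f e) (f a) x' y' * minor B (g e) (g c) x' y') * hζ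
    simp [k3, hxy'] at k5

end Planes

/-! ### Subbundles -/

section Bundles

open Module

theorem SmoothOn.of_local {W : Type*} [NormedAddCommGroup W] [NormedSpace ℂ W] {s : M → W}
    (h : ∀ x, ∃ U : Set M, IsOpen U ∧ x ∈ U ∧ SmoothOn s U) : SmoothOn s Set.univ := fun x _ => by
  obtain ⟨U, hU, hx, hs⟩ := h x
  exact (hs.contMDiffAt (hU.mem_nhds hx)).contMDiffWithinAt

theorem SmoothOn.mono {W : Type*} [NormedAddCommGroup W] [NormedSpace ℂ W] {s : M → W}
    {U U' : Set M} (h : SmoothOn s U) (hU : U' ⊆ U) : SmoothOn s U' := ContMDiffOn.mono h hU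

theorem IsSubbundle.finrank_eq {k : ℕ} {L : M → Submodule ℂ (E n)} (h : IsSubbundle k L) (x : M) :
    finrank ℂ (L x) = k := by
  obtain ⟨U, -, hx, s, -, hs⟩ := h x
  rw [← (hs x hx).2, finrank_span_eq_card (hs x hx).1, Fintype.card_fin]

theorem IsSubbundle.image {k : ℕ} {L : M → Submodule ℂ (E n)} (h : IsSubbundle k L)
    {g : M → E n ≃L[ℂ] E n} (hg : SmoothOn (toEnd g) Set.univ) : IsSubbundle k (image g L) := by
  intro x
  obtain ⟨U, hU, hx, s, hs, hL⟩ := h x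
  refine ⟨U, hU, hx, fun i y => g y (s i y), fun i => ?_, fun y hy => ⟨?_, ?_⟩⟩
  · exact (hg.mono (Set.subset_univ U)).app (hs i)
  · exact (hL y hy).1.map' ((g y : E n ≃L[ℂ] E n) : E n →ₗ[ℂ] E n) (g y).toLinearEquiv.ker
  · rw [Dressing.image, ← (hL y hy).2, Submodule.map_span, ← Set.range_comp]
    rfl

/-- With `S` a local frame and `St` its transpose for the metric, the projection is S (St S)⁻¹ St;
the Gram map St S is invertible because `V` is non-degenerate. -/
theorem smoothOn_projV {k : ℕ} {V : M → Submodule ℂ (E n)} (h : IsSubbundle k V)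
    (hV : ∀ x, Nondeg (V x)) : SmoothOn (projV V) Set.univ := by
  refine SmoothOn.of_local fun x => ?_
  obtain ⟨U, hU, hx, s, hs, hL⟩ := h x
  refine ⟨U, hU, hx, ?_⟩
  -- the frame, its transpose, and the Gram map
  let S : M → (Fin k → ℂ) →L[ℂ] E n := fun y =>
    ∑ i, (ContinuousLinearMap.proj (R := ℂ) (φ := fun _ : Fin k => ℂ) i).smulRight (s i y)
  let St : M → E n →L[ℂ] (Fin k → ℂ) := fun y =>
    ∑ i, (formL n (s i y)).smulRight (Pi.single i 1)
  have hSa : ∀ y c, S y c = ∑ i, c i • s i y := fun y c => by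
    simp [S, sum_apply]
  have hSta : ∀ y v i, St y v i = form n (s i y) v := fun y v i => by
    simp [St, sum_apply, Finset.sum_apply, Pi.single_apply]
  have hS : SmoothOn S U := by
    refine SmoothOn.sum fun i _ => ?_
    exact SmoothOn.bilin ((ContinuousLinearMap.smulRightL ℂ (Fin k → ℂ)
      (E n)).bilinearRestrictScalars ℝ) (SmoothOn.const _) (hs i)
  have hfs : ∀ i, SmoothOn (fun y => formL n (s i y)) U := fun i =>
    SmoothOn.comp_contDiff (f := formL n) ((formL n).restrictScalars ℝ).contDiff (hs i)
  have hSt : SmoothOn St U := by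
    refine SmoothOn.sum fun i _ => ?_
    exact SmoothOn.bilin ((ContinuousLinearMap.smulRightL ℂ (E n)
      (Fin k → ℂ)).bilinearRestrictScalars ℝ) (hfs i) (SmoothOn.const _)
  let G : M → (Fin k → ℂ) →L[ℂ] (Fin k → ℂ) := fun y => (St y).comp (S y)
  have hG : SmoothOn G U :=
    SmoothOn.bilin ((ContinuousLinearMap.compL ℂ (Fin k → ℂ) (E n)
      (Fin k → ℂ)).bilinearRestrictScalars ℝ) hSt hS
  have hSmem : ∀ y ∈ U, ∀ c, S y c ∈ V y := fun y hy c => by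
    rw [hSa, ← (hL y hy).2]
    exact Submodule.sum_mem _ fun i _ =>
      Submodule.smul_mem _ _ (Submodule.subset_span ⟨i, rfl⟩)
  have hperp : ∀ y ∈ U, ∀ v, St y v = 0 → v ∈ perp (V y) := fun y hy v hv => by
    rw [mem_perp, ← (hL y hy).2]
    intro w hw
    refine Submodule.span_induction ?_ ?_ ?_ ?_ hw
    · rintro _ ⟨i, rfl⟩
      rw [← hSta, hv]; rfl
    · simp
    · intro a b _ _ ha hb
      rw [map_add, LinearMap.add_apply, ha, hb, add_zero]
    · intro c a _ ha
      rw [map_smul, LinearMap.smul_apply, ha, smul_zero]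
  have hinj : ∀ y ∈ U, Function.Injective (G y) := fun y hy => by
    rw [injective_iff_map_eq_zero]
    intro c hc
    have h1 : S y c = 0 := by
      have h2 : S y c ∈ V y ⊓ perp (V y) := ⟨hSmem y hy c, hperp y hy _ hc⟩
      rw [(hV y).isCompl.inf_eq_bot] at h2
      simpa using h2
    rw [hSa] at h1
    funext i
    exact Fintype.linearIndependent_iff.1 (hL y hy).1 c h1 i
  have hinv : ∀ y ∈ U, ∃ e : (Fin k → ℂ) ≃L[ℂ] (Fin k → ℂ), (e : (Fin k → ℂ) →L[ℂ] _) = G y :=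
    fun y hy => ⟨(LinearEquiv.ofInjectiveEndo (G y : (Fin k → ℂ) →ₗ[ℂ] _)
      (hinj y hy)).toContinuousLinearEquiv, by ext1 v; rfl⟩
  have hGi : SmoothOn (fun y => (G y).inverse) U := fun y hy => by
    obtain ⟨e, he⟩ := hinv y hy
    have h1 : ContDiffAt ℝ ∞ (ContinuousLinearMap.inverse : ((Fin k → ℂ) →L[ℂ] (Fin k → ℂ)) → _)
        (G y) := he ▸ (contDiffAt_map_inverse (𝕜 := ℂ) e).restrict_scalars ℝ
    exact (h1.contMDiffAt (n := ∞)).comp_contMDiffWithinAt y (hG y hy)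
  have hP : SmoothOn (fun y => (S y).comp (((G y).inverse).comp (St y))) U :=
    SmoothOn.bilin ((ContinuousLinearMap.compL ℂ (E n) (Fin k → ℂ)
      (E n)).bilinearRestrictScalars ℝ) hS
      (SmoothOn.bilin ((ContinuousLinearMap.compL ℂ (E n) (Fin k → ℂ)
        (Fin k → ℂ)).bilinearRestrictScalars ℝ) hGi hSt)
  refine hP.congr fun y hy => ((hV y).proj_unique ?_ ?_).symm
  · exact fun v => hSmem y hy _
  · intro v
    refine hperp y hy _ ?_
    obtain ⟨e, he⟩ := hinv y hy
    have h1 : St y (S y ((G y).inverse (St y v))) = G y ((G y).inverse (St y v)) := rfl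
    rw [map_sub, ContinuousLinearMap.comp_apply, ContinuousLinearMap.comp_apply, h1, ← he,
      ContinuousLinearMap.inverse_equiv]
    simp

/-- Two planes which meet, but are not orthogonal. -/
def MeetInLine (L L' : Submodule ℂ (E n)) : Prop :=
  (∃ w ∈ L ⊓ L', w ≠ 0) ∧ ∃ u ∈ L, ∃ v ∈ L', form n u v ≠ 0

theorem span_pair_eq {L : Submodule ℂ (E n)} (h2 : finrank ℂ L = 2) {e a : E n} (he : e ∈ L)
    (ha : a ∈ L) (h : LinearIndependent ℂ ![e, a]) : Submodule.span ℂ {e, a} = L := by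
  refine Submodule.eq_of_le_of_finrank_eq ?_ ?_
  · rw [Submodule.span_le]
    rintro _ (rfl | rfl)
    exacts [he, ha]
  · have := finrank_span_eq_card h
    rw [Matrix.range_cons_cons_empty] at this
    rw [this, h2, Fintype.card_fin]

theorem exists_pair {L : Submodule ℂ (E n)} (h2 : finrank ℂ L = 2) {e : E n} (he0 : e ≠ 0) :
    ∃ a ∈ L, LinearIndependent ℂ ![e, a] := by
  by_contra! h
  have : L ≤ Submodule.span ℂ {e} := fun a ha => by
    have h1 := h a ha
    rw [LinearIndependent.pair_iff' he0] at h1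
    push Not at h1
    obtain ⟨c, hc⟩ := h1
    exact Submodule.mem_span_singleton.2 ⟨c, hc⟩
  have h3 := Submodule.finrank_mono this
  rw [h2, finrank_span_singleton he0] at h3
  omega

theorem MeetInLine.of_isometry {V L L' : Submodule ℂ (E n)} (hV : Nondeg V)
    (h4 : finrank ℂ V = 4) (hL : Isotropic L) (hL' : Isotropic L') (hLV : L ≤ V) (hLV' : L' ≤ V)
    (h2 : finrank ℂ L = 2) (h2' : finrank ℂ L' = 2)
    (h1 : finrank ℂ (L ⊓ L' : Submodule ℂ (E n)) = 1) {f g : E n ≃L[ℂ] E n} (hf : Orthogonal f)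
    (hg : Orthogonal g) (hfV : ∀ v ∈ V, f v ∈ V) (hgV : ∀ v ∈ V, g v ∈ V)
    (hdet : detOn V f = detOn V g) :
    MeetInLine (L.map (f : E n →ₗ[ℂ] E n)) (L'.map (g : E n →ₗ[ℂ] E n)) := by
  obtain ⟨⟨e, heL, heL'⟩, he0', hemul⟩ := finrank_eq_one_iff'.1 h1
  have he0 : e ≠ 0 := fun h => he0' (Subtype.ext h)
  obtain ⟨a, haL, hea⟩ := exists_pair h2 he0
  obtain ⟨c, hcL', hec⟩ := exists_pair h2' he0
  -- Otherwise `c` is orthogonal to `L`, hence lies in `L` by maximality, and so in the line spanned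
  -- by `e`.
  have hac : form n a c ≠ 0 := by
    intro h0
    have hcL : c ∈ L := by
      refine hV.mem_of_isotropic hL hLV h4 h2 (hLV' hcL') fun w hw => ?_
      rw [← span_pair_eq h2 heL haL hea, Submodule.mem_span_pair] at hw
      obtain ⟨α, β, rfl⟩ := hw
      rw [map_add, map_smul, map_smul, LinearMap.add_apply, LinearMap.smul_apply,
        LinearMap.smul_apply, h0, hL' e heL' c hcL', smul_zero, smul_zero, add_zero]
    obtain ⟨α, hα⟩ := hemul ⟨c, hcL, hcL'⟩
    rw [LinearIndependent.pair_iff' he0] at hec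
    exact hec α (congrArg Subtype.val hα)
  let B : LinearMap.BilinForm ℂ V := (form n).restrict V
  have hBs : B.IsSymm := ⟨fun u v => form_comm _ _⟩
  let fV : V ≃ₗ[ℂ] V := LinearEquiv.ofInjectiveEndo
    ((f : E n →ₗ[ℂ] E n).restrict hfV) (fun u v huv => Subtype.ext
      (f.injective (congrArg Subtype.val huv)))
  let gV : V ≃ₗ[ℂ] V := LinearEquiv.ofInjectiveEndo
    ((g : E n →ₗ[ℂ] E n).restrict hgV) (fun u v huv => Subtype.ext
      (g.injective (congrArg Subtype.val huv)))
  have hdet' : LinearMap.det (fV : V →ₗ[ℂ] V) = LinearMap.det (gV : V →ₗ[ℂ] V) := by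
    have hfV' : ∀ w ∈ V, (f : E n →ₗ[ℂ] E n) w ∈ V := hfV
    have hgV' : ∀ w ∈ V, (g : E n →ₗ[ℂ] E n) w ∈ V := hgV
    rw [detOn, detOn, dif_pos hfV', dif_pos hgV'] at hdet
    rw [show (fV : V →ₗ[ℂ] V) = (f : E n →ₗ[ℂ] E n).restrict hfV from rfl,
      show (gV : V →ₗ[ℂ] V) = (g : E n →ₗ[ℂ] E n).restrict hgV from rfl, hdet]
  have lift : ∀ {u v : E n} (hu : u ∈ V) (hv : v ∈ V), LinearIndependent ℂ ![u, v] →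
      LinearIndependent ℂ ![(⟨u, hu⟩ : V), ⟨v, hv⟩] := by
    intro u v hu hv h
    refine LinearIndependent.of_comp V.subtype ?_
    have h5 : V.subtype ∘ ![(⟨u, hu⟩ : V), ⟨v, hv⟩] = ![u, v] := by
      funext i; fin_cases i <;> rfl
    rw [h5]
    exact h
  have key := minor_eq_zero_of_isometry (finBasisOfFinrankEq ℂ V h4) hBs hV
    (e := ⟨e, hLV heL⟩) (a := ⟨a, hLV haL⟩) (c := ⟨c, hLV' hcL'⟩) (hL e heL e heL)
    (hL e heL a haL) (hL a haL a haL) (hL' e heL' c hcL') (hL' c hcL' c hcL') hac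
    (lift _ _ hea) (lift _ _ hec) (f := fV) (g := gV) (fun x y => hf x y) (fun x y => hg x y) hdet'
  have k1 : form n (f e) (g e) * form n (f a) (g c) - form n (f e) (g c) * form n (f a) (g e) = 0 :=
    key.1
  have k2 : ¬ (form n (f e) (g e) = 0 ∧ form n (f e) (g c) = 0 ∧ form n (f a) (g e) = 0 ∧
    form n (f a) (g c) = 0) := key.2
  -- a vector of the first plane orthogonal to the second one lies in it
  have hmem : ∀ α β : ℂ, α * form n (f e) (g e) + β * form n (f a) (g e) = 0 →
      α * form n (f e) (g c) + β * form n (f a) (g c) = 0 → (α ≠ 0 ∨ β ≠ 0) →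
      ∃ w ∈ L.map (f : E n →ₗ[ℂ] E n) ⊓ L'.map (g : E n →ₗ[ℂ] E n), w ≠ 0 := by
    intro α β hα hβ h0
    have hw : α • e + β • a ∈ L := L.add_mem (L.smul_mem _ heL) (L.smul_mem _ haL)
    refine ⟨f (α • e + β • a), ⟨⟨_, hw, rfl⟩, ?_⟩, ?_⟩
    · have hgmap : finrank ℂ (L'.map (g : E n →ₗ[ℂ] E n)) = 2 :=
        (LinearEquiv.finrank_map_eq (g : E n ≃ₗ[ℂ] E n) L').trans h2'
      refine hV.mem_of_isotropic (hg.isotropic_map hL') ?_ h4 hgmap (hfV _ (hLV hw)) ?_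
      · rintro _ ⟨v, hv, rfl⟩
        exact hgV v (hLV' hv)
      · rintro _ ⟨v, hv, rfl⟩
        rw [← span_pair_eq h2' heL' hcL' hec, SetLike.mem_coe, Submodule.mem_span_pair] at hv
        obtain ⟨γ, η, rfl⟩ := hv
        change form n (g (γ • e + η • c)) (f (α • e + β • a)) = 0
        rw [form_comm]
        simp only [map_add, map_smul, LinearMap.add_apply, LinearMap.smul_apply, smul_eq_mul]
        linear_combination γ * hα + η * hβ
    · intro h
      have h5 : α • e + β • a = 0 := f.injective (h.trans (map_zero f).symm)
      have h6 := LinearIndependent.pair_iff.1 hea α β h5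
      tauto
  refine ⟨?_, ?_⟩
  -- The 2 × 2 pairing matrix of the image planes is singular but not zero. A kernel vector is read
  -- off whichever of its columns does not vanish.
  · by_cases h3 : form n (f e) (g e) = 0 ∧ form n (f a) (g e) = 0
    · refine hmem (form n (f a) (g c)) (-form n (f e) (g c)) ?_ (by ring) ?_
      · rw [h3.1, h3.2]; ring
      · simp only [ne_eq, neg_eq_zero]
        tauto
    · refine hmem (form n (f a) (g e)) (-form n (f e) (g e)) (by ring)
        (by linear_combination -k1) ?_
      simp only [ne_eq, neg_eq_zero]
      tauto
  · by_contra! h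
    exact k2 ⟨h _ ⟨e, heL, rfl⟩ _ ⟨e, heL', rfl⟩, h _ ⟨e, heL, rfl⟩ _ ⟨c, hcL', rfl⟩,
      h _ ⟨a, haL, rfl⟩ _ ⟨e, heL', rfl⟩, h _ ⟨a, haL, rfl⟩ _ ⟨c, hcL', rfl⟩⟩

/-- Where some `t j` of a frame of `L'` is not orthogonal to `L`, the vectors of `L` orthogonal to
it form a line, spanned by (s₁, t_j) s₀ - (s₀, t_j) s₁. Since `L'` is isotropic this line contains
the nonzero intersection, hence equals it, and its generator is smooth. -/
theorem IsSubbundle.inf {L L' : M → Submodule ℂ (E n)} (h : IsSubbundle 2 L)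
    (h' : IsSubbundle 2 L') (hL' : ∀ x, Isotropic (L' x)) (hm : ∀ x, MeetInLine (L x) (L' x)) :
    IsSubbundle 1 fun x => L x ⊓ L' x := by
  intro x
  obtain ⟨U, hU, hx, s, hs, hsL⟩ := h x
  obtain ⟨U', hU', hx', t, ht, htL⟩ := h' x
  obtain ⟨i, j, hij⟩ : ∃ i j, form n (s i x) (t j x) ≠ 0 := by
    by_contra! h0
    obtain ⟨-, u, hu, v, hv, huv⟩ := hm x
    refine huv ?_
    rw [← (hsL x hx).2] at hu
    rw [← (htL x hx').2] at hv
    obtain ⟨a, rfl⟩ := (Submodule.mem_span_range_iff_exists_fun ℂ).1 hu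
    obtain ⟨b, rfl⟩ := (Submodule.mem_span_range_iff_exists_fun ℂ).1 hv
    simp [h0]
  have hsmooth : ∀ k, SmoothOn (fun y => form n (s k y) (t j y)) (U ∩ U') := fun k =>
    ((hs k).mono Set.inter_subset_left).form ((ht j).mono Set.inter_subset_right)
  have hopen : IsOpen (U ∩ U' ∩ {y | form n (s i y) (t j y) ≠ 0}) :=
    (hsmooth i).continuousOn.isOpen_inter_preimage (hU.inter hU') isOpen_compl_singleton
  refine ⟨_, hopen, ⟨⟨hx, hx'⟩, hij⟩, fun _ y =>
    form n (s 1 y) (t j y) • s 0 y - form n (s 0 y) (t j y) • s 1 y, fun _ => ?_, ?_⟩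
  · refine SmoothOn.mono ?_ Set.inter_subset_left
    exact ((hsmooth 1).smul ((hs 0).mono Set.inter_subset_left)).sub
      ((hsmooth 0).smul ((hs 1).mono Set.inter_subset_left))
  · rintro y ⟨⟨hy, hy'⟩, hne⟩
    set a := s 0 y
    set b := s 1 y
    set c := t j y
    have hab : LinearIndependent ℂ ![a, b] := by
      have := (hsL y hy).1
      convert this using 1
      funext k; fin_cases k <;> rfl
    have hLab : ∀ v, v ∈ L y ↔ ∃ α β : ℂ, α • a + β • b = v := by
      intro v
      rw [← (hsL y hy).2, Submodule.mem_span_range_iff_exists_fun]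
      constructor
      · rintro ⟨d, rfl⟩
        exact ⟨d 0, d 1, by rw [Fin.sum_univ_two]⟩
      · rintro ⟨α, β, rfl⟩
        exact ⟨![α, β], by rw [Fin.sum_univ_two]; rfl⟩
    have hne' : form n a c ≠ 0 ∨ form n b c ≠ 0 := by
      fin_cases i
      · exact Or.inl hne
      · exact Or.inr hne
    have hcL : c ∈ L' y := by
      rw [← (htL y hy').2]
      exact Submodule.subset_span ⟨j, rfl⟩
    set w := form n b c • a - form n a c • b with hw
    have hw0 : w ≠ 0 := by
      intro h0
      have := LinearIndependent.pair_iff.1 hab (form n b c) (-form n a c)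
        (by rw [← h0, hw, neg_smul, sub_eq_add_neg])
      simp only [neg_eq_zero] at this
      tauto
    have hmul : ∀ v ∈ L y ⊓ L' y, ∃ κ : ℂ, v = κ • w := by
      rintro v ⟨hv, hv'⟩
      obtain ⟨α, β, rfl⟩ := (hLab v).1 hv
      have h0 := hL' y _ hv' _ hcL
      simp only [map_add, map_smul, LinearMap.add_apply, LinearMap.smul_apply, smul_eq_mul] at h0
      rcases hne' with h1 | h1
      · refine ⟨-β / form n a c, ?_⟩
        rw [hw]
        match_scalars
        · field_simp; linear_combination h0
        · field_simp
      · refine ⟨α / form n b c, ?_⟩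
        rw [hw]
        match_scalars
        · field_simp
        · field_simp; linear_combination h0
    obtain ⟨⟨w', hw'L, hw'0⟩, -⟩ := hm y
    obtain ⟨κ, hκ⟩ := hmul w' hw'L
    have hκ0 : κ ≠ 0 := by
      rintro rfl
      exact hw'0 (by rw [hκ, zero_smul])
    have hwL : w ∈ L y ⊓ L' y := by
      have : w = κ⁻¹ • w' := by rw [hκ, smul_smul, inv_mul_cancel₀ hκ0, one_smul]
      rw [this]
      exact Submodule.smul_mem _ _ hw'L
    refine ⟨LinearIndependent.of_subsingleton (0 : Fin 1) hw0, le_antisymm ?_ ?_⟩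
    · rw [Submodule.span_le]
      rintro _ ⟨_, rfl⟩
      exact hwL
    · intro v hv
      obtain ⟨κ, rfl⟩ := hmul v hv
      exact Submodule.smul_mem _ _ (Submodule.subset_span ⟨0, rfl⟩)

end Bundles

/-! ### Laurent expansions -/

section Laurent

open Filter

/-- λ²F extends to an entire function. Taking its divided difference at 0 twice subtracts the
principal part of `F` and leaves an entire function, which tends to `c` at infinity and is constant
by Liouville. -/
theorem eq_laurent_of_tendsto {A : Type*} [NormedAddCommGroup A] [NormedSpace ℂ A]
    [CompleteSpace A] {F H : ℂ → A} {H' c : A} (hF : DifferentiableOn ℂ F {0}ᶜ)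
    (hH : HasDerivAt H H' 0)  (hFH : ∀ᶠ l in 𝓝[≠] (0 : ℂ), F l = (l ^ 2)⁻¹ • H l)
    (hc : Tendsto (fun m => F m⁻¹) (𝓝[≠] (0 : ℂ)) (𝓝 c)) {l : ℂ} (hl : l ≠ 0) :
    F l = (l ^ 2)⁻¹ • H 0 + l⁻¹ • H' + c := by
  let K : ℂ → A := fun l => if l = 0 then H 0 else l ^ 2 • F l
  have hK : ∀ l ≠ 0, K l = l ^ 2 • F l := fun l hl => if_neg hl
  have hK0 : K 0 = H 0 := if_pos rfl
  have hKH : K =ᶠ[𝓝 0] H := by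
    rw [eventually_nhdsWithin_iff] at hFH
    filter_upwards [hFH] with l hl
    by_cases h : l = 0
    · rw [h, hK0]
    · rw [hK l h, hl h, smul_smul, mul_inv_cancel₀ (pow_ne_zero 2 h), one_smul]
  have hKd0 : HasDerivAt K H' 0 := hH.congr_of_eventuallyEq hKH
  have hKd : Differentiable ℂ K := fun l => by
    by_cases h : l = 0
    · rw [h]; exact hKd0.differentiableAt
    · have h1 : K =ᶠ[𝓝 l] fun l => l ^ 2 • F l := by
        filter_upwards [isOpen_ne.mem_nhds h] with z hz using hK z hz
      refine DifferentiableAt.congr_of_eventuallyEq ?_ h1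
      exact (differentiableAt_id.pow 2).smul (hF.differentiableAt (isOpen_compl_singleton.mem_nhds h))
  have hdiff : ∀ f : ℂ → A, Differentiable ℂ f → Differentiable ℂ (dslope f 0) := fun f hf => by
    rw [← differentiableOn_univ] at hf ⊢
    exact (Complex.differentiableOn_dslope univ_mem).2 hf
  have hG := hdiff _ (hdiff _ hKd)
  have hGl : ∀ l ≠ 0, dslope (dslope K 0) 0 l = F l - ((l ^ 2)⁻¹ • H 0 + l⁻¹ • H') := fun l hl => by
    rw [dslope_of_ne _ hl, slope_def_module, dslope_of_ne _ hl, dslope_same, hKd0.deriv,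
      slope_def_module, hK l hl, hK0, sub_zero]
    match_scalars <;> field_simp
  have hlim : Tendsto (dslope (dslope K 0) 0) (cocompact ℂ) (𝓝 c) := by
    rw [← Metric.cobounded_eq_cocompact]
    have h0 : Tendsto (fun l : ℂ => l⁻¹) (Bornology.cobounded ℂ) (𝓝[≠] 0) :=
      tendsto_inv₀_cobounded'
    have h1 : Tendsto F (Bornology.cobounded ℂ) (𝓝 c) := by
      refine (hc.comp h0).congr fun l => ?_
      simp
    have h2 : Tendsto (fun l : ℂ => l⁻¹) (Bornology.cobounded ℂ) (𝓝 0) :=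
      h0.mono_right nhdsWithin_le_nhds
    have h3 : Tendsto (fun l : ℂ => F l - ((l⁻¹ ^ 2) • H 0 + l⁻¹ • H')) (Bornology.cobounded ℂ)
        (𝓝 (c - (((0 : ℂ) ^ 2) • H 0 + (0 : ℂ) • H'))) :=
      h1.sub (((h2.pow 2).smul_const _).add (h2.smul_const _))
    have h4 : c - (((0 : ℂ) ^ 2) • H 0 + (0 : ℂ) • H') = c := by simp
    rw [h4] at h3
    refine h3.congr' ?_
    filter_upwards [Bornology.eventually_ne_cobounded (0 : ℂ)] with l hl
    rw [hGl l hl, inv_pow]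
  have := hG.apply_eq_of_tendsto_cocompact l hlim
  rw [hGl l hl, sub_eq_iff_eq_add] at this
  rw [this, add_comm]

variable {A : Type*} [NormedRing A] [NormedAlgebra ℂ A]

/-- The Laurent expansion of a dressed family, from its behaviour at `0` and at `∞`. -/
theorem dressed_eq_laurent [CompleteSpace A] {F R S T P Q Z : ℂ → A} {R' S' D N q : A}
    (hF : DifferentiableOn ℂ F {0}ᶜ) (hR : HasDerivAt R R' 0) (hS : HasDerivAt S S' 0)
    (hT : DifferentiableAt ℂ T 0) (hP : ContinuousAt P 0) (hQ : ContinuousAt Q 0)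
    (hZ : ContinuousAt Z 0)
    (h0 : ∀ᶠ l in 𝓝[≠] (0 : ℂ),
      F l = R l * (T l + (D + l⁻¹ • N + ((l ^ 2)⁻¹ - 1) • q) * S l))
    (hinf : ∀ᶠ m in 𝓝[≠] (0 : ℂ),
      F m⁻¹ = P m * (Z m + (D + m • N + (m ^ 2 - 1) • q) * Q m)) {l : ℂ} (hl : l ≠ 0) :
    F l = (l ^ 2)⁻¹ • (R 0 * q * S 0) + l⁻¹ • (R' * q * S 0 + R 0 * (N * S 0 + q * S'))
      + P 0 * (Z 0 + (D - q) * Q 0) := by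
  have hid : HasDerivAt (fun l : ℂ => l) 1 0 := hasDerivAt_id _
  have hsq : HasDerivAt (fun l : ℂ => l ^ 2) 0 0 := by
    simpa using hasDerivAt_pow 2 (0 : ℂ)
  -- This is λ²F near 0. The derivative term `T` carries a factor λ², so it affects neither the
  -- value nor the first derivative at 0.
  have hH : HasDerivAt (fun l => R l * (l ^ 2 • T l + (l ^ 2 • (D - q) + l • N + q) * S l))
      (R' * q * S 0 + R 0 * (N * S 0 + q * S')) 0 := by
    have h1 := hsq.smul hT.hasDerivAt
    have h2 := (((hsq.smul_const (D - q)).add (hid.smul_const N)).add_const q).mul hS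
    have h3 := hR.mul (h1.add h2)
    refine (h3.congr_deriv ?_)
    simp [mul_assoc]
  have hc : Tendsto (fun m => F m⁻¹) (𝓝[≠] (0 : ℂ)) (𝓝 (P 0 * (Z 0 + (D - q) * Q 0))) := by
    have h1 : ContinuousAt (fun m : ℂ => P m * (Z m + (D + m • N + (m ^ 2 - 1) • q) * Q m)) 0 := by
      fun_prop
    have h2 := h1.tendsto.mono_left (nhdsWithin_le_nhds (s := {0}ᶜ))
    have h3 : P 0 * (Z 0 + (D + (0 : ℂ) • N + ((0 : ℂ) ^ 2 - 1) • q) * Q 0) =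
        P 0 * (Z 0 + (D - q) * Q 0) := by
      simp [sub_eq_add_neg]
    rw [h3] at h2
    refine h2.congr' ?_
    filter_upwards [hinf] with m hm using hm.symm
  have := eq_laurent_of_tendsto hF hH (by
    filter_upwards [h0, self_mem_nhdsWithin] with l hl hl0
    have hl0 : l ≠ 0 := hl0
    have h5 : (l ^ 2) * ((l ^ 2)⁻¹ - 1) = 1 - l ^ 2 := by field_simp
    rw [eq_inv_smul_iff₀ (pow_ne_zero 2 hl0), hl, ← mul_smul_comm, smul_add, ← smul_mul_assoc]
    congr 3
    match_scalars <;> field_simp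
    ring) hc hl
  rw [this]
  simp [mul_assoc]

end Laurent

/-! ### Block decompositions along a projection, in a noncommutative ring -/

section Splitting

variable {R : Type*} [Ring R]

/-- The decomposition of a connection along a projection `p` with derivative `δ`. -/
theorem splitting_eq {p δ d b : R} (hp : p * p = p) (hd : p * d - d * p = δ) (hb : b = p * b + b * p) :
    p * (δ + (d + b) * p) + (1 - p) * (-δ + (d + b) * (1 - p)) = d := by
  -- The hypothesis on `b` says that both its diagonal blocks vanish, and `hd` says that `p` is
  -- parallel for the connection with form `d`; so `b` drops out and `d` survives whole.
  have hb1 : p * b * p = 0 := by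
    have := congrArg (fun t => p * t) hb
    simp only [mul_add, ← mul_assoc, hp] at this
    simpa using this
  have h1 : p * (δ + (d + b) * p) + (1 - p) * (-δ + (d + b) * (1 - p)) =
      d + (b - (p * b + b * p)) + 2 • (p * b * p) + (p * δ + p * δ - δ) -
        (p * d + d * p - 2 • (p * d * p)) := by noncomm_ring
  have h2 : p * d + d * p - 2 • (p * d * p) = p * δ + p * δ - δ := by
    rw [← hd]
    have : p * (p * d - d * p) + p * (p * d - d * p) - (p * d - d * p) =
      (p * p) * d + (p * p) * d - p * d + d * p - 2 • (p * d * p) := by noncomm_ring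
    rw [this, hp]; abel
  rw [h1, hb1, h2, ← hb]
  simp

/-- Conjugation by the reflection fixes diagonal blocks and negates the off-diagonal ones. Complex
scalars serve only to divide by 2. -/
theorem offDiag_of_reflection [Module ℂ R] {p y : R} (hp : p * p = p)
    (hy : (p - (1 - p)) * y * (p - (1 - p)) = -y) : y = p * y + y * p := by
  have h2 : ∀ z : R, 2 • z = 0 → z = 0 := fun z hz => by
    have : (2 : ℂ) • z = 0 := by rw [two_smul, ← two_nsmul]; exact hz
    exact (smul_eq_zero.1 this).resolve_left two_ne_zero
  have e1 : (p - (1 - p)) * y * (p - (1 - p)) =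
    4 • (p * y * p) - 2 • (p * y) - 2 • (y * p) + y := by noncomm_ring
  rw [e1] at hy
  have e2 : p * y * p = 0 := by
    refine h2 _ ?_
    have := congrArg (fun t => p * t * p) hy
    have e3 : p * (4 • (p * y * p) - 2 • (p * y) - 2 • (y * p) + y) * p =
      4 • ((p * p) * y * (p * p)) - 2 • ((p * p) * y * p) - 2 • (p * y * (p * p)) + p * y * p := by
      noncomm_ring
    simp only [e3, hp] at this
    have e4 : 4 • (p * y * p) - 2 • (p * y * p) - 2 • (p * y * p) + p * y * p - p * -y * p =
      2 • (p * y * p) := by noncomm_ring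
    rw [← e4, this, sub_self]
  refine sub_eq_zero.1 (h2 _ ?_)
  rw [e2] at hy
  have e5 : 2 • (y - (p * y + y * p)) = (4 • 0 - 2 • (p * y) - 2 • (y * p) + y) - -y := by abel
  rw [e5, hy, sub_self]

/-- The form pδ - (1 - p)δ is that of 𝒟_V, for which `p` is parallel; subtracting `q` and gauging by
`r`, both commuting with `p`, keep it parallel. The hypothesis `ht` is the derivative of sp = ps. -/
theorem commutator_gauge {p δ r s t q : R} (hp : p * p = p) (hδ : δ = δ * p + p * δ)
    (hr : p * r = r * p) (hs : p * s = s * p) (hrs : r * s = 1) (hq : p * q = q * p)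
    (ht : t * p + s * δ = δ * s + p * t) :
    p * (r * (t + (p * δ - (1 - p) * δ - q) * s)) - r * (t + (p * δ - (1 - p) * δ - q) * s) * p
      = δ := by
  have h1 : p * (r * (t + (p * δ - (1 - p) * δ - q) * s)) -
      r * (t + (p * δ - (1 - p) * δ - q) * s) * p =
      (p * r) * (t + (p * δ - (1 - p) * δ - q) * s) -
      r * (t * p + (p * δ - (1 - p) * δ - q) * (s * p)) := by noncomm_ring
  rw [h1, hr, ← hs]
  have h2 : t * p = δ * s + p * t - s * δ := eq_sub_of_add_eq ht
  rw [h2]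
  have h3 : r * p * (t + (p * δ - (1 - p) * δ - q) * s) -
      r * (δ * s + p * t - s * δ + (p * δ - (1 - p) * δ - q) * (p * s)) =
      (r * s) * δ - r * δ * s + r * (p * (p * δ - (1 - p) * δ) - (p * δ - (1 - p) * δ) * p) * s
      - r * (p * q - q * p) * s := by noncomm_ring
  have h4 : p * (p * δ - (1 - p) * δ) - (p * δ - (1 - p) * δ) * p = δ := by
    have h5 : δ * p = δ - p * δ := eq_sub_of_add_eq hδ.symm
    have h6 : p * (p * δ - (1 - p) * δ) - (p * δ - (1 - p) * δ) * p =
      (p * p) * δ + (p * p) * δ - p * δ - (p * (δ * p) + p * (δ * p) - δ * p) := by noncomm_ring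
    rw [h6, h5]
    have h7 : p * p * δ + p * p * δ - p * δ - (p * (δ - p * δ) + p * (δ - p * δ) - (δ - p * δ)) =
      p * p * δ + p * p * δ - p * δ - (2 • (p * δ) - 2 • (p * p * δ) - δ + p * δ) := by noncomm_ring
    rw [h7, hp]; abel
  rw [h3, h4, hq, hrs]
  noncomm_ring

end Splitting

/-! ### Holomorphic families of bundle automorphisms -/

section Families

open Filter

/-- A family of bundle automorphisms which is holomorphic near the parameter `0`, together with its
first derivatives. -/
structure HoloFamily (R : ℂ → M → E n ≃L[ℂ] E n) : Prop where
  smooth : ∀ᶠ l in 𝓝 (0 : ℂ), SmoothOn (toEnd (R l)) Set.univ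
  differentiableAt : ∀ x, DifferentiableAt ℂ (fun l => toEnd (R l) x) 0
  differentiableAt_diff : ∀ x X, DifferentiableAt ℂ (fun l => diff (toEnd (R l)) x X) 0

section

variable {W : Type*} [NormedAddCommGroup W] [NormedSpace ℂ W]

theorem diff_sum_smul {ι : Type*} (I : Finset ι) (a : ι → ℂ) {s : ι → M → W} {x : M}
    (hs : ∀ i, SmoothOn (s i) Set.univ) (X) :
    diff (fun y => ∑ i ∈ I, a i • s i y) x X = ∑ i ∈ I, a i • diff (s i) x X := by
  classical
  induction I using Finset.induction_on with
  | empty => simp only [Finset.sum_empty]; rw [diff_const]; rfl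
  | insert i I hi ih =>
    have h1 : SmoothOn (fun y => a i • s i y) Set.univ := (hs i).const_smul (a i)
    have h2 : SmoothOn (fun y => ∑ i ∈ I, a i • s i y) Set.univ :=
      SmoothOn.sum fun i _ => (hs i).const_smul (a i)
    have h3 : (fun y => ∑ j ∈ insert i I, a j • s j y) =
        (fun y => a i • s i y) + fun y => ∑ j ∈ I, a j • s j y := by
      funext y
      rw [Finset.sum_insert hi]; rfl
    rw [h3, diff_add (h1.diffAt isOpen_univ (Set.mem_univ x))
      (h2.diffAt isOpen_univ (Set.mem_univ x)), add_apply, ih, Finset.sum_insert hi]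
    congr 1
    have h4 := diff_bilin ((ContinuousLinearMap.lsmul ℂ ℂ).bilinearRestrictScalars ℝ)
      (SmoothOn.diffAt (SmoothOn.const (a i)) isOpen_univ (Set.mem_univ x))
      ((hs i).diffAt isOpen_univ (Set.mem_univ x)) X
    rw [diff_const] at h4
    refine h4.trans ?_
    simp

end

/-- The parameter enters only through scalar coefficients of a finite sum of fixed sections, so
differentiating along the surface leaves rational coefficients in λ. -/
theorem HoloFamily.of_rational {R : ℂ → M → E n ≃L[ℂ] E n} {p : Polynomial ℂ} {N : ℕ}
    {c : ℕ → M → EndE n} (hc : ∀ k, SmoothOn (c k) Set.univ) (hp : p.eval 0 ≠ 0)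
    (h : ∀ᶠ l in 𝓝 (0 : ℂ), ∀ x,
      toEnd (R l) x = (p.eval l)⁻¹ • ∑ k ∈ Finset.range (N + 1), l ^ k • c k x) :
    HoloFamily R := by
  have h' : ∀ᶠ l in 𝓝 (0 : ℂ), toEnd (R l) =
      fun x => ∑ k ∈ Finset.range (N + 1), ((p.eval l)⁻¹ * l ^ k) • c k x := by
    filter_upwards [h] with l hl
    funext x
    rw [hl, Finset.smul_sum]
    simp only [smul_smul]
  have hd : ∀ k, DifferentiableAt ℂ (fun l => (p.eval l)⁻¹ * l ^ k) 0 := fun k =>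
    (p.differentiable.differentiableAt.inv hp).mul (differentiableAt_id.pow k)
  refine ⟨?_, fun x => ?_, fun x X => ?_⟩
  · filter_upwards [h'] with l hl
    rw [hl]
    exact SmoothOn.sum fun k _ => (hc k).const_smul _
  · have h1 : (fun l => toEnd (R l) x) =ᶠ[𝓝 0]
        fun l => ∑ k ∈ Finset.range (N + 1), ((p.eval l)⁻¹ * l ^ k) • c k x := by
      filter_upwards [h'] with l hl
      rw [hl]
    refine DifferentiableAt.congr_of_eventuallyEq ?_ h1
    exact DifferentiableAt.fun_sum fun k _ => (hd k).smul_const _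
  · have h1 : (fun l => diff (toEnd (R l)) x X) =ᶠ[𝓝 0]
        fun l => ∑ k ∈ Finset.range (N + 1), ((p.eval l)⁻¹ * l ^ k) • diff (c k) x X := by
      filter_upwards [h'] with l hl
      rw [hl, diff_sum_smul _ _ hc]
    refine DifferentiableAt.congr_of_eventuallyEq ?_ h1
    exact DifferentiableAt.fun_sum fun k _ => (hd k).smul_const _

variable {R : ℂ → M → E n ≃L[ℂ] E n}

theorem HoloFamily.smooth_zero (hR : HoloFamily R) : SmoothOn (toEnd (R 0)) Set.univ :=
  hR.smooth.self_of_nhds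

theorem HoloFamily.differentiableAt_inv (hR : HoloFamily R) (x : M) :
    DifferentiableAt ℂ (fun l => toEnd (inv (R l)) x) 0 := by
  have h1 : DifferentiableAt ℂ (ContinuousLinearMap.inverse : EndE n → EndE n) (toEnd (R 0) x) :=
    (contDiffAt_map_inverse (𝕜 := ℂ) (n := 1) (R 0 x)).differentiableAt (by simp)
  have h2 := DifferentiableAt.comp (0 : ℂ) h1 (hR.differentiableAt x)
  have h3 : (fun l => toEnd (inv (R l)) x) =
      ContinuousLinearMap.inverse ∘ fun l => toEnd (R l) x := by
    funext l
    simp [toEnd, inv]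
  rw [h3]
  exact h2

theorem HoloFamily.differentiableAt_diff_inv (hR : HoloFamily R) (x : M) (X) :
    DifferentiableAt ℂ (fun l => diff (toEnd (inv (R l))) x X) 0 := by
  have h1 : (fun l => diff (toEnd (inv (R l))) x X) =ᶠ[𝓝 0]
      fun l => - (toEnd (inv (R l)) x * diff (toEnd (R l)) x X * toEnd (inv (R l)) x) := by
    filter_upwards [hR.smooth] with l hl using diff_toEnd_inv hl x X
  refine DifferentiableAt.congr_of_eventuallyEq ?_ h1
  exact (((hR.differentiableAt_inv x).clm_comp (hR.differentiableAt_diff x X)).clm_comp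
    (hR.differentiableAt_inv x)).neg

/-- The twisting condition near the parameter `0`. -/
def TwistedNear (V : M → Submodule ℂ (E n)) (R : ℂ → M → E n ≃L[ℂ] E n) : Prop :=
  ∀ᶠ l in 𝓝 (0 : ℂ), ∀ x, refl (V x) * toEnd (R l) x * refl (V x) = toEnd (R (-l)) x

variable {V : M → Submodule ℂ (E n)}

theorem commute_of_reflection {A : Type*} [Ring A] [Module ℂ A] {p g : A} (hp : p * p = p)
    (h : (p - (1 - p)) * g * (p - (1 - p)) = g) : p * g = g * p := by
  have h1 : g * (p - (1 - p)) = (p - (1 - p)) * g := by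
    have := congrArg (fun t => (p - (1 - p)) * t) h
    simp only [← mul_assoc, reflection_mul_self hp, one_mul] at this
    exact this
  have h2 : (2 : ℂ) • (p * g - g * p) = 0 := by
    rw [two_smul]
    have : p * g - g * p + (p * g - g * p) = (p - (1 - p)) * g - g * (p - (1 - p)) := by
      noncomm_ring
    rw [this, h1, sub_self]
  exact sub_eq_zero.1 ((smul_eq_zero.1 h2).resolve_left two_ne_zero)

theorem commute_inv {g : E n ≃L[ℂ] E n} {p : EndE n} (h : p * (g : EndE n) = (g : EndE n) * p) :
    p * (g.symm : EndE n) = (g.symm : EndE n) * p := by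
  ext1 v
  have := congrArg (fun T : EndE n => g.symm (T (g.symm v))) h
  simpa using this.symm

/-- The parameter 0 is fixed by λ ↦ -λ, so there twisting says that `R 0` commutes with the
reflection. -/
theorem TwistedNear.commute (h : TwistedNear V R) (hV : ∀ x, Nondeg (V x)) (x : M) :
    projV V x * toEnd (R 0) x = toEnd (R 0) x * projV V x := by
  have h1 := h.self_of_nhds x
  rw [neg_zero] at h1
  exact commute_of_reflection (hV x).proj_mul_proj h1

theorem TwistedNear.commute_inv (h : TwistedNear V R) (hV : ∀ x, Nondeg (V x)) (x : M) :
    projV V x * toEnd (inv (R 0)) x = toEnd (inv (R 0)) x * projV V x :=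
  Dressing.commute_inv (h.commute hV x)

theorem TwistedNear.inv (h : TwistedNear V R) (hV : ∀ x, Nondeg (V x)) :
    TwistedNear V fun l => inv (R l) := by
  filter_upwards [h] with l hl x
  have h1 := (hV x).refl_mul_refl
  have h2 : toEnd (R (-l)) x * (refl (V x) * toEnd (Dressing.inv (R l)) x * refl (V x)) = 1 := by
    rw [← hl x]
    calc _ = refl (V x) * (toEnd (R l) x * ((refl (V x) * refl (V x)) *
          toEnd (Dressing.inv (R l)) x)) * refl (V x) := by simp only [mul_assoc]
      _ = 1 := by rw [h1, one_mul, toEnd_mul_toEnd_inv, mul_one, h1]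
  calc _ = toEnd (Dressing.inv (R (-l))) x * (toEnd (R (-l)) x *
        (refl (V x) * toEnd (Dressing.inv (R l)) x * refl (V x))) := by
        rw [← mul_assoc (toEnd (Dressing.inv (R (-l))) x), toEnd_inv_mul_toEnd, one_mul]
    _ = _ := by rw [h2, mul_one]

/-- Differentiating the twisting relation at 0 gives ρR'ρ = -R'. -/
theorem TwistedNear.deriv_offDiag (h : TwistedNear V R) (hV : ∀ x, Nondeg (V x)) {x : M}
    {R' : EndE n} (hR : HasDerivAt (fun l => toEnd (R l) x) R' 0) :
    R' = projV V x * R' + R' * projV V x := by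
  refine offDiag_of_reflection (hV x).proj_mul_proj ?_
  have h1 : HasDerivAt (fun l => refl (V x) * toEnd (R l) x * refl (V x))
      (refl (V x) * R' * refl (V x)) 0 := by
    have h3 := ((hasDerivAt_const (0 : ℂ) (refl (V x))).clm_comp hR).clm_comp
      (hasDerivAt_const (0 : ℂ) (refl (V x)))
    refine h3.congr_deriv ?_
    simp
    rfl
  have h2 : HasDerivAt (fun l => toEnd (R (-l)) x) (-R') 0 := by
    have hn : HasDerivAt (fun l : ℂ => -l) (-1) 0 := hasDerivAt_neg' 0
    have h3 : HasDerivAt (fun l => toEnd (R l) x) R' (-0) := by rwa [neg_zero]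
    exact (h3.scomp (0 : ℂ) hn).congr_deriv (by simp)
  refine h1.unique (h2.congr_of_eventuallyEq ?_)
  filter_upwards [h] with l hl using hl x

end Families

/-! ### The dressed family of connections -/

section Half

open Filter

theorem gauge_apply (g : M → E n ≃L[ℂ] E n) (A : OneForm M (EndE n)) (x X) :
    gauge g A x X = toEnd g x * (diff (toEnd (inv g)) x X + A x X * toEnd (inv g) x) := rfl

theorem Ad_apply (g : M → E n ≃L[ℂ] E n) (A : OneForm M (EndE n)) (x X) :
    Ad g A x X = toEnd g x * (A x X * toEnd (inv g) x) := rfl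

section Algebra

variable {A : Type*} [Ring A] [Algebra ℂ A]

theorem half_smul_gauge (c : ℂ) (f k u u' a a' : A) :
    (1 / 2 : ℂ) • (f * (u + a * k) - c • (f * (u' + a' * k))) =
      f * ((1 / 2 : ℂ) • (u - c • u') + ((1 / 2 : ℂ) • (a - c • a')) * k) := by
  simp only [mul_add, mul_sub, smul_mul_assoc, mul_smul_comm, sub_mul]
  module

theorem half_smul_splitting (c : ℂ) (p u u' a a' : A) :
    (1 / 2 : ℂ) • (p * (u + a * p) + (1 - p) * (-u + a * (1 - p)) -
        c • (p * (u' + a' * p) + (1 - p) * (-u' + a' * (1 - p)))) =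
      p * ((1 / 2 : ℂ) • (u - c • u') + ((1 / 2 : ℂ) • (a - c • a')) * p) +
      (1 - p) * (-((1 / 2 : ℂ) • (u - c • u')) + ((1 / 2 : ℂ) • (a - c • a')) * (1 - p)) := by
  simp only [mul_add, mul_sub, smul_mul_assoc, mul_smul_comm, sub_mul, mul_neg, mul_one, one_mul]
  module

theorem half_smul_mul_add (c : ℂ) (p s u u' v v' : A) :
    (1 / 2 : ℂ) • (u * p + s * v - c • (u' * p + s * v')) =
      ((1 / 2 : ℂ) • (u - c • u')) * p + s * ((1 / 2 : ℂ) • (v - c • v')) := by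
  simp only [mul_sub, smul_mul_assoc, mul_smul_comm, sub_mul]
  module

end Algebra

/-! ### The coefficients of the dressed family as diagonal and off-diagonal blocks -/

section OffDiag

variable {A : Type*} [Ring A]

/-- This is the form 𝒩_V of the trivial connection; differentiating p² = p shows that δ itself has
no diagonal blocks. -/
theorem offDiag_connection {p δ : A} (hδ : δ = δ * p + p * δ) :
    -(p * δ - (1 - p) * δ) = p * -(p * δ - (1 - p) * δ) + -(p * δ - (1 - p) * δ) * p := by
  have h5 : δ * p = δ - p * δ := eq_sub_of_add_eq hδ.symm
  have h6 : p * -(p * δ - (1 - p) * δ) + -(p * δ - (1 - p) * δ) * p =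
      -(2 • (p * p) * δ) + p * δ - (2 • p * (δ * p)) + δ * p := by noncomm_ring
  rw [h6, h5]
  have h7 : -(2 • (p * p) * δ) + p * δ - (2 • p * (δ - p * δ)) + (δ - p * δ) =
    -(2 • (p * p) * δ) + 2 • (p * p) * δ + δ - 2 • (p * δ) := by noncomm_ring
  rw [h7]
  noncomm_ring

/-- Each summand of the coefficient of λ⁻¹ has exactly one off-diagonal factor: `r'`, `N` or `s'`.
-/
theorem offDiag_leading {p r s r' s' N q : A} (hr : p * r = r * p) (hs : p * s = s * p)
    (hq : p * q = q * p) (hr' : r' = p * r' + r' * p) (hs' : s' = p * s' + s' * p)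
    (hN : N = p * N + N * p) :
    r' * q * s + r * (N * s + q * s') =
      p * (r' * q * s + r * (N * s + q * s')) + (r' * q * s + r * (N * s + q * s')) * p := by
  have h1 : p * (r' * q * s + r * (N * s + q * s')) + (r' * q * s + r * (N * s + q * s')) * p =
      p * r' * q * s + r' * q * (s * p) + (p * r) * N * s + r * N * (s * p) + (p * r) * q * s' +
        r * q * (s' * p) := by noncomm_ring
  rw [h1, hr, ← hs]
  have h2 : p * r' * q * s + r' * q * (p * s) + (r * p) * N * s + r * N * (p * s) + (r * p) * q * s' +
      r * q * (s' * p) = p * r' * q * s + r' * (q * p) * s + r * (p * N + N * p) * s +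
        r * (p * q) * s' + r * q * (s' * p) := by noncomm_ring
  rw [h2, ← hN, ← hq, hq]
  have h3 : p * r' * q * s + r' * (q * p) * s + r * N * s + r * (q * p) * s' + r * q * (s' * p) =
      p * r' * q * s + r' * (q * p) * s + r * N * s + r * q * (p * s' + s' * p) := by noncomm_ring
  rw [h3, ← hs', ← hq]
  have h4 : p * r' * q * s + r' * (p * q) * s + r * N * s + r * q * s' =
      (p * r' + r' * p) * q * s + r * N * s + r * q * s' := by noncomm_ring
  rw [h4, ← hr']
  noncomm_ring

/-- The splitting along `p` of the dressed connection form. -/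
theorem dressed_splitting {p δ r s r' s' q P Q Z : A} (hp : p * p = p)
    (hδ : δ = δ * p + p * δ) (hr : p * r = r * p) (hs : p * s = s * p) (hq : p * q = q * p)
    (hr' : r' = p * r' + r' * p) (hs' : s' = p * s' + s' * p) (hP : p * P = P * p)
    (hQ : p * Q = Q * p) (hPQ : P * Q = 1) (hZ : Z * p + Q * δ = δ * Q + p * Z) :
    p * (δ + (r * q * s + P * (Z + (p * δ - (1 - p) * δ - q) * Q) +
        (r' * q * s + r * (-(p * δ - (1 - p) * δ) * s + q * s'))) * p) +
      (1 - p) * (-δ + (r * q * s + P * (Z + (p * δ - (1 - p) * δ - q) * Q) +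
        (r' * q * s + r * (-(p * δ - (1 - p) * δ) * s + q * s'))) * (1 - p)) =
      r * q * s + P * (Z + (p * δ - (1 - p) * δ - q) * Q) := by
  have h1 : p * (r * q * s) = r * q * s * p := by
    rw [← mul_assoc, ← mul_assoc, hr, mul_assoc r p, hq, mul_assoc (r * q), ← hs]
    simp only [mul_assoc]
  refine splitting_eq hp ?_ (offDiag_leading hr hs hq hr' hs' (offDiag_connection hδ))
  rw [mul_add, add_mul, h1, add_sub_add_left_eq_sub]
  exact commutator_gauge hp hδ hP hQ hPQ hq hZ

end OffDiag

theorem typePart_Ad_apply (c : ℂ) (g : M → E n ≃L[ℂ] E n) (α : OneForm M (EndE n)) (x X) :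
    typePart c (Ad g α) x X = toEnd g x * (typePart c α x X * toEnd (inv g) x) := by
  simp only [typePart_apply, Ad_apply, smul_mul_assoc, mul_smul_comm, sub_mul, mul_sub]

theorem typePart_gauge_apply (c : ℂ) (g : M → E n ≃L[ℂ] E n) (A : OneForm M (EndE n)) (x X) :
    typePart c (gauge g A) x X = toEnd g x *
      (typePart c (diff (toEnd (inv g))) x X + typePart c A x X * toEnd (inv g) x) := by
  rw [typePart_apply, gauge_apply, gauge_apply]
  exact half_smul_gauge (A := EndE n) c _ _ _ _ _ _

theorem diff_one_sub {T : M → EndE n} (hT : SmoothOn T Set.univ) (x : M) :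
    diff (1 - T) x = - diff T x := by
  have h := diff_sub (s := fun _ : M => (1 : EndE n)) (t := T) (x := x)
    (SmoothOn.diffAt (U := Set.univ) (SmoothOn.const 1) isOpen_univ (Set.mem_univ x))
    (hT.diffAt isOpen_univ (Set.mem_univ x))
  rw [diff_const, zero_sub] at h
  exact h

variable {V : M → Submodule ℂ (E n)}

theorem connD_apply (A : OneForm M (EndE n)) (hV : SmoothOn (projV V) Set.univ) (x X) :
    connD A V x X =
      projV V x * (diff (projV V) x X + A x X * projV V x) +
      (1 - projV V x) * (-diff (projV V) x X + A x X * (1 - projV V x)) := by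
  have h : connD A V x X = projV V x * (diff (projV V) x X + A x X * projV V x) +
      (1 - projV V x) * (diff (1 - projV V) x X + A x X * (1 - projV V x)) := rfl
  rw [h, diff_one_sub hV]
  rfl

theorem typePart_connD_apply (c : ℂ) (A : OneForm M (EndE n)) (hV : SmoothOn (projV V) Set.univ)
    (x X) : typePart c (connD A V) x X =
      projV V x * (typePart c (diff (projV V)) x X + typePart c A x X * projV V x) +
      (1 - projV V x) *
        (-typePart c (diff (projV V)) x X + typePart c A x X * (1 - projV V x)) := by
  rw [typePart_apply, connD_apply A hV, connD_apply A hV]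
  exact half_smul_splitting (A := EndE n) c _ _ _ _ _

theorem typePart_sub (c : ℂ) (α β : OneForm M (EndE n)) :
    typePart c (α - β) = typePart c α - typePart c β := by
  funext x; ext1 X
  simp only [typePart_apply, Pi.sub_apply, sub_apply]
  module

theorem typePart_zero (c : ℂ) : typePart c (0 : OneForm M (EndE n)) = 0 := by
  funext x; ext1 X
  simp [typePart_apply]

theorem diff_projV (hV : ∀ x, Nondeg (V x)) (hVs : SmoothOn (projV V) Set.univ) (c : ℂ) (x : M)
    (X) : typePart c (diff (projV V)) x X =
      typePart c (diff (projV V)) x X * projV V x + projV V x * typePart c (diff (projV V)) x X := by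
  have h0 : projV V * projV V = projV V := funext fun x => (hV x).proj_mul_proj
  have h1 : ∀ X, diff (projV V) x X = diff (projV V) x X * projV V x +
      projV V x * diff (projV V) x X := fun X => by
    have h2 := diff_mul (hVs.diffAt isOpen_univ (Set.mem_univ x))
      (hVs.diffAt isOpen_univ (Set.mem_univ x)) X
    rw [h0] at h2
    exact h2
  rw [typePart_apply]
  conv_lhs => rw [h1, h1 (tangentJ x X)]
  exact half_smul_mul_add (A := EndE n) c _ _ _ _ _ _

theorem diff_commute {S T : M → EndE n} (hS : SmoothOn S Set.univ) (hT : SmoothOn T Set.univ)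
    (h : ∀ x, T x * S x = S x * T x) (c : ℂ) (x : M) (X) :
    typePart c (diff S) x X * T x + S x * typePart c (diff T) x X =
      typePart c (diff T) x X * S x + T x * typePart c (diff S) x X := by
  have h0 : S * T = T * S := funext fun x => (h x).symm
  have h1 : ∀ X, diff S x X * T x + S x * diff T x X = diff T x X * S x + T x * diff S x X :=
    fun X => by
      have h2 := diff_mul (hS.diffAt isOpen_univ (Set.mem_univ x))
        (hT.diffAt isOpen_univ (Set.mem_univ x)) X
      have h3 := diff_mul (hT.diffAt isOpen_univ (Set.mem_univ x))
        (hS.diffAt isOpen_univ (Set.mem_univ x)) X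
      rw [h0, h3] at h2
      exact h2.symm
  rw [typePart_apply, typePart_apply, ← half_smul_mul_add (A := EndE n),
    ← half_smul_mul_add (A := EndE n), h1, h1]

theorem HoloFamily.differentiableAt_typePart {R : ℂ → M → E n ≃L[ℂ] E n} (hR : HoloFamily R) (c : ℂ)
    (x : M) (X) : DifferentiableAt ℂ (fun l => typePart c (diff (toEnd (inv (R l)))) x X) 0 :=
  ((hR.differentiableAt_diff_inv x X).sub
    ((hR.differentiableAt_diff_inv x (tangentJ x X)).const_smul c)).const_smul (1 / 2 : ℂ)

end Half

/-! ### The two types of the dressed family -/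

section Dressed

open Filter

theorem dressed_eq_laurent_end {F R S T P Q Z : ℂ → EndE n} {R' S' D N q : EndE n}
    (hF : DifferentiableOn ℂ F {0}ᶜ) (hR : HasDerivAt R R' 0) (hS : HasDerivAt S S' 0)
    (hT : DifferentiableAt ℂ T 0) (hP : ContinuousAt P 0) (hQ : ContinuousAt Q 0)
    (hZ : ContinuousAt Z 0)
    (h0 : ∀ᶠ l in 𝓝[≠] (0 : ℂ),
      F l = R l * (T l + (D + l⁻¹ • N + ((l ^ 2)⁻¹ - 1) • q) * S l))
    (hinf : ∀ᶠ m in 𝓝[≠] (0 : ℂ),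
      F m⁻¹ = P m * (Z m + (D + m • N + (m ^ 2 - 1) • q) * Q m)) (l : ℂ) (hl : l ≠ 0) :
    F l = (l ^ 2)⁻¹ • (R 0 * q * S 0) + l⁻¹ • (R' * q * S 0 + R 0 * (N * S 0 + q * S'))
      + P 0 * (Z 0 + (D - q) * Q 0) :=
  dressed_eq_laurent (A := EndE n) hF hR hS hT hP hQ hZ h0 hinf hl

variable {V : M → Submodule ℂ (E n)}

theorem typePart_connD_zero (c : ℂ) (hVs : SmoothOn (projV V) Set.univ) (x : M) (X) :
    typePart c (connD 0 V) x X = projV V x * typePart c (diff (projV V)) x X -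
        (1 - projV V x) * typePart c (diff (projV V)) x X := by
  rw [typePart_connD_apply c 0 hVs, typePart_zero]
  have h : ∀ {A : Type _} [Ring A] (p d : A), p * (d + 0 * p) + (1 - p) * (-d + 0 * (1 - p)) =
      p * d - (1 - p) * d := fun p d => by noncomm_ring
  exact h (A := EndE n) _ _

theorem typePart_formN_zero (c : ℂ) (x : M) (X) :
    typePart c (formN 0 V) x X = - typePart c (connD 0 V) x X := by
  rw [formN, typePart_sub, typePart_zero]
  exact zero_sub _

set_option maxHeartbeats 2000000 in
/-- One type of the dressed family of connections at a point: `R` is the dressing near the parameter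
where the family has its pole, `P` is the dressing near the opposite parameter. -/
theorem dressed_apply {c : ℂ} (hV : ∀ x, Nondeg (V x)) (hVs : SmoothOn (projV V) Set.univ)
    {q A : OneForm M (EndE n)} {R P : ℂ → M → E n ≃L[ℂ] E n}
    (hR : HoloFamily R) (hP : HoloFamily P) (hRt : TwistedNear V R) (hPt : TwistedNear V P)
    (x : M) (X : TangentSpace 𝓘(ℝ, ℂ) x)
    (hq : projV V x * typePart c q x X = typePart c q x X * projV V x) {F : ℂ → EndE n}
    (hF : DifferentiableOn ℂ F {0}ᶜ)
    (h0 : ∀ᶠ l in 𝓝[≠] (0 : ℂ), F l = toEnd (R l) x *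
      (typePart c (diff (toEnd (inv (R l)))) x X + (typePart c (connD 0 V) x X +
        l⁻¹ • typePart c (formN 0 V) x X + ((l ^ 2)⁻¹ - 1) • typePart c q x X) *
          toEnd (inv (R l)) x))
    (hinf : ∀ᶠ m in 𝓝[≠] (0 : ℂ), F m⁻¹ = toEnd (P m) x *
      (typePart c (diff (toEnd (inv (P m)))) x X + (typePart c (connD 0 V) x X +
        m • typePart c (formN 0 V) x X + (m ^ 2 - 1) • typePart c q x X) * toEnd (inv (P m)) x))
    (hA : typePart c A x X = F 1) :
    ∃ R' S' : EndE n, (S' = projV V x * S' + S' * projV V x) ∧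
      (typePart c (connD A V) x X =
        Ad (R 0) (typePart c q) x X + typePart c (gauge (P 0) (connD 0 V - q)) x X) ∧
      (typePart c (formN A V) x X =
        R' * typePart c q x X * toEnd (inv (R 0)) x + toEnd (R 0) x *
          (typePart c (formN 0 V) x X * toEnd (inv (R 0)) x + typePart c q x X * S')) ∧
      ∀ l, l ≠ 0 → F l = typePart c (connD A V) x X + l⁻¹ • typePart c (formN A V) x X +
        ((l ^ 2)⁻¹ - 1) • Ad (R 0) (typePart c q) x X := by
  have hR' := (hR.differentiableAt x).hasDerivAt
  have hS' := (hR.differentiableAt_inv x).hasDerivAt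
  have hS'o := (hRt.inv hV).deriv_offDiag hV hS'
  have hδ := diff_projV hV hVs c x X
  have hD0 := typePart_connD_zero c hVs x X
  have hN0 : typePart c (formN 0 V) x X = _ := (typePart_formN_zero c x X).trans (by rw [hD0])
  have key := dressed_eq_laurent_end hF hR' hS' (hR.differentiableAt_typePart c x X)
    (hP.differentiableAt x).continuousAt (hP.differentiableAt_inv x).continuousAt
    (hP.differentiableAt_typePart c x X).continuousAt h0 hinf
  -- The derivative of the relation saying that (P 0)⁻¹ commutes with π_V.
  have hZ := diff_commute hP.smooth_zero.toEnd_inv hVs (hPt.commute_inv hV) c x X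
  have hp : projV V x * projV V x = projV V x := (hV x).proj_mul_proj
  have split := dressed_splitting (A := EndE n) hp hδ (hRt.commute hV x)
    (hRt.commute_inv hV x) hq (hRt.deriv_offDiag hV hR') hS'o (hPt.commute hV x)
    (hPt.commute_inv hV x) (toEnd_mul_toEnd_inv (P 0) x) hZ
  refine ⟨deriv (fun l => toEnd (R l) x) 0, deriv (fun l => toEnd (inv (R l)) x) 0, hS'o, ?_⟩
  generalize deriv (fun l => toEnd (R l) x) 0 = R' at *
  generalize deriv (fun l => toEnd (inv (R l)) x) 0 = S' at *
  have hAd : Ad (R 0) (typePart c q) x X =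
      toEnd (R 0) x * typePart c q x X * toEnd (inv (R 0)) x := by rw [Ad_apply, mul_assoc]
  have hga : typePart c (gauge (P 0) (connD 0 V - q)) x X =
      toEnd (P 0) x * (typePart c (diff (toEnd (inv (P 0)))) x X +
        (typePart c (connD 0 V) x X - typePart c q x X) * toEnd (inv (P 0)) x) := by
    rw [typePart_gauge_apply, typePart_sub]; rfl
  -- At λ = 1 the connection form is the sum of the three Laurent coefficients, which `split`
  -- separates into 𝒟_V and 𝒩_V.
  have hAeq : typePart c A x X = _ := hA.trans (key 1 one_ne_zero)
  rw [one_pow, inv_one, one_smul, one_smul] at hAeq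
  rw [hAd, hga]
  have hform : typePart c (formN A V) x X = typePart c A x X - typePart c (connD A V) x X := by
    rw [formN, typePart_sub]; rfl
  rw [← hN0, ← hD0] at split
  generalize toEnd (R 0) x * typePart c q x X * toEnd (inv (R 0)) x = a at *
  generalize R' * typePart c q x X * toEnd (inv (R 0)) x + toEnd (R 0) x *
    (typePart c (formN 0 V) x X * toEnd (inv (R 0)) x + typePart c q x X * S') = b at *
  generalize toEnd (P 0) x * (typePart c (diff (toEnd (inv (P 0)))) x X +
        (typePart c (connD 0 V) x X - typePart c q x X) * toEnd (inv (P 0)) x) = d at *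
  have hconn : typePart c (connD A V) x X = a + d := by
    rw [typePart_connD_apply c A hVs, hAeq]
    have e : a + b + d = a + d + b := by abel
    rw [e]
    exact split
  have hform' : typePart c (formN A V) x X = b := by
    rw [hform, hconn, hAeq]; abel
  refine ⟨hconn, hform', fun l hl => ?_⟩
  rw [hconn, hform', key l hl]
  module

/-- The dressed derivative of the congruence annihilates the dressed isotropic subbundle. -/
theorem dressed_formN_apply_eq_zero (hV : ∀ x, Nondeg (V x)) {R : ℂ → M → E n ≃L[ℂ] E n}
    (hRt : TwistedNear V R) {x : M} {R' S' N N' q : EndE n}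
    (hS' : S' = projV V x * S' + S' * projV V x)
    (hN' : N' = R' * q * toEnd (inv (R 0)) x + toEnd (R 0) x *
          (N * toEnd (inv (R 0)) x + q * S')) {u : E n} (hu : u ∈ V x) (hNu : N u = 0)
    (hqu : q u = 0) (hqp : ∀ v ∈ perp (V x), q v = 0) : N' (toEnd (R 0) x u) = 0 := by
  have h1 : toEnd (inv (R 0)) x (toEnd (R 0) x u) = u := by simp [toEnd, inv]
  have h2 : proj (V x) (toEnd (R 0) x u) = toEnd (R 0) x u := by
    have : proj (V x) (toEnd (R 0) x u) = toEnd (R 0) x (proj (V x) u) :=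
      congrArg (fun T : EndE n => T u) (hRt.commute hV x)
    rw [this, (hV x).proj_of_mem hu]
  -- The off-diagonal `S'` maps V to V^⊥, where `q` vanishes; this disposes of the one term that
  -- does not end in `u`.
  have h3 : S' (toEnd (R 0) x u) ∈ perp (V x) := by
    have h4 : S' (toEnd (R 0) x u) = proj (V x) (S' (toEnd (R 0) x u)) +
        S' (proj (V x) (toEnd (R 0) x u)) := congrArg (fun T : EndE n => T (toEnd (R 0) x u)) hS'
    rw [h2, right_eq_add] at h4
    have h5 := (hV x).sub_proj_mem (S' (toEnd (R 0) x u))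
    rwa [h4, sub_zero] at h5
  rw [hN']
  change R' (q (toEnd (inv (R 0)) x (toEnd (R 0) x u))) + toEnd (R 0) x
    (N (toEnd (inv (R 0)) x (toEnd (R 0) x u)) + q (S' (toEnd (R 0) x u))) = 0
  rw [h1, hNu, hqu, hqp _ h3, map_zero, add_zero, map_zero, add_zero]

end Dressed

/-! ### Rational families of bundle automorphisms -/

section Rational

open Filter Bornology

/-- A polynomial growing at most like `λ ^ d` has degree at most `d`. -/
theorem coeff_eq_zero_of_tendsto {W : Type*} [NormedAddCommGroup W] [NormedSpace ℂ W] (a : ℕ → W)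
    (N d : ℕ) {w : W} (h : Tendsto (fun m : ℂ => m ^ d • ∑ k ∈ Finset.range (N + 1), (m⁻¹) ^ k • a k)
      (𝓝[≠] 0) (𝓝 w)) : ∀ k, d < k → k ≤ N → a k = 0 := by
  induction N with
  | zero => intro k h1 h2; omega
  | succ N ih =>
    have key : d < N + 1 → a (N + 1) = 0 := by
      intro hd
      -- The extra positive power of `m` forces the limit 0, whereas the same expression tends to
      -- its top coefficient `a (N + 1)`.
      have h1 : Tendsto (fun m : ℂ => m ^ (N + 1 - d) •
          (m ^ d • ∑ k ∈ Finset.range (N + 2), (m⁻¹) ^ k • a k)) (𝓝[≠] 0) (𝓝 ((0 : ℂ) • w)) := by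
        refine Tendsto.smul ?_ h
        have : Tendsto (fun m : ℂ => m ^ (N + 1 - d)) (𝓝 0) (𝓝 (0 ^ (N + 1 - d))) :=
          (continuous_pow _).tendsto _
        rw [zero_pow (by omega)] at this
        exact this.mono_left nhdsWithin_le_nhds
      have h2 : Tendsto (fun m : ℂ => ∑ k ∈ Finset.range (N + 2), m ^ (N + 1 - k) • a k)
          (𝓝[≠] 0) (𝓝 (∑ k ∈ Finset.range (N + 2), (0 : ℂ) ^ (N + 1 - k) • a k)) := by
        have : Continuous (fun m : ℂ => ∑ k ∈ Finset.range (N + 2), m ^ (N + 1 - k) • a k) := by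
          fun_prop
        exact (this.tendsto 0).mono_left nhdsWithin_le_nhds
      have h3 : (∑ k ∈ Finset.range (N + 2), (0 : ℂ) ^ (N + 1 - k) • a k) = a (N + 1) := by
        rw [Finset.sum_range_succ, Finset.sum_eq_zero]
        · simp
        · intro k hk
          rw [zero_pow (by have := Finset.mem_range.1 hk; omega), zero_smul]
      rw [h3] at h2
      rw [zero_smul] at h1
      refine tendsto_nhds_unique h2 (h1.congr' ?_)
      filter_upwards [self_mem_nhdsWithin] with m hm
      have hm : m ≠ 0 := hm
      rw [smul_smul, ← pow_add, Nat.sub_add_cancel (by omega), Finset.smul_sum]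
      refine Finset.sum_congr rfl fun k hk => ?_
      have := Finset.mem_range.1 hk
      rw [smul_smul, inv_pow, pow_sub₀ _ hm (by omega)]
    intro k hk hkN
    rcases Nat.lt_or_ge N k with h1 | h1
    · obtain rfl : k = N + 1 := by omega
      exact key hk
    · refine ih ?_ k hk h1
      refine h.congr fun m => ?_
      rw [Finset.sum_range_succ]
      by_cases hd : d < N + 1
      · rw [key hd, smul_zero, add_zero]
      · omega

theorem eval_reverse_eq (p : Polynomial ℂ) {m : ℂ} (hm : m ≠ 0) :
    p.reverse.eval m = m ^ p.natDegree * p.eval m⁻¹ := by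
  let := invertibleOfNonzero (inv_ne_zero hm)
  have h := Polynomial.eval₂_reverse_mul_pow (RingHom.id ℂ) m⁻¹ p
  rw [invOf_eq_inv, inv_inv] at h
  change p.reverse.eval m * _ = p.eval m⁻¹ at h
  rw [← h, mul_left_comm, inv_pow, mul_inv_cancel₀ (pow_ne_zero _ hm), mul_one]

open Classical in
/-- A family parametrized by `λ⁻¹`, with a prescribed value at `λ = ∞`. -/
def atInfinity (r : ℂ → M → E n ≃L[ℂ] E n) (rInf : M → E n ≃L[ℂ] E n) (m : ℂ) : M → E n ≃L[ℂ] E n :=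
  if m = 0 then rInf else r m⁻¹

variable {r : ℂ → M → E n ≃L[ℂ] E n} {rInf : M → E n ≃L[ℂ] E n} {poles : Finset ℂ}
  {V : M → Submodule ℂ (E n)}

theorem atInfinity_zero : atInfinity r rInf 0 = rInf := if_pos rfl

theorem atInfinity_of_ne {m : ℂ} (hm : m ≠ 0) : atInfinity r rInf m = r m⁻¹ := if_neg hm

theorem eventually_notMem {l : ℂ} (h : l ∉ poles) : ∀ᶠ k in 𝓝 l, k ∉ poles :=
  poles.finite_toSet.isClosed.isOpen_compl.mem_nhds h

theorem eventually_inv_notMem (poles : Finset ℂ) : ∀ᶠ m in 𝓝[≠] (0 : ℂ), m⁻¹ ∉ poles := by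
  have h1 : ∀ᶠ l in cobounded ℂ, l ∉ poles := isBounded_def.1 poles.finite_toSet.isBounded
  exact tendsto_inv₀_nhdsNE_zero.eventually h1

namespace IsRationalOrthogonal

theorem smooth (hr : IsRationalOrthogonal r rInf poles) {l : ℂ} (hl : l ∉ poles) :
    SmoothOn (toEnd (r l)) Set.univ := by
  obtain ⟨p, N, c, hc, h⟩ := hr.rational
  have h1 : toEnd (r l) = fun x => (p.eval l)⁻¹ • ∑ k ∈ Finset.range (N + 1), l ^ k • c k x :=
    funext (h l hl).2
  rw [h1]
  exact SmoothOn.const_smul _ (SmoothOn.sum fun k _ => (hc k).const_smul _)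

theorem holoFamily (hr : IsRationalOrthogonal r rInf poles) (h0 : 0 ∉ poles) : HoloFamily r := by
  obtain ⟨p, N, c, hc, h⟩ := hr.rational
  exact HoloFamily.of_rational hc (h 0 h0).1
    ((eventually_notMem h0).mono fun l hl => (h l hl).2)

theorem tendsto_atInfinity (hr : IsRationalOrthogonal r rInf poles) (x : M) :
    Tendsto (fun m => toEnd (r m⁻¹) x) (𝓝[≠] 0) (𝓝 (toEnd rInf x)) :=
  (hr.tendsto_inf x).comp tendsto_inv₀_nhdsNE_zero

/-- The finite limit at infinity bounds the degree of the numerator by d = deg p. Multiplying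
numerator and denominator by mᵈ, with m = λ⁻¹, then gives a rational family in `m` whose
denominator, the reversed polynomial, does not vanish at 0. -/
theorem holoFamily_atInfinity (hr : IsRationalOrthogonal r rInf poles) :
    HoloFamily (atInfinity r rInf) := by
  obtain ⟨p, N, c, hc, h⟩ := hr.rational
  have hp : p ≠ 0 := by
    rintro rfl
    obtain ⟨m, hm⟩ := (eventually_inv_notMem poles).exists
    simpa using (h _ hm).1
  set d := p.natDegree with hd
  have hp0 : p.reverse.eval 0 ≠ 0 := by
    rw [← Polynomial.coeff_zero_eq_eval_zero, Polynomial.coeff_zero_reverse]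
    exact Polynomial.leadingCoeff_ne_zero.2 hp
  have hsum : ∀ x, ∀ᶠ m in 𝓝[≠] (0 : ℂ), p.reverse.eval m • toEnd (r m⁻¹) x =
      m ^ d • ∑ k ∈ Finset.range (N + 1), (m⁻¹) ^ k • c k x := fun x => by
    filter_upwards [eventually_inv_notMem poles, self_mem_nhdsWithin] with m hm hm0
    rw [(h _ hm).2 x, eval_reverse_eq p hm0, smul_smul, mul_assoc, mul_inv_cancel₀ (h _ hm).1,
      mul_one]
  have hrev : Tendsto (fun m => p.reverse.eval m) (𝓝[≠] 0) (𝓝 (p.reverse.eval 0)) :=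
    (p.reverse.continuous.tendsto 0).mono_left nhdsWithin_le_nhds
  have hlim : ∀ x, Tendsto (fun m : ℂ => m ^ d • ∑ k ∈ Finset.range (N + 1), (m⁻¹) ^ k • c k x)
      (𝓝[≠] 0) (𝓝 (p.reverse.eval 0 • toEnd rInf x)) := fun x =>
    Tendsto.congr' (hsum x) (hrev.smul (hr.tendsto_atInfinity x))
  have hck : ∀ x k, d < k → k ≤ N → c k x = 0 := fun x => coeff_eq_zero_of_tendsto _ N d (hlim x)
  have hsum' : ∀ m : ℂ, m ≠ 0 → ∀ x, m ^ d • ∑ k ∈ Finset.range (N + 1), (m⁻¹) ^ k • c k x =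
      ∑ j ∈ Finset.range (d + 1), m ^ j • (if d - j ≤ N then c (d - j) x else 0) := by
    intro m hm x
    rw [Finset.smul_sum]
    conv_rhs => rw [← Finset.sum_range_reflect]
    -- Both sums equal the sum of `g`, which is supported on k ≤ min d N: terms with k > d vanish by
    -- `hck`, and those with k > N are absent by convention.
    set g : ℕ → EndE n := fun k => if k ≤ d ∧ k ≤ N then m ^ (d - k) • c k x else 0 with hg
    have h1 : ∀ K, K ≤ N + d + 1 → (∀ k, k ≤ d → k ≤ N → k < K) →
        ∑ k ∈ Finset.range K, g k = ∑ k ∈ Finset.range (N + d + 1), g k := fun K hK hK' =>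
      Finset.sum_subset (Finset.range_mono hK) fun k _ hk =>
        if_neg fun hkd => hk (Finset.mem_range.2 (hK' k hkd.1 hkd.2))
    calc _ = ∑ k ∈ Finset.range (N + 1), g k := Finset.sum_congr rfl fun k hk => ?_
      _ = ∑ k ∈ Finset.range (d + 1), g k :=
        (h1 _ (by omega) (by omega)).trans (h1 _ (by omega) (by omega)).symm
      _ = _ := Finset.sum_congr rfl fun k hk => ?_
    · have hkN : k ≤ N := by have := Finset.mem_range.1 hk; omega
      by_cases hkd : k ≤ d
      · rw [hg]
        simp only [hkd, hkN, and_self, if_true]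
        rw [smul_smul, inv_pow, pow_sub₀ _ hm hkd]
      · have h2 : g k = 0 := if_neg fun h3 => hkd h3.1
        rw [hck x k (by omega) hkN, h2]
        ext1 v
        simp
    · have hkd : k ≤ d := by have := Finset.mem_range.1 hk; omega
      have e1 : d + 1 - 1 - k = d - k := by omega
      have e2 : d - (d - k) = k := by omega
      rw [e1, e2, hg]
      by_cases hkN : k ≤ N
      · simp [hkd, hkN]
      · ext1 v
        simp [hkN]
  refine HoloFamily.of_rational (p := p.reverse) (N := d)
    (c := fun j x => if d - j ≤ N then c (d - j) x else 0) (fun k => ?_) hp0 ?_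
  · by_cases hk : d - k ≤ N
    · simp only [hk, if_true]; exact hc _
    · simp only [hk, if_false]; exact SmoothOn.const 0
  · have h1 : ∀ᶠ m in 𝓝[≠] (0 : ℂ), ∀ x, toEnd (atInfinity r rInf m) x = (p.reverse.eval m)⁻¹ •
        ∑ j ∈ Finset.range (d + 1), m ^ j • (if d - j ≤ N then c (d - j) x else 0) := by
      filter_upwards [eventually_inv_notMem poles, self_mem_nhdsWithin,
        hrev.eventually_ne hp0] with m hm hm0 hm1 x
      have hm0 : m ≠ 0 := hm0
      rw [atInfinity_of_ne hm0, ← hsum' m hm0 x, (h _ hm).2 x, eval_reverse_eq p hm0, smul_smul,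
        mul_inv, mul_right_comm, inv_mul_cancel₀ (pow_ne_zero _ hm0), one_mul]
    rw [eventually_nhdsWithin_iff] at h1
    filter_upwards [h1] with m hm
    by_cases hm0 : m = 0
    · subst hm0
      intro x
      rw [atInfinity_zero, eq_inv_smul_iff₀ hp0]
      -- The value prescribed at infinity agrees with the rational expression because both are the
      -- limit as m → 0.
      refine tendsto_nhds_unique (hlim x) ?_
      have hcont : Continuous fun m : ℂ => ∑ j ∈ Finset.range (d + 1), m ^ j •
        (if d - j ≤ N then c (d - j) x else 0) := by fun_prop
      refine ((hcont.tendsto 0).mono_left nhdsWithin_le_nhds).congr' ?_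
      filter_upwards [self_mem_nhdsWithin] with m hm
      exact (hsum' m hm x).symm
    · exact hm hm0

theorem twistedNear (htw : IsTwisted V r poles) (h0 : 0 ∉ poles) : TwistedNear V r := by
  have h1 : ∀ᶠ l in 𝓝 (0 : ℂ), -l ∉ poles := by
    have : Tendsto (fun l : ℂ => -l) (𝓝 0) (𝓝 0) := by simpa using (continuous_neg.tendsto (0 : ℂ))
    exact this.eventually (eventually_notMem h0)
  filter_upwards [eventually_notMem h0, h1] with l hl hl' using htw l hl hl'

theorem twistedNear_atInfinity (hr : IsRationalOrthogonal r rInf poles)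
    (htw : IsTwisted V r poles) : TwistedNear V (atInfinity r rInf) := by
  have hneg : Tendsto (fun l : ℂ => -l) (𝓝[≠] 0) (𝓝[≠] 0) := by
    refine tendsto_nhdsWithin_iff.2 ⟨?_, ?_⟩
    · have : Tendsto (fun l : ℂ => -l) (𝓝 0) (𝓝 0) := by
        simpa using (continuous_neg.tendsto (0 : ℂ))
      exact this.mono_left nhdsWithin_le_nhds
    · filter_upwards [self_mem_nhdsWithin] with l hl
      exact neg_ne_zero.2 hl
  have h1 : ∀ᶠ m in 𝓝[≠] (0 : ℂ), ∀ x,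
      refl (V x) * toEnd (r m⁻¹) x * refl (V x) = toEnd (r (-m)⁻¹) x := by
    filter_upwards [eventually_inv_notMem poles, hneg.eventually (eventually_inv_notMem poles)]
      with m hm hm'
    rw [inv_neg] at hm' ⊢
    exact htw _ hm hm'
  have h2 := eventually_nhdsWithin_iff.1 h1
  filter_upwards [h2] with m hm
  by_cases hm0 : m = 0
  · subst hm0
    intro x
    rw [neg_zero, atInfinity_zero]
    have h3 : Tendsto (fun m => refl (V x) * toEnd (r m⁻¹) x * refl (V x)) (𝓝[≠] 0)
        (𝓝 (refl (V x) * toEnd rInf x * refl (V x))) :=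
      ((hr.tendsto_atInfinity x).const_mul _).mul_const _
    refine tendsto_nhds_unique h3 (((hr.tendsto_atInfinity x).comp hneg).congr' ?_)
    filter_upwards [h1] with m hm using (hm x).symm
  · rw [atInfinity_of_ne hm0, atInfinity_of_ne (neg_ne_zero.2 hm0)]
    exact hm hm0

end IsRationalOrthogonal

end Rational

/-! ### Sections of the dressed surface -/

section DressedSurface

open Filter Module

theorem cov_apply (A : OneForm M (EndE n)) (s : M → E n) (x X) :
    cov A s x X = diff s x X + A x X (s x) := rfl

theorem cov_zero (s : M → E n) : cov 0 s = diff s := by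
  funext x; ext1 X
  exact add_zero _

theorem typePart_cov_apply (c : ℂ) (A : OneForm M (EndE n)) (s : M → E n) (x X) :
    typePart c (cov A s) x X = typePart c (diff s) x X + typePart c A x X (s x) := by
  simp only [typePart_apply, cov_apply, sub_apply, smul_apply]
  module

theorem typePart_diff_app (c : ℂ) {T : M → EndE n} {s : M → E n} {x : M} (hT : DiffAt T x)
    (hs : DiffAt s x) (X) : typePart c (diff fun y => T y (s y)) x X =
      typePart c (diff T) x X (s x) + T x (typePart c (diff s) x X) := by
  simp only [typePart_apply, diff_app hT hs, sub_apply, smul_apply, map_sub, map_smul]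
  module

theorem form_typePart_diff (c : ℂ) {s t : M → E n} {x : M} (hs : DiffAt s x) (ht : DiffAt t x)
    (h : ∀ᶠ y in 𝓝 x, form n (s y) (t y) = 0) (X) :
    form n (typePart c (diff s) x X) (t x) + form n (s x) (typePart c (diff t) x X) = 0 := by
  have h1 : ∀ X, form n (diff s x X) (t x) + form n (s x) (diff t x X) = 0 := fun X => by
    rw [← diff_form hs ht, diff_congr (t := fun _ => (0 : ℂ)) h, diff_const]; rfl
  have h2 := h1 X
  have h3 := h1 (tangentJ x X)
  simp only [typePart_apply, map_smul, map_sub, LinearMap.sub_apply, LinearMap.smul_apply,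
    smul_eq_mul]
  linear_combination (1 / 2 : ℂ) * h2 - (1 / 2 : ℂ) * c * h3

variable {L L' V : M → Submodule ℂ (E n)}

theorem IsSubbundle.exists_section {k : ℕ} (h : IsSubbundle k L) {x : M} {w : E n} (hw : w ∈ L x) :
    ∃ U : Set M, IsOpen U ∧ x ∈ U ∧ ∃ s : M → E n, SmoothOn s U ∧ (∀ y ∈ U, s y ∈ L y) ∧ s x = w := by
  obtain ⟨U, hU, hx, s, hs, hsp⟩ := h x
  rw [← (hsp x hx).2, Submodule.mem_span_range_iff_exists_fun] at hw
  obtain ⟨a, rfl⟩ := hw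
  refine ⟨U, hU, hx, fun y => ∑ i, a i • s i y, SmoothOn.sum fun i _ => (hs i).const_smul _,
    fun y hy => ?_, rfl⟩
  rw [← (hsp y hy).2]
  exact Submodule.sum_mem _ fun i _ => Submodule.smul_mem _ _ (Submodule.subset_span ⟨i, rfl⟩)

/-- The second fundamental form of an isotropic subbundle of rank two vanishes in a type in which
sections of a line subbundle differentiate into it. -/
theorem form_typePart_diff_eq_zero {c : ℂ} (hL : IsSubbundle 2 L) (hLi : ∀ x, Isotropic (L x))
    (hΛ : IsSubbundle 1 fun x => L x ⊓ L' x)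
    (hcov : ∀ (U : Set M) (s : M → E n), IsOpen U → SmoothOn s U →
      (∀ x ∈ U, s x ∈ L x ⊓ L' x) → ∀ x ∈ U, ∀ X, typePart c (diff s) x X ∈ L x)
    {U : Set M} {t : M → E n} (hU : IsOpen U) (ht : SmoothOn t U) (htL : ∀ y ∈ U, t y ∈ L y)
    {x : M} (hx : x ∈ U) {w : E n} (hw : w ∈ L x) (X) :
    form n w (typePart c (diff t) x X) = 0 := by
  -- Since `L` is isotropic, (s₁, ds₂) is skew in the two sections. A skew pairing on a plane that
  -- has a nonzero vector in its kernel vanishes, and `s` provides that vector.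
  have anti : ∀ (U₁ U₂ : Set M) (s₁ s₂ : M → E n), IsOpen U₁ → IsOpen U₂ → x ∈ U₁ → x ∈ U₂ →
      SmoothOn s₁ U₁ → SmoothOn s₂ U₂ → (∀ y ∈ U₁, s₁ y ∈ L y) → (∀ y ∈ U₂, s₂ y ∈ L y) →
      form n (s₁ x) (typePart c (diff s₂) x X) = - form n (s₂ x) (typePart c (diff s₁) x X) := by
    intro U₁ U₂ s₁ s₂ h1 h2 hx1 hx2 hs1 hs2 hm1 hm2
    have h3 := form_typePart_diff c (hs1.diffAt h1 hx1) (hs2.diffAt h2 hx2)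
      (by filter_upwards [h1.mem_nhds hx1, h2.mem_nhds hx2] with y hy1 hy2 using
            hLi y _ (hm1 y hy1) _ (hm2 y hy2)) X
    rw [form_comm (s₂ x)]
    linear_combination h3
  obtain ⟨e, he, he0⟩ : ∃ e ∈ L x ⊓ L' x, e ≠ 0 := by
    refine (Submodule.ne_bot_iff _).1 fun h0 => ?_
    have h1 := hΛ.finrank_eq x
    rw [h0, finrank_bot] at h1
    omega
  obtain ⟨Ue, hUe, hxe, s, hs, hsm, rfl⟩ := hΛ.exists_section he
  have hsd : ∀ w ∈ L x, form n w (typePart c (diff s) x X) = 0 := fun w hw =>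
    hLi x _ hw _ (hcov Ue s hUe hs hsm x hxe X)
  by_cases hli : LinearIndependent ℂ ![s x, t x]
  · rw [← span_pair_eq (hL.finrank_eq x) he.1 (htL x hx) hli, Submodule.mem_span_pair] at hw
    obtain ⟨a, b, rfl⟩ := hw
    have h1 := anti Ue U s t hUe hU hxe hx hs ht (fun y hy => (hsm y hy).1) htL
    have h2 := anti U U t t hU hU hx hx ht ht htL htL
    rw [hsd _ (htL x hx), neg_zero] at h1
    rw [self_eq_neg] at h2
    simp only [map_add, map_smul, LinearMap.add_apply, LinearMap.smul_apply, h1, h2, smul_zero,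
      add_zero]
  -- When `t x` is a multiple of `s x`, extend `w` to a section of `L` and apply skewness twice.
  · rw [LinearIndependent.pair_iff' he0] at hli
    push Not at hli
    obtain ⟨a, ha⟩ := hli
    obtain ⟨Uw, hUw, hxw, s', hs', hsm', rfl⟩ := hL.exists_section hw
    rw [anti Uw U s' t hUw hU hxw hx hs' ht hsm' htL, ← ha, map_smul, LinearMap.smul_apply,
      anti Ue Uw s s' hUe hUw hxe hxw hs hs' (fun y hy => (hsm y hy).1) hsm', hsd _ hw]
    simp

/-- `⋀² L'` maps `L` to its annihilator, when `L` meets `L'` in a line. -/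
theorem form_wedgeSq_eq_zero {L L' : Submodule ℂ (E n)} (h2 : finrank ℂ L = 2)
    (h1 : finrank ℂ (L ⊓ L' : Submodule ℂ (E n)) = 1) (hL' : Isotropic L') {T : EndE n}
    (hT : T ∈ wedgeSq L') {t w : E n} (ht : t ∈ L) (hw : w ∈ L) : form n w (T t) = 0 := by
  obtain ⟨e, he, he0⟩ : ∃ e ∈ L ⊓ L', e ≠ 0 := by
    refine (Submodule.ne_bot_iff _).1 fun h0 => ?_
    rw [h0, finrank_bot] at h1
    omega
  obtain ⟨a, ha, hea⟩ := exists_pair h2 he0 (L := L)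
  rw [← span_pair_eq h2 he.1 ha hea, Submodule.mem_span_pair] at ht hw
  obtain ⟨α, β, rfl⟩ := ht
  obtain ⟨γ, δ, rfl⟩ := hw
  refine wedgeSq_induction (p := fun T => form n (γ • e + δ • a) (T (α • e + β • a)) = 0)
    (fun u hu v hv => ?_) ?_ ?_ ?_ hT
  -- The common vector `e` is orthogonal to `L'`, so only the (a, a) entry survives, and it vanishes
  -- because u ∧ v is skew.
  · have hue := hL' u hu e he.2
    have hve := hL' v hv e he.2
    have hue' := hL' e he.2 u hu
    have hve' := hL' e he.2 v hv
    simp only [wedge_apply, map_add, map_sub, map_smul, LinearMap.add_apply, LinearMap.smul_apply,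
      smul_eq_mul, hue, hve, hue', hve', form_comm a]
    ring
  · rw [zero_apply, map_zero]
  · intro S T hS hT
    rw [add_apply, map_add, hS, hT, add_zero]
  · intro c T hT
    rw [smul_apply, map_smul, hT, smul_zero]

/-- The relevant type of the derivative of a section of the dressed line bundle. -/
theorem dressed_cov_mem {c : ℂ} (hV4 : IsSubbundle 4 V) (hV : ∀ x, Nondeg (V x))
    (hL : IsSubbundle 2 L) (hLi : ∀ x, Isotropic (L x)) (hL'i : ∀ x, Isotropic (L' x))
    (hLV : ∀ x, L x ≤ V x) (hL'V : ∀ x, L' x ≤ V x) (hΛ : IsSubbundle 1 fun x => L x ⊓ L' x)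
    (hcov : ∀ (U : Set M) (s : M → E n), IsOpen U → SmoothOn s U →
      (∀ x ∈ U, s x ∈ L x ⊓ L' x) → ∀ x ∈ U, ∀ X, typePart c (diff s) x X ∈ L x)
    {q A : OneForm M (EndE n)} (hq : ∀ x X, typePart c q x X ∈ wedgeSq (L' x))
    {f g : M → E n ≃L[ℂ] E n} (hg : SmoothOn (toEnd g) Set.univ)
    (hD : ∀ x X, typePart c (connD A V) x X =
        Ad f (typePart c q) x X + typePart c (gauge g (connD 0 V - q)) x X)
    (hN : ∀ x X, ∀ u ∈ image f L' x, typePart c (formN A V) x X u = 0)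
    {U : Set M} {s : M → E n} (hU : IsOpen U) (hs : SmoothOn s U)
    (hsL : ∀ x ∈ U, s x ∈ image g L x ⊓ image f L' x) {x : M} (hx : x ∈ U) (X) :
    typePart c (cov A s) x X ∈ image g L x := by
  have hVs := smoothOn_projV hV4 hV
  -- Pulling back by `g` gives a section of the original `L`, to which the isotropy and derivative
  -- conditions apply.
  set t : M → E n := fun y => toEnd (inv g) y (s y) with ht
  have htL : ∀ y ∈ U, t y ∈ L y := fun y hy => mem_map_iff.1 (hsL y hy).1
  have hgi : SmoothOn (toEnd (inv g)) U := hg.toEnd_inv.mono (Set.subset_univ _)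
  have hts : SmoothOn t U := hgi.app hs
  have hx' := hU.mem_nhds hx
  have hdt : typePart c (diff t) x X = typePart c (diff (toEnd (inv g))) x X (s x) +
      toEnd (inv g) x (typePart c (diff s) x X) :=
    typePart_diff_app c (hgi.diffAt hU hx) (hs.diffAt hU hx) X
  have hpt : typePart c (diff t) x X = typePart c (diff (projV V)) x X (t x) +
      projV V x (typePart c (diff t) x X) := by
    rw [← typePart_diff_app c (hVs.diffAt isOpen_univ (Set.mem_univ x)) (hts.diffAt hU hx) X]
    have h1 : diff (fun y => projV V y (t y)) x = diff t x := diff_congr (by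
      filter_upwards [hx'] with y hy using (hV y).proj_of_mem (hLV y (htL y hy)))
    rw [typePart_apply, typePart_apply, h1]
  have hoff := congrArg (fun T : EndE n => T (t x)) (diff_projV hV hVs c x X)
  -- 𝒩_V kills `s` by `hN`, and the Ad_f q term kills it since f⁻¹s lies in `L'`. What remains is
  -- g(𝒟_V - q)t, where 𝒟_V t = π_V dt.
  have hAs : typePart c (cov A s) x X =
      g x (projV V x (typePart c (diff t) x X) - typePart c q x X (t x)) := by
    have hA : typePart c A x X = typePart c (connD A V) x X + typePart c (formN A V) x X := by
      rw [formN, typePart_sub]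
      exact (add_sub_cancel _ _).symm
    have hq0 : Ad f (typePart c q) x X (s x) = 0 := by
      have h1 : typePart c q x X (toEnd (inv f) x (s x)) = 0 :=
        wedgeSq_apply_eq_zero (hq x X) ((hL'i x).le_perp (mem_map_iff.1 (hsL x hx).2))
      change toEnd f x (typePart c q x X (toEnd (inv f) x (s x))) = 0
      rw [h1, map_zero]
    have hgt : s x = toEnd g x (t x) := by simp [ht, toEnd, inv]
    have hgd : typePart c (diff s) x X =
        toEnd g x (toEnd (inv g) x (typePart c (diff s) x X)) := by simp [toEnd, inv]
    -- The derivative of π_V maps V into V^⊥.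
    have hδ : projV V x (typePart c (diff (projV V)) x X (t x)) = 0 := by
      have h1 : typePart c (diff (projV V)) x X (t x) =
          typePart c (diff (projV V)) x X (projV V x (t x)) +
            projV V x (typePart c (diff (projV V)) x X (t x)) := hoff
      have h2 : projV V x (t x) = t x := (hV x).proj_of_mem (hLV x (htL x hx))
      rwa [h2, left_eq_add] at h1
    have hDt : typePart c (connD 0 V) x X (t x) = - typePart c (diff (projV V)) x X (t x) := by
      rw [typePart_connD_zero c hVs]
      change projV V x (typePart c (diff (projV V)) x X (t x)) -
        (typePart c (diff (projV V)) x X (t x) -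
          projV V x (typePart c (diff (projV V)) x X (t x))) = _
      rw [hδ, sub_zero, zero_sub]
    have hga : typePart c (gauge g (connD 0 V - q)) x X (s x) =
        toEnd g x (typePart c (diff (toEnd (inv g))) x X (s x) +
          (typePart c (connD 0 V) x X (t x) - typePart c q x X (t x))) := by
      rw [typePart_gauge_apply, typePart_sub]; rfl
    rw [typePart_cov_apply, hA, hD, add_apply, add_apply, hN x X _ (hsL x hx).2, hq0, hga, hDt,
      zero_add, add_zero]
    conv_lhs => lhs; rw [hgd]
    rw [← map_add]
    refine congrArg (toEnd g x) ?_
    have h5 : projV V x (typePart c (diff t) x X) =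
        typePart c (diff t) x X - typePart c (diff (projV V)) x X (t x) :=
      eq_sub_of_add_eq' hpt.symm
    rw [h5, hdt]
    abel
  rw [hAs]
  refine Submodule.mem_map_of_mem ?_
  -- As `L` is maximal isotropic in `V`, it remains to check orthogonality to `L` of π_V dt and of
  -- qt separately.
  refine (hV x).mem_of_isotropic (hLi x) (hLV x) (hV4.finrank_eq x) (hL.finrank_eq x)
    (Submodule.sub_mem _ ((hV x).proj_mem _) (hL'V x (wedgeSq_apply_mem (hq x X) _)))
    fun w hw => ?_
  rw [map_sub, form_wedgeSq_eq_zero (hL.finrank_eq x) (hΛ.finrank_eq x) (hL'i x) (hq x X)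
    (htL x hx) hw, sub_zero, form_comm]
  refine ((hV x).form_proj_left (typePart c (diff t) x X) (hLV x hw)).trans ?_
  rw [form_comm]
  exact form_typePart_diff_eq_zero hL hLi hΛ hcov hU hts htL hx hw X

end DressedSurface

/-! ### The associated family of connections -/

section Loop

open Filter Complex

variable {A : OneForm M (EndE n)} {V : M → Submodule ℂ (E n)} {q : OneForm M (EndE n)}

theorem neg_I_mul_neg_I : -I * -I = -1 := by simp

theorem typePart_I_loop_apply (l : ℂ) (x : M) (X) : typePart I (loop A V q l) x X =
    typePart I (connD A V) x X + l⁻¹ • typePart I (formN A V) x X +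
      ((l ^ 2)⁻¹ - 1) • typePart I q x X := by
  have h1 : ∀ α : OneForm M (EndE n), typePart I (typePart I α) = typePart I α :=
    typePart_typePart I_mul_I
  have h2 : ∀ α : OneForm M (EndE n), typePart I (typePart (-I) α) = 0 :=
    typePart_neg_typePart I_mul_I
  simp only [loop, part10_eq, part01_eq, typePart_add, typePart_smul, h1, h2, Pi.add_apply,
    Pi.smul_apply, add_apply, smul_apply, Pi.zero_apply, zero_apply]
  module

theorem typePart_neg_I_loop_apply (l : ℂ) (x : M) (X) : typePart (-I) (loop A V q l) x X =
    typePart (-I) (connD A V) x X + l • typePart (-I) (formN A V) x X +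
      (l ^ 2 - 1) • typePart (-I) q x X := by
  have h1 : ∀ α : OneForm M (EndE n), typePart (-I) (typePart (-I) α) = typePart (-I) α :=
    typePart_typePart neg_I_mul_neg_I
  have h2 : ∀ α : OneForm M (EndE n), typePart (-I) (typePart I α) = 0 := fun α => by
    have := typePart_neg_typePart neg_I_mul_neg_I α
    rwa [neg_neg] at this
  simp only [loop, part10_eq, part01_eq, typePart_add, typePart_smul, h1, h2, Pi.add_apply,
    Pi.smul_apply, add_apply, smul_apply, Pi.zero_apply, zero_apply]
  module

theorem ext_typePart {α β : OneForm M (EndE n)} (h1 : ∀ x X, typePart I α x X = typePart I β x X)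
    (h2 : ∀ x X, typePart (-I) α x X = typePart (-I) β x X) : α = β := by
  rw [← typePart_add_neg I α, ← typePart_add_neg I β]
  funext x; ext1 X
  rw [Pi.add_apply, Pi.add_apply, add_apply, add_apply, h1, h2]

theorem loop_one : loop A V q 1 = A := by
  have h : ∀ c, ∀ x X, typePart c (formN A V) x X = typePart c A x X - typePart c (connD A V) x X :=
    fun c x X => by rw [formN, typePart_sub]; rfl
  refine ext_typePart (fun x X => ?_) fun x X => ?_
  · rw [typePart_I_loop_apply, h]
    ext1 v
    simp
  · rw [typePart_neg_I_loop_apply, h]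
    ext1 v
    simp

section Combination

variable {W : Type*} [NormedAddCommGroup W] [NormedSpace ℂ W]

theorem inChart_combination (a b c d : ℂ) (α₀ α₁ α₂ α₃ α₄ : OneForm M W)
    (e : OpenPartialHomeomorph M ℂ) :
    inChart (α₀ + a • α₁ + b • α₂ + c • α₃ + d • α₄) e = fun y => inChart α₀ e y +
      a • inChart α₁ e y + b • inChart α₂ e y + c • inChart α₃ e y + d • inChart α₄ e y := rfl

theorem fderiv_combination {y : ℂ} {K₀ K₁ K₂ K₃ K₄ : ℂ → ℂ →L[ℝ] W} (h₀ : DifferentiableAt ℝ K₀ y)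
    (h₁ : DifferentiableAt ℝ K₁ y) (h₂ : DifferentiableAt ℝ K₂ y) (h₃ : DifferentiableAt ℝ K₃ y)
    (h₄ : DifferentiableAt ℝ K₄ y) (a b c d : ℂ) (u v : ℂ) :
    fderiv ℝ (fun y => K₀ y + a • K₁ y + b • K₂ y + c • K₃ y + d • K₄ y) y u v =
      fderiv ℝ K₀ y u v + a • fderiv ℝ K₁ y u v + b • fderiv ℝ K₂ y u v + c • fderiv ℝ K₃ y u v +
        d • fderiv ℝ K₄ y u v := by
  have h := (((h₀.hasFDerivAt.add (h₁.hasFDerivAt.const_smul a)).add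
    (h₂.hasFDerivAt.const_smul b)).add (h₃.hasFDerivAt.const_smul c)).add
    (h₄.hasFDerivAt.const_smul d)
  exact congrArg (fun T : ℂ →L[ℝ] ℂ →L[ℝ] W => T u v) h.fderiv

theorem continuousAt_combination {l₀ : ℂ} (hl₀ : l₀ ≠ 0) (a₀ a₁ a₂ a₃ a₄ : W) :
    ContinuousAt (fun l : ℂ => a₀ + l⁻¹ • a₁ + l • a₂ + ((l ^ 2)⁻¹ - 1) • a₃ + (l ^ 2 - 1) • a₄)
      l₀ := by
  have h1 : ContinuousAt (fun l : ℂ => l⁻¹) l₀ := continuousAt_inv₀ hl₀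
  have h2 : ContinuousAt (fun l : ℂ => (l ^ 2)⁻¹ - 1) l₀ :=
    ((continuousAt_id.pow 2).inv₀ (pow_ne_zero 2 hl₀)).sub continuousAt_const
  exact (((continuousAt_const.add (h1.smul continuousAt_const)).add
    (continuousAt_id.smul continuousAt_const)).add (h2.smul continuousAt_const)).add
    (((continuousAt_id.pow 2).sub continuousAt_const).smul continuousAt_const)

end Combination

section Smooth

variable [IsManifold 𝓘(ℂ) ω M]

theorem SmoothForm.connD (hV : SmoothOn (projV V) Set.univ) (hA : SmoothForm A) :
    SmoothForm (connD A V) := by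
  have := isManifold_real (M := M)
  have h1 : SmoothOn (1 - projV V) Set.univ := (SmoothOn.const (1 : EndE n)).sub hV
  exact ((hA.covEnd hV).leftMul hV).add ((hA.covEnd h1).leftMul h1)

theorem SmoothForm.formN (hV : SmoothOn (projV V) Set.univ) (hA : SmoothForm A) :
    SmoothForm (formN A V) := hA.sub (hA.connD hV)

theorem SmoothForm.loop (hV : SmoothOn (projV V) Set.univ) (hA : SmoothForm A) (hq : SmoothForm q)
    (l : ℂ) : SmoothForm (loop A V q l) := by
  have h := hA.formN hV
  unfold Dressing.loop
  rw [part01_eq, part01_eq]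
  exact (((((hA.connD hV).add ((h.typePart I).const_smul _)).add
    ((h.typePart (-I)).const_smul _)).add ((hq.typePart I).const_smul _)).add
    ((hq.typePart (-I)).const_smul _))

/-- At a fixed point of the surface the curvature is continuous in λ away from 0, so flatness passes
to the limit. -/
theorem IsFlat.loop_of_eventually (hV : SmoothOn (projV V) Set.univ) (hA : SmoothForm A)
    (hq : SmoothForm q) {l₀ : ℂ} (hl₀ : l₀ ≠ 0) (h : ∀ᶠ l in 𝓝[≠] l₀, IsFlat (loop A V q l)) :
    IsFlat (loop A V q l₀) := by
  intro e he y hy u v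
  have hd : ∀ α : OneForm M (EndE n), SmoothForm α → DifferentiableAt ℝ (inChart α e) y :=
    fun α hα => ((hα e he).contDiffAt (e.open_target.mem_nhds hy)).differentiableAt (by simp)
  have h0 := hd _ (hA.connD hV)
  have h1 := hd _ ((hA.formN hV).typePart I)
  have h2 := hd _ ((hA.formN hV).typePart (-I))
  have h3 := hd _ (hq.typePart I)
  have h4 := hd _ (hq.typePart (-I))
  rw [← part10_eq] at h1 h3
  rw [← part01_eq] at h2 h4
  have hl : ∀ l, inChart (Dressing.loop A V q l) e = _ := fun l =>
    inChart_combination l⁻¹ l ((l ^ 2)⁻¹ - 1) (l ^ 2 - 1) _ _ _ _ _ e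
  have ha : ∀ u, ContinuousAt (fun l => inChart (Dressing.loop A V q l) e y u) l₀ := fun u => by
    simp only [hl]
    exact continuousAt_combination (W := EndE n) hl₀ _ _ _ _ _
  have hb : ∀ u v, ContinuousAt (fun l => fderiv ℝ (inChart (Dressing.loop A V q l) e) y u v) l₀ :=
    fun u v => by
      simp only [hl, fderiv_combination h0 h1 h2 h3 h4]
      exact continuousAt_combination (W := EndE n) hl₀ _ _ _ _ _
  have hcont := ((hb u v).sub (hb v u)).add
    (((ha u).clm_comp (ha v)).sub ((ha v).clm_comp (ha u)))
  refine tendsto_nhds_unique (hcont.tendsto.mono_left (nhdsWithin_le_nhds (s := {l₀}ᶜ)))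
    (tendsto_const_nhds.congr' ?_)
  filter_upwards [h] with l hl using (hl e he y hy u v).symm

end Smooth

end Loop

/-! ### Dressing, before the final gauge -/

section DressingTransform

open Filter Complex

variable {L10 L01 V : M → Submodule ℂ (E n)} {q : OneForm M (EndE n)}
  {r : ℂ → M → E n ≃L[ℂ] E n} {rInf : M → E n ≃L[ℂ] E n} {poles : Finset ℂ}

/-- One type of the dressed family of connections, with `α` and `B` the families of connections
before and after dressing. -/
theorem dressed_half {c : ℂ} (hV : ∀ x, Nondeg (V x)) (hVs : SmoothOn (projV V) Set.univ)
    {R P : ℂ → M → E n ≃L[ℂ] E n} (hR : HoloFamily R) (hP : HoloFamily P) (hRt : TwistedNear V R)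
    (hPt : TwistedNear V P) (hq : ∀ x X, projV V x * typePart c q x X = typePart c q x X * projV V x)
    {α B : ℂ → OneForm M (EndE n)}
    (hα : ∀ l, l ≠ 0 → ∀ x X, typePart c (α l) x X = typePart c (connD 0 V) x X +
        l⁻¹ • typePart c (formN 0 V) x X + ((l ^ 2)⁻¹ - 1) • typePart c q x X)
    (hB : ∀ x X, DifferentiableOn ℂ (fun l => B l x X) {0}ᶜ)
    (h0 : ∀ᶠ l in 𝓝[≠] (0 : ℂ), B l = gauge (R l) (α l))
    (hinf : ∀ᶠ m in 𝓝[≠] (0 : ℂ), B m⁻¹ = gauge (P m) (α m⁻¹)) (x : M)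
    (X : TangentSpace 𝓘(ℝ, ℂ) x) :
    ∃ R' S' : EndE n, (S' = projV V x * S' + S' * projV V x) ∧
      (typePart c (connD (B 1) V) x X =
        Ad (R 0) (typePart c q) x X + typePart c (gauge (P 0) (connD 0 V - q)) x X) ∧
      (typePart c (formN (B 1) V) x X =
        R' * typePart c q x X * toEnd (inv (R 0)) x + toEnd (R 0) x *
          (typePart c (formN 0 V) x X * toEnd (inv (R 0)) x + typePart c q x X * S')) ∧
      ∀ l, l ≠ 0 → typePart c (B l) x X = typePart c (connD (B 1) V) x X +
        l⁻¹ • typePart c (formN (B 1) V) x X + ((l ^ 2)⁻¹ - 1) • Ad (R 0) (typePart c q) x X := by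
  refine dressed_apply hV hVs hR hP hRt hPt x X (hq x X) (F := fun l => typePart c (B l) x X)
    (A := B 1) (((hB x X).sub ((hB x (tangentJ x X)).const_smul c)).const_smul (1 / 2 : ℂ)) ?_ ?_ rfl
  · filter_upwards [h0, self_mem_nhdsWithin] with l hl hl0
    rw [hl, typePart_gauge_apply, hα l hl0]
  · filter_upwards [hinf, self_mem_nhdsWithin] with m hm hm0
    rw [hm, typePart_gauge_apply, hα _ (inv_ne_zero hm0), inv_inv, inv_pow, inv_inv]

variable [IsManifold 𝓘(ℂ) ω M]

theorem image_eq_of_commute (hV : ∀ x, Nondeg (V x)) {g : M → E n ≃L[ℂ] E n}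
    (h : ∀ x, projV V x * toEnd g x = toEnd g x * projV V x) : image g V = V :=
  funext fun x => (hV x).map_eq_of_commute (h x)

/-- Relative to r(1)·d the congruence `V` does not move: r(0) and r(∞) commute with π_V, so the new
planes stay inside `V`. -/
theorem dressed_isConstrainedWillmoreWith
    (hW : IsConstrainedWillmoreWith 0 L10 L01 q V) (h0 : (0 : ℂ) ∉ poles) (h1 : (1 : ℂ) ∉ poles)
    (hr : IsRationalOrthogonal r rInf poles) (htw : IsTwisted V r poles)
    (hext : HasHolomorphicExtension (loop 0 V q) r poles)
    (hdet : ∀ x, detOn (V x) (r 0 x) = detOn (V x) (rInf x)) :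
    IsConstrainedWillmoreWith (gauge (r 1) 0) (image rInf L10) (image (r 0) L01)
      (qHat (r 0) rInf q) V := by
  have hreal := isManifold_real (M := M)
  obtain ⟨B, hBs, hBd, hBr⟩ := hext
  have hB1 : B 1 = gauge (r 1) 0 := by rw [hBr 1 one_ne_zero h1, loop_one]
  rw [← hB1]
  have hV4 := hW.central.subbundle
  have hV := hW.central.nondeg
  have hVs := smoothOn_projV hV4 hV
  have hi10 := hW.surface.isotropic10
  have hi01 := hW.surface.isotropic01
  have hV10 : ∀ x, L10 x ≤ V x := fun x => le_sup_left.trans (hW.central.sup_le x)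
  have hV01 : ∀ x, L01 x ≤ V x := fun x => le_sup_right.trans (hW.central.sup_le x)
  have hm10 := hW.mult10
  have hm01 := hW.mult01
  have hN10 := hW.central.formN10
  have hN01 := hW.central.formN01
  have hc10 := hW.surface.cov10
  have hc01 := hW.surface.cov01
  simp only [part10_eq, part01_eq, cov_zero] at hm10 hm01 hN10 hN01 hc10 hc01
  have hΛ := hW.surface.subbundle_inf
  have hΛ' : IsSubbundle 1 fun x => L01 x ⊓ L10 x := by simpa only [inf_comm] using hΛ
  -- the two ends of the dressing family
  have hP0 : atInfinity r rInf 0 = rInf := atInfinity_zero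
  have hRh := hr.holoFamily h0
  have hPh := hr.holoFamily_atInfinity
  have hRt := IsRationalOrthogonal.twistedNear htw h0
  have hPt := hr.twistedNear_atInfinity htw
  have hR0s := hRh.smooth_zero
  have hP0s := hPh.smooth_zero
  have hR0c := hRt.commute hV
  have hP0c := hPt.commute hV
  have hRo := hr.orthogonal 0 h0
  have hPo := hr.orthogonal_inf
  rw [hP0] at hP0s hP0c
  have hqc10 : ∀ x X, projV V x * typePart I q x X = typePart I q x X * projV V x := fun x X =>
    (hV x).commute_of_mem_wedgeSq (Submodule.mem_sup_left (wedgeSq_mono (hV01 x) (hm10 x X)))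
  have hqc01 : ∀ x X, projV V x * typePart (-I) q x X = typePart (-I) q x X * projV V x :=
    fun x X =>
      (hV x).commute_of_mem_wedgeSq (Submodule.mem_sup_left (wedgeSq_mono (hV10 x) (hm01 x X)))
  have hnear0 : ∀ᶠ l in 𝓝[≠] (0 : ℂ), B l = gauge (r l) (loop 0 V q l) := by
    filter_upwards [(eventually_notMem h0).filter_mono nhdsWithin_le_nhds, self_mem_nhdsWithin]
      with l hl hl0 using hBr l hl0 hl
  have hnearInf : ∀ᶠ m in 𝓝[≠] (0 : ℂ), B m⁻¹ = gauge (atInfinity r rInf m) (loop 0 V q m⁻¹) := by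
    filter_upwards [eventually_inv_notMem poles, self_mem_nhdsWithin] with m hm hm0
    rw [atInfinity_of_ne hm0, hBr _ (inv_ne_zero hm0) hm]
  have half10 := dressed_half (c := I) hV hVs hRh hPh hRt hPt hqc10 (α := loop 0 V q)
    (fun l _ x X => typePart_I_loop_apply l x X) hBd hnear0 hnearInf
  -- In the parameter λ⁻¹ the (0,1)-part has its pole at 0, so r(∞) takes the role of r(0), and
  -- conversely.
  have half01 := dressed_half (c := -I) hV hVs hPh hRh hPt hRt hqc01
    (α := fun l => loop 0 V q l⁻¹) (B := fun l => B l⁻¹)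
    (fun l _ x X => by rw [typePart_neg_I_loop_apply, inv_pow])
    (fun x X => (hBd x X).comp differentiableOn_inv fun l hl => inv_ne_zero hl)
    hnearInf (by simpa only [inv_inv] using hnear0)
  simp only [hP0, inv_one] at half10 half01
  set A := B 1 with hA
  have hAs : SmoothForm A := (hBs 1 one_ne_zero).1
  -- the multiplier
  have hq10 : typePart I (qHat (r 0) rInf q) = Ad (r 0) (typePart I q) := by
    rw [qHat, typePart_add, part10_eq, part01_eq]
    funext x; ext1 X
    rw [Pi.add_apply, add_apply, typePart_Ad_apply, typePart_Ad_apply,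
      typePart_typePart I_mul_I, typePart_neg_typePart I_mul_I, Pi.zero_apply, zero_apply, zero_mul,
      mul_zero, add_zero, Ad_apply]
  have hq01 : typePart (-I) (qHat (r 0) rInf q) = Ad rInf (typePart (-I) q) := by
    have h2 := typePart_neg_typePart neg_I_mul_neg_I q
    rw [neg_neg] at h2
    rw [qHat, typePart_add, part10_eq, part01_eq]
    funext x; ext1 X
    rw [Pi.add_apply, add_apply, typePart_Ad_apply, typePart_Ad_apply,
      typePart_typePart neg_I_mul_neg_I, h2, Pi.zero_apply, zero_apply, zero_mul,
      mul_zero, zero_add, Ad_apply]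
  have hqs : SmoothForm (qHat (r 0) rInf q) :=
    ((hW.harmonic.smooth.typePart I).Ad hR0s).add (by
      rw [part01_eq]; exact (hW.harmonic.smooth.typePart (-I)).Ad hP0s)
  have hloop : ∀ l, l ≠ 0 → B l = loop A V (qHat (r 0) rInf q) l := fun l hl => by
    refine ext_typePart (fun x X => ?_) fun x X => ?_
    · obtain ⟨_, _, _, _, _, h⟩ := half10 x X
      rw [h l hl, typePart_I_loop_apply, hq10]
    · obtain ⟨_, _, _, _, _, h⟩ := half01 x X
      have h2 := h l⁻¹ (inv_ne_zero hl)
      rw [inv_inv, inv_pow, inv_inv] at h2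
      rw [h2, typePart_neg_I_loop_apply, hq01]
  have hflat : ∀ l, l ≠ 0 → l ∉ poles → IsFlat (loop A V (qHat (r 0) rInf q) l) :=
    fun l hl hlp => by
      rw [← hloop l hl, hBr l hl hlp]
      exact (hW.harmonic.flat l hl).gauge (hr.smooth hlp)
        (SmoothForm.loop hVs SmoothForm.zero hW.harmonic.smooth l)
  have himV : ∀ x, image rInf V x = V x := fun x => congrFun (image_eq_of_commute hV hP0c) x
  have himV' : ∀ x, image (r 0) V x = V x := fun x => congrFun (image_eq_of_commute hV hR0c) x
  have hle10 : ∀ x, image rInf L10 x ≤ V x := fun x =>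
    (Submodule.map_mono (hV10 x)).trans (himV x).le
  have hle01 : ∀ x, image (r 0) L01 x ≤ V x := fun x =>
    (Submodule.map_mono (hV01 x)).trans (himV' x).le
  have hqm10 : ∀ x X, typePart I (qHat (r 0) rInf q) x X ∈ wedgeSq (image (r 0) L01 x) :=
    fun x X => by rw [hq10]; exact (hRo x).conj_mem_wedgeSq (hm10 x X)
  have hqm01 : ∀ x X, typePart (-I) (qHat (r 0) rInf q) x X ∈ wedgeSq (image rInf L10 x) :=
    fun x X => by rw [hq01]; exact (hPo x).conj_mem_wedgeSq (hm01 x X)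
  have hN10' : ∀ x X, ∀ u ∈ image (r 0) L01 x, typePart I (formN A V) x X u = 0 := by
    rintro x X _ ⟨u, hu, rfl⟩
    obtain ⟨R', S', hS', _, hN', _⟩ := half10 x X
    exact dressed_formN_apply_eq_zero hV hRt hS' hN' (hV01 x hu) (hN10 x X u hu)
      (wedgeSq_apply_eq_zero (hm10 x X) ((hi01 x).le_perp hu)) fun v hv =>
      wedgeSq_apply_eq_zero (hm10 x X) (perp_anti (hV01 x) hv)
  have hN01' : ∀ x X, ∀ u ∈ image rInf L10 x, typePart (-I) (formN A V) x X u = 0 := by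
    rintro x X _ ⟨u, hu, rfl⟩
    obtain ⟨R', S', hS', _, hN', _⟩ := half01 x X
    rw [← hP0] at hN' ⊢
    exact dressed_formN_apply_eq_zero hV hPt hS' hN' (hV10 x hu) (hN01 x X u hu)
      (wedgeSq_apply_eq_zero (hm01 x X) ((hi10 x).le_perp hu)) fun v hv =>
      wedgeSq_apply_eq_zero (hm01 x X) (perp_anti (hV10 x) hv)
  have hmem : ∀ {g : M → E n ≃L[ℂ] E n} (x), (∀ y, image g V y = V y) → ∀ v ∈ V x, g x v ∈ V x :=
    fun x h v hv => (h x).le (Submodule.mem_map_of_mem hv)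
  refine ⟨⟨hW.surface.subbundle10.image hP0s, hW.surface.subbundle01.image hR0s,
    fun x => (hPo x).isotropic_map (hi10 x), fun x => (hRo x).isotropic_map (hi01 x), ?_, ?_, ?_⟩,
    ⟨hV4, hV, fun x => sup_le (hle10 x) (hle01 x), hN10', ?_⟩,
    ⟨⟨4, hV4⟩, hV, hqs, ?_, ?_⟩, hqm10, ?_⟩
  · refine IsSubbundle.inf (hW.surface.subbundle10.image hP0s) (hW.surface.subbundle01.image hR0s)
      (fun x => (hRo x).isotropic_map (hi01 x)) fun x => ?_
    exact MeetInLine.of_isometry (hV x) (hV4.finrank_eq x) (hi10 x) (hi01 x) (hV10 x) (hV01 x)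
      (hW.surface.subbundle10.finrank_eq x) (hW.surface.subbundle01.finrank_eq x)
      (hΛ.finrank_eq x) (hPo x) (hRo x) (hmem x himV) (hmem x himV') (hdet x).symm
  · intro U s hU hs hsL x hx X
    exact dressed_cov_mem hV4 hV hW.surface.subbundle10 hi10 hi01 hV10 hV01 hΛ hc10 hm10 hP0s
      (fun x X => by obtain ⟨_, _, _, h, _⟩ := half10 x X; exact h) hN10' hU hs hsL hx X
  · intro U s hU hs hsL x hx X
    rw [part01_eq]
    exact dressed_cov_mem hV4 hV hW.surface.subbundle01 hi01 hi10 hV01 hV10 hΛ'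
      (fun U s hU hs hsL => hc01 U s hU hs fun x hx => (hsL x hx).symm) hm01 hR0s
      (fun x X => by obtain ⟨_, _, _, h, _⟩ := half01 x X; exact h) hN01' hU hs
      (fun x hx => (hsL x hx).symm) hx X
  · rw [part01_eq]; exact hN01'
  · intro x X
    have h2 := typePart_add_neg I (qHat (r 0) rInf q)
    rw [← h2]
    exact Submodule.add_mem _ (Submodule.mem_sup_left (wedgeSq_mono (hle01 x) (hqm10 x X)))
      (Submodule.mem_sup_left (wedgeSq_mono (hle10 x) (hqm01 x X)))
  · intro l hl
    by_cases hlp : l ∈ poles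
    · refine IsFlat.loop_of_eventually hVs hAs hqs hl ?_
      have h2 : ∀ᶠ k in 𝓝[≠] l, k ∉ poles := by
        rw [eventually_nhdsWithin_iff]
        -- The poles are isolated, so nearby parameters other than `l` itself avoid them.
        have h3 : ((poles.erase l : Finset ℂ) : Set ℂ)ᶜ ∈ 𝓝 l :=
          (poles.erase l).finite_toSet.isClosed.isOpen_compl.mem_nhds (by simp)
        filter_upwards [h3] with k hk hkl hkp
        exact hk (Finset.mem_coe.2 (Finset.mem_erase.2 ⟨hkl, hkp⟩))
      filter_upwards [h2, eventually_ne_nhdsWithin hl] with k hk hk0 using hflat k hk0 hk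
    · exact hflat l hl hlp
  · rw [part01_eq]; exact hqm01

end DressingTransform

/-! ### Covariance under bundle automorphisms -/

section Covariance

open Complex

section Algebra

variable {A : Type*} [Ring A]

theorem gauge_covEnd_aux {F K dK p δ a : A} (hKF : K * F = 1) :
    (-(F * dK * F) * (p * K) + F * (δ * K + p * dK)) + F * (dK + a * K) * (F * p * K) =
      F * ((δ + a * p) * K + p * dK) := by
  have h : F * (dK + a * K) * (F * p * K) = F * dK * F * (p * K) + F * a * (K * F) * p * K := by
    noncomm_ring
  rw [h, hKF]
  noncomm_ring

/-- The sum starting with `-(F * dK * F)` is the derivative of FpK. The terms in `dK` recombine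
through p² + (1 - p)² = 1, so projecting commutes with gauging. -/
theorem gauge_connD_aux {F K dK p δ a : A} (hKF : K * F = 1) (hp : p * p = p) :
    F * p * K * ((-(F * dK * F) * (p * K) + F * (δ * K + p * dK)) +
        F * (dK + a * K) * (F * p * K)) +
      (1 - F * p * K) * (-(-(F * dK * F) * (p * K) + F * (δ * K + p * dK)) +
        F * (dK + a * K) * (1 - F * p * K)) =
      F * (dK + (p * (δ + a * p) + (1 - p) * (-δ + a * (1 - p))) * K) := by
  have h1 := gauge_covEnd_aux (F := F) (dK := dK) (p := p) (δ := δ) (a := a) hKF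
  have h2 : -(-(F * dK * F) * (p * K) + F * (δ * K + p * dK)) +
        F * (dK + a * K) * (1 - F * p * K) = F * ((1 - p) * dK + (-δ + a * (1 - p)) * K) := by
    have h3 : ∀ u v w : A, -u + v * (1 - w) = v - (u + v * w) := fun u v w => by noncomm_ring
    rw [h3, h1]
    noncomm_ring
  rw [h1, h2]
  have h4 : ∀ u : A, F * p * K * (F * u) = F * (p * u) := fun u => by
    rw [mul_assoc (F * p), ← mul_assoc K, hKF, one_mul, mul_assoc]
  rw [sub_mul, one_mul, h4, h4]
  have h5 : ∀ u v : A, F * (p * (u + p * dK)) + (F * ((1 - p) * dK + v) -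
      F * (p * ((1 - p) * dK + v))) = F * (dK + (p * u + (1 - p) * v)) +
        (F * (p * p) * dK + F * (p * p) * dK - F * p * dK - F * p * dK) := fun u v => by
    noncomm_ring
  rw [h5, hp]
  noncomm_ring

theorem gauge_inv_aux {F K dF : A} (hKF : K * F = 1) :
    K * (dF + F * (-(K * dF * K) + 0 * K) * F) = 0 := by
  have h : K * (dF + F * (-(K * dF * K) + 0 * K) * F) =
      K * dF - (K * F) * K * dF * (K * F) := by noncomm_ring
  rw [h, hKF]
  noncomm_ring

theorem gauge_combination [Algebra ℂ A] (F K k d N q : A) (a b : ℂ) :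
    F * (k + d * K) + a • (F * (N * K)) + b • (F * (q * K)) =
      F * (k + (d + a • N + b • q) * K) := by
  simp only [mul_add, add_mul, smul_mul_assoc, mul_smul_comm]
  abel

end Algebra

variable {g : M → E n ≃L[ℂ] E n} {V : M → Submodule ℂ (E n)} {A q : OneForm M (EndE n)}

theorem inv_inv_eq (g : M → E n ≃L[ℂ] E n) : inv (inv g) = g := rfl

theorem diff_toEnd (hg : SmoothOn (toEnd g) Set.univ) (x : M) (X) :
    diff (toEnd g) x X = -(toEnd g x * diff (toEnd (inv g)) x X * toEnd g x) :=
  diff_toEnd_inv (g := inv g) hg.toEnd_inv x X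

theorem gauge_inv_gauge_zero (hg : SmoothOn (toEnd g) Set.univ) :
    gauge (inv g) (gauge g 0) = 0 := by
  funext x; ext1 X
  rw [gauge_apply, gauge_apply, inv_inv_eq, diff_toEnd_inv hg]
  exact gauge_inv_aux (A := EndE n) (toEnd_inv_mul_toEnd g x)

theorem projV_image (hg : ∀ x, Orthogonal (g x)) (hV : ∀ x, Nondeg (V x)) :
    projV (image g V) = toEnd g * (projV V * toEnd (inv g)) := by
  funext x
  exact ((hg x).proj_map (hV x)).trans (mul_assoc _ _ _)

theorem connD_gauge (hgs : SmoothOn (toEnd g) Set.univ) (hg : ∀ x, Orthogonal (g x))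
    (hV : ∀ x, Nondeg (V x)) (hVs : SmoothOn (projV V) Set.univ) :
    connD (gauge g A) (image g V) = gauge g (connD A V) := by
  have hVK : SmoothOn (projV V * toEnd (inv g)) Set.univ := hVs.mul hgs.toEnd_inv
  have hP := projV_image hg hV
  have hPs : SmoothOn (projV (image g V)) Set.univ := by rw [hP]; exact hgs.mul hVK
  funext x; ext1 X
  have hd : diff (projV (image g V)) x X =
      diff (toEnd g) x X * (projV V x * toEnd (inv g) x) + toEnd g x *
        (diff (projV V) x X * toEnd (inv g) x + projV V x * diff (toEnd (inv g)) x X) := by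
    rw [hP]
    exact (diff_mul (hgs.diffAt isOpen_univ (Set.mem_univ x))
      (hVK.diffAt isOpen_univ (Set.mem_univ x)) X).trans (congrArg _ (congrArg _
      (diff_mul (hVs.diffAt isOpen_univ (Set.mem_univ x))
        (hgs.toEnd_inv.diffAt isOpen_univ (Set.mem_univ x)) X)))
  have hPx : projV (image g V) x = toEnd g x * projV V x * toEnd (inv g) x :=
    (hg x).proj_map (hV x)
  rw [connD_apply _ hPs, gauge_apply, gauge_apply, connD_apply _ hVs, hd, hPx, diff_toEnd hgs]
  exact gauge_connD_aux (A := EndE n) (toEnd_inv_mul_toEnd g x) (hV x).proj_mul_proj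

theorem formN_gauge (hgs : SmoothOn (toEnd g) Set.univ) (hg : ∀ x, Orthogonal (g x))
    (hV : ∀ x, Nondeg (V x)) (hVs : SmoothOn (projV V) Set.univ) :
    formN (gauge g A) (image g V) = Ad g (formN A V) := by
  rw [formN, connD_gauge hgs hg hV hVs]
  funext x; ext1 X
  have h : ∀ {R : Type _} [Ring R] (F K k a d : R),
      F * (k + a * K) - F * (k + d * K) = F * ((a - d) * K) := fun F K k a d => by noncomm_ring
  exact h (R := EndE n) _ _ _ _ _

theorem loop_gauge (hgs : SmoothOn (toEnd g) Set.univ) (hg : ∀ x, Orthogonal (g x))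
    (hV : ∀ x, Nondeg (V x)) (hVs : SmoothOn (projV V) Set.univ) (l : ℂ) :
    loop (gauge g A) (image g V) (Ad g q) l = gauge g (loop A V q l) := by
  refine ext_typePart (fun x X => ?_) fun x X => ?_
  · rw [typePart_gauge_apply, typePart_I_loop_apply, typePart_I_loop_apply,
      connD_gauge hgs hg hV hVs, formN_gauge hgs hg hV hVs, typePart_gauge_apply,
      typePart_Ad_apply, typePart_Ad_apply]
    exact gauge_combination (A := EndE n) _ _ _ _ _ _ _ _
  · rw [typePart_gauge_apply, typePart_neg_I_loop_apply, typePart_neg_I_loop_apply,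
      connD_gauge hgs hg hV hVs, formN_gauge hgs hg hV hVs, typePart_gauge_apply,
      typePart_Ad_apply, typePart_Ad_apply]
    exact gauge_combination (A := EndE n) _ _ _ _ _ _ _ _

theorem typePart_cov_gauge (c : ℂ) (hgs : SmoothOn (toEnd g) Set.univ) {s : M → E n} {x : M}
    (hs : DiffAt s x) (X) : typePart c (cov (gauge g A) s) x X =
      g x (typePart c (cov A fun y => toEnd (inv g) y (s y)) x X) := by
  rw [typePart_cov_apply, typePart_cov_apply, typePart_gauge_apply,
    typePart_diff_app c (hgs.toEnd_inv.diffAt isOpen_univ (Set.mem_univ x)) hs]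
  have h : typePart c (diff s) x X =
      toEnd g x (toEnd (inv g) x (typePart c (diff s) x X)) := by simp [toEnd, inv]
  conv_lhs => lhs; rw [h]
  change toEnd g x _ + toEnd g x (_ + _) = toEnd g x _
  rw [← map_add]
  refine congrArg (toEnd g x) ?_
  rw [← add_assoc, add_comm (toEnd (inv g) x _)]
  rfl

variable [IsManifold 𝓘(ℂ) ω M]

theorem IsSurface.gauge {L10 L01 : M → Submodule ℂ (E n)} (h : IsSurface A L10 L01)
    (hgs : SmoothOn (toEnd g) Set.univ) (hg : ∀ x, Orthogonal (g x)) :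
    IsSurface (gauge g A) (image g L10) (image g L01) := by
  have hinf : (fun x => image g L10 x ⊓ image g L01 x) = image g fun x => L10 x ⊓ L01 x :=
    funext fun x => (Submodule.map_inf _ (g x).injective).symm
  have hmem : ∀ {U : Set M} {s : M → E n}, (∀ x ∈ U, s x ∈ image g L10 x ⊓ image g L01 x) →
      ∀ x ∈ U, toEnd (inv g) x (s x) ∈ L10 x ⊓ L01 x := fun hs x hx =>
    ⟨mem_map_iff.1 (hs x hx).1, mem_map_iff.1 (hs x hx).2⟩
  refine ⟨h.subbundle10.image hgs, h.subbundle01.image hgs,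
    fun x => (hg x).isotropic_map (h.isotropic10 x),
    fun x => (hg x).isotropic_map (h.isotropic01 x), hinf ▸ h.subbundle_inf.image hgs, ?_, ?_⟩
  · intro U s hU hs hsL x hx X
    rw [part10_eq, typePart_cov_gauge I hgs (hs.diffAt hU hx)]
    exact Submodule.mem_map_of_mem (h.cov10 U _ hU
      ((hgs.toEnd_inv.mono (Set.subset_univ U)).app hs) (hmem hsL) x hx X)
  · intro U s hU hs hsL x hx X
    rw [part01_eq, typePart_cov_gauge (-I) hgs (hs.diffAt hU hx), ← part01_eq]
    exact Submodule.mem_map_of_mem (h.cov01 U _ hU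
      ((hgs.toEnd_inv.mono (Set.subset_univ U)).app hs) (hmem hsL) x hx X)

/-- Under an orthogonal gauge 𝒩_V and `q` are conjugated, while 𝒟_V and the whole associated family
are gauged; each condition is thus carried to its counterpart. -/
theorem IsConstrainedWillmoreWith.gauge {L10 L01 : M → Submodule ℂ (E n)} (hA : SmoothForm A)
    (h : IsConstrainedWillmoreWith A L10 L01 q V)
    (hgs : SmoothOn (toEnd g) Set.univ) (hg : ∀ x, Orthogonal (g x)) :
    IsConstrainedWillmoreWith (gauge g A) (image g L10) (image g L01) (Ad g q) (image g V) := by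
  have hreal := isManifold_real (M := M)
  have hV := h.central.nondeg
  have hVs := smoothOn_projV h.central.subbundle hV
  have hN := formN_gauge (A := A) hgs hg hV hVs
  have hnd : ∀ x, Nondeg (image g V x) := fun x => (hg x).nondeg_map (hV x)
  have hAd : ∀ (α : OneForm M (EndE n)) (x X) (u : E n), Ad g α x X (g x u) = g x (α x X u) :=
    fun α x X u => by
      change g x (α x X ((g x).symm (g x u))) = _
      rw [(g x).symm_apply_apply]
  have hq10 : part10 (Ad g q) = Ad g (part10 q) := by
    funext x; ext1 X
    rw [part10_eq, part10_eq, typePart_Ad_apply, Ad_apply]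
  have hq01 : part01 (Ad g q) = Ad g (part01 q) := by
    funext x; ext1 X
    rw [part01_eq, part01_eq, typePart_Ad_apply, Ad_apply]
  have hN10 : part10 (formN (Dressing.gauge g A) (image g V)) = Ad g (part10 (formN A V)) := by
    rw [hN]
    funext x; ext1 X
    rw [part10_eq, part10_eq, typePart_Ad_apply, Ad_apply]
  have hN01 : part01 (formN (Dressing.gauge g A) (image g V)) = Ad g (part01 (formN A V)) := by
    rw [hN]
    funext x; ext1 X
    rw [part01_eq, part01_eq, typePart_Ad_apply, Ad_apply]
  refine ⟨h.surface.gauge hgs hg, ⟨h.central.subbundle.image hgs, hnd, fun x => ?_, ?_, ?_⟩,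
    ⟨⟨4, h.central.subbundle.image hgs⟩, hnd, h.harmonic.smooth.Ad hgs, fun x X => ?_,
      fun l hl => ?_⟩, fun x X => ?_, fun x X => ?_⟩
  · exact sup_le (Submodule.map_mono (le_sup_left.trans (h.central.sup_le x)))
      (Submodule.map_mono (le_sup_right.trans (h.central.sup_le x)))
  · rintro x X _ ⟨u, hu, rfl⟩
    rw [hN10]
    exact (hAd _ x X u).trans (by rw [h.central.formN10 x X u hu, map_zero])
  · rintro x X _ ⟨u, hu, rfl⟩
    rw [hN01]
    exact (hAd _ x X u).trans (by rw [h.central.formN01 x X u hu, map_zero])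
  · obtain ⟨S, hS, T, hT, hST⟩ := Submodule.mem_sup.1 (h.harmonic.values x X)
    rw [Ad_apply, ← hST, add_mul, mul_add]
    refine Submodule.add_mem _ (Submodule.mem_sup_left ((hg x).conj_mem_wedgeSq hS))
      (Submodule.mem_sup_right ?_)
    have h2 := (hg x).conj_mem_wedgeSq hT
    rw [← (hg x).perp_map] at h2
    exact h2
  · rw [loop_gauge hgs hg hV hVs]
    exact (h.harmonic.flat l hl).gauge hgs (SmoothForm.loop hVs hA h.harmonic.smooth l)
  · rw [hq10]; exact (hg x).conj_mem_wedgeSq (h.mult10 x X)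
  · rw [hq01]; exact (hg x).conj_mem_wedgeSq (h.mult01 x X)

end Covariance

end Dressing

end

theorem mainTheorem3 {n : ℕ} (hn : 3 ≤ n)
    {M : Type*} [TopologicalSpace M] [ChartedSpace ℂ M] [IsManifold 𝓘(ℂ) ω M]
    (L10 L01 V : M → Submodule ℂ (Dressing.E n)) (q : Dressing.OneForm M (Dressing.EndE n))
    (hW : Dressing.IsConstrainedWillmoreWith 0 L10 L01 q V)
    (r : ℂ → M → Dressing.E n ≃L[ℂ] Dressing.E n) (rInf : M → Dressing.E n ≃L[ℂ] Dressing.E n)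
    (poles : Finset ℂ) (h0 : (0 : ℂ) ∉ poles) (h1 : (1 : ℂ) ∉ poles)
    (hr : Dressing.IsRationalOrthogonal r rInf poles)
    (htw : Dressing.IsTwisted V r poles)
    (hext : Dressing.HasHolomorphicExtension (Dressing.loop 0 V q) r poles)
    (hdet : ∀ x, Dressing.detOn (V x) (r 0 x) = Dressing.detOn (V x) (rInf x)) :
    Dressing.IsConstrainedWillmoreWith 0
      (Dressing.image (Dressing.inv (r 1)) (Dressing.image rInf L10))
      (Dressing.image (Dressing.inv (r 1)) (Dressing.image (r 0) L01))
      (Dressing.Ad (Dressing.inv (r 1)) (Dressing.qHat (r 0) rInf q))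
      (Dressing.image (Dressing.inv (r 1)) V) := by
  have hreal := Dressing.isManifold_real (M := M)
  have hs := hr.smooth h1
  -- Gauging the result for r(1)·d by r(1)⁻¹ restores the trivial connection.
  have h := (Dressing.dressed_isConstrainedWillmoreWith hW h0 h1 hr htw hext hdet).gauge
    (Dressing.SmoothForm.gauge hs Dressing.SmoothForm.zero) hs.toEnd_inv
    fun x => (hr.orthogonal 1 h1 x).symm
  rwa [Dressing.gauge_inv_gauge_zero hs] at h
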